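/- Let $\mathcal H$ be a complex separable Hilbert space, $H_0$ a self-adjoint operator on $\mathcal H$ bounded from below, $V\in\mathcal B(\mathcal H)$ relatively compact with respect to $H_0$ (that is, $V(H_0-z)^{-1}$ is compact for some, equivalently every, $z\in\rho(H_0)$), and $H=H_0+V$ with domain $\mathcal D(H_0)$. Write $\langle x\rangle=(1+x^2)^{1/2}$ and, for an open interval $K\subset\mathbb R$ and $a>0$, $S_a(K)=\{z\in\mathbb C:\ \mathrm{Re}\,z\in K,\ 0<|\mathrm{Im}\,z|<a\}$; let $D(K)$ be the space of smooth complex-valued functions on $\mathbb R$ with compact support contained in $K$. For a closed operator $A$ on $\mathcal H$ and an open interval $K$, consider: Hypothesis 1 on $K$: $A$ has only finitely many non-real eigenvalues with real part in $K$. Hypothesis 2 on $K$ with exponent $n>0$: there are $a>0$ and $C>0$ with $S_a(K)\subset\rho(A)$ and $\|(A-z)^{-1}\|\le C|\mathrm{Im}\,z|^{-1}\left(\langle \mathrm{Re}\,z\rangle/|\mathrm{Im}\,z|\right)^{n}$ for all $z\in S_a(K)$. A cut-off is a function $\tau\in C_c^\infty(\mathbb R,\mathbb C)$ equal to $1$ near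 $0$. Put $\chi(x+iy)=\tau(y/\langle x\rangle)$; $\tau$ is admissible for $A$ on $K$ if the support of $\chi$ contains no non-real eigenvalue of $A$ with real part in $K$. For $f\in D(K)$, $N\in\mathbb N$ and $\tau$ admissible, let $\tilde f(x+iy)=\left(\sum_{k=0}^N \frac{f^{(k)}(x)}{k!}(iy)^k\right)\chi(x+iy)$ and $\partial_{\bar z}=\frac12(\partial_x+i\partial_y)$. We say that $f(A)$ is well defined if admissible cut-offs exist and, for every $N>n$ and every admissible $\tau$, the integral $$f(A)=\frac1\pi\int_{\mathbb C}\partial_{\bar z}\tilde f(z)\,(A-z)^{-1}\,dx\,dy$$ converges absolutely in operator norm, with a value that does not depend on $N$ and $\tau$. Let $s_0<s_1$ be real numbers and suppose that $H$ satisfies Hypothesis 1 and Hypothesis 2 with exponent $n$ on $I=(s_0,s_1)$. Let $m\ge1$ be an integer. Then there is $c>0$ with $s_0+c>0$ and $-c\in\rho(H)$ such that, for every $J=(r_0,r_1)$ with $(s_1+c)^{-m}<r_0<r_1<(s_0+c)^{-m}$: (i) the bounded operator $(H+c)^{-m}$ satisfies Hypothesis 1 on $J$ and Hypothesis 2 on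 $J$ with the same exponent $n$; (ii) for every $f\in D(J)$, the function $g_m$ defined by $g_m(\lambda)=f((\lambda+c)^{-m})$ for $\lambda\in I$ and $g_m(\lambda)=0$ for $\lambda\notin I$ belongs to $D(I)$, the operators $f((H+c)^{-m})$ and $g_m(H)$ are well defined (using $J$ and $I$ respectively, and the exponent $n$), and $$f((H+c)^{-m})=g_m(H).$$ -/

import Mathlib

open MeasureTheory TopologicalSpace
open scoped ContDiff

namespace SpecCalc

noncomputable section

variable {E : Type*} [NormedAddCommGroup E] [InnerProductSpace ℂ E]

/-! ### Unbounded operators: eigenvalues, resolvent, relative compactness -/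

/-- `A` is bounded from below: `⟨x, A x⟩ ≥ γ ‖x‖²` on the domain of `A`, for some real `γ`. -/
def BoundedFromBelow (A : E →ₗ.[ℂ] E) : Prop :=
  ∃ γ : ℝ, ∀ x : A.domain, γ * ‖(x : E)‖ ^ 2 ≤ (inner ℂ (x : E) (A x)).re

/-- `lam` is an eigenvalue of `A`. -/
def IsEigenvalue (A : E →ₗ.[ℂ] E) (lam : ℂ) : Prop :=
  ∃ x : A.domain, (x : E) ≠ 0 ∧ A x = lam • (x : E)

/-- `R` is a bounded two-sided inverse of `A - z : D(A) → E`. -/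
def IsResolventAt (A : E →ₗ.[ℂ] E) (z : ℂ) (R : E →L[ℂ] E) : Prop :=
  (∀ y : E, ∃ h : R y ∈ A.domain, A ⟨R y, h⟩ - z • R y = y) ∧
    ∀ x : A.domain, R (A x - z • (x : E)) = x

theorem IsResolventAt.unique {A : E →ₗ.[ℂ] E} {z : ℂ} {R S : E →L[ℂ] E}
    (hR : IsResolventAt A z R) (hS : IsResolventAt A z S) : R = S := by
  ext y
  obtain ⟨h, hy⟩ := hR.1 y
  have h2 := hS.2 ⟨R y, h⟩
  rw [hy] at h2
  exact h2.symm

/-- The resolvent set of `A`. -/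
def rho (A : E →ₗ.[ℂ] E) : Set ℂ := {z | ∃ R : E →L[ℂ] E, IsResolventAt A z R}

open Classical in
/-- The resolvent `(A - z)⁻¹`, for `z` in the resolvent set of `A` (and `0` otherwise). -/
def res (A : E →ₗ.[ℂ] E) (z : ℂ) : E →L[ℂ] E :=
  if h : ∃ R : E →L[ℂ] E, IsResolventAt A z R then h.choose else 0

theorem isResolventAt_res {A : E →ₗ.[ℂ] E} {z : ℂ} (hz : z ∈ rho A) :
    IsResolventAt A z (res A z) := by
  have h : ∃ R : E →L[ℂ] E, IsResolventAt A z R := hz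
  rw [res, dif_pos h]
  exact h.choose_spec

/-- The bounded operator `V` is relatively compact with respect to `A`: the operator
`V (A - z)⁻¹` is compact for some (equivalently, every) `z` in the resolvent set of `A`. -/
def RelativelyCompact (V : E →L[ℂ] E) (A : E →ₗ.[ℂ] E) : Prop :=
  ∃ z ∈ rho A, IsCompactOperator (V ∘L res A z)

/-- The operator `A + V`, with domain `D(A)`. -/
def perturb (A : E →ₗ.[ℂ] E) (V : E →L[ℂ] E) : E →ₗ.[ℂ] E := (V : E →ₗ[ℂ] E) +ᵥ A

/-- A bounded operator, seen as an operator with domain the whole space. -/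
def ofBounded (B : E →L[ℂ] E) : E →ₗ.[ℂ] E := (B : E →ₗ[ℂ] E).toPMap ⊤

/-- The bounded operator `(A + c)^{-m} = ((A - (-c))⁻¹)^m`, for `-c` in the resolvent set. -/
def invPow (A : E →ₗ.[ℂ] E) (c : ℝ) (m : ℕ) : E →L[ℂ] E := res A (-(c : ℂ)) ^ m

/-! ### The two hypotheses -/

/-- The Japanese bracket `⟨x⟩ = (1 + x²)^{1/2}`. -/
def bracket (x : ℝ) : ℝ := Real.sqrt (1 + x ^ 2)

/-- `S_a(I) = {z | Re z ∈ I, 0 < |Im z| < a}`. -/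
def tube (a : ℝ) (I : Set ℝ) : Set ℂ := {z | z.re ∈ I ∧ 0 < |z.im| ∧ |z.im| < a}

/-- First hypothesis for `A` on `I`: finitely many non-real eigenvalues with real part in `I`. -/
def FiniteNonrealEigenvalues (A : E →ₗ.[ℂ] E) (I : Set ℝ) : Prop :=
  {lam : ℂ | IsEigenvalue A lam ∧ lam.im ≠ 0 ∧ lam.re ∈ I}.Finite

/-- Second hypothesis for `A` on `I`, with exponent `n > 0`: on some `S_a(I)`, which lies in the
resolvent set, the resolvent is bounded by `C |Im z|⁻¹ (⟨Re z⟩ / |Im z|)^n`. -/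
def ResolventEstimate (A : E →ₗ.[ℂ] E) (I : Set ℝ) (n : ℝ) : Prop :=
  0 < n ∧ ∃ a > (0 : ℝ), ∃ C > (0 : ℝ), tube a I ⊆ rho A ∧ ∀ z ∈ tube a I,
    ‖res A z‖ ≤ C * |z.im|⁻¹ * (bracket z.re / |z.im|) ^ n

/-! ### The functional calculus -/

/-- `f ∈ D(I)`: smooth, complex valued, with compact support contained in `I`. -/
def IsTestFunction (I : Set ℝ) (f : ℝ → ℂ) : Prop :=
  ContDiff ℝ ∞ f ∧ HasCompactSupport f ∧ tsupport f ⊆ I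

/-- A cut-off function: smooth, compactly supported, equal to `1` near `0`. -/
def IsCutoff (τ : ℝ → ℂ) : Prop :=
  ContDiff ℝ ∞ τ ∧ HasCompactSupport τ ∧ ∃ ε > (0 : ℝ), ∀ s : ℝ, |s| < ε → τ s = 1

/-- `χ(x, y) = τ(y / ⟨x⟩)`. -/
def chi (τ : ℝ → ℂ) (z : ℂ) : ℂ := τ (z.im / bracket z.re)

/-- The almost-analytic extension of `f` of order `N` associated with the cut-off `τ`:
`(∑_{k ≤ N} f^{(k)}(x) (i y)^k / k!) χ(x, y)`. -/
def almostAnalytic (N : ℕ) (τ : ℝ → ℂ) (f : ℝ → ℂ) (z : ℂ) : ℂ :=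
  (∑ k ∈ Finset.range (N + 1),
    iteratedDeriv k f z.re / (k.factorial : ℂ) * (Complex.I * (z.im : ℂ)) ^ k) * chi τ z

/-- `∂F/∂z̄ = (∂F/∂x + i ∂F/∂y) / 2`. -/
def dbar (F : ℂ → ℂ) (z : ℂ) : ℂ :=
  (1 / 2 : ℂ) * (fderiv ℝ F z 1 + Complex.I * fderiv ℝ F z Complex.I)

/-- The cut-off `τ` is admissible for `A` on `I`: the support of `χ` contains no non-real
eigenvalue of `A` whose real part lies in `I`. -/
def IsAdmissible (A : E →ₗ.[ℂ] E) (I : Set ℝ) (τ : ℝ → ℂ) : Prop :=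
  IsCutoff τ ∧
    ∀ lam : ℂ, IsEigenvalue A lam → lam.im ≠ 0 → lam.re ∈ I → lam ∉ tsupport (chi τ)

/-- The integrand `∂f̃/∂z̄ (A - z)⁻¹` of the Helffer-Sjöstrand formula. -/
def hsIntegrand (A : E →ₗ.[ℂ] E) (N : ℕ) (τ : ℝ → ℂ) (f : ℝ → ℂ) (z : ℂ) : E →L[ℂ] E :=
  dbar (almostAnalytic N τ f) z • res A z

/-- `f(A)` is well defined by the Helffer-Sjöstrand formula on `I`, with exponent `n`, and is equal
to `B`: admissible cut-offs exist, and for every admissible cut-off `τ` and every order `N > n` the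
integral of `∂f̃/∂z̄ (A - z)⁻¹` over `ℂ = ℝ²` converges absolutely in operator norm, with
`B = π⁻¹ ∫ ∂f̃/∂z̄ (A - z)⁻¹ dx dy`. Such a `B` is unique. -/
def HasFunctionalCalculus (A : E →ₗ.[ℂ] E) (I : Set ℝ) (n : ℝ) (f : ℝ → ℂ)
    (B : E →L[ℂ] E) : Prop :=
  (∃ τ : ℝ → ℂ, IsAdmissible A I τ) ∧
    ∀ (N : ℕ) (τ : ℝ → ℂ), n < (N : ℝ) → IsAdmissible A I τ →
      Integrable (hsIntegrand A N τ f) (volume : Measure ℂ) ∧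
        B = ((Real.pi : ℂ)⁻¹) • ∫ z : ℂ, hsIntegrand A N τ f z

theorem HasFunctionalCalculus.unique {A : E →ₗ.[ℂ] E} {I : Set ℝ} {n : ℝ} {f : ℝ → ℂ}
    {B C : E →L[ℂ] E} (hB : HasFunctionalCalculus A I n f B)
    (hC : HasFunctionalCalculus A I n f C) : B = C := by
  obtain ⟨τ, hτ⟩ := hB.1
  obtain ⟨N, hN⟩ := exists_nat_gt n
  rw [(hB.2 N τ hN hτ).2, (hC.2 N τ hN hτ).2]

/-- The function `g_m(t) = f((t + c)^{-m})` on `(s₀, s₁)`, extended by `0` to `ℝ`. -/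
def pullback (s₀ s₁ c : ℝ) (m : ℕ) (f : ℝ → ℂ) : ℝ → ℂ :=
  (Set.Ioo s₀ s₁).indicator fun t => f (((t + c) ^ m)⁻¹)

end

end SpecCalc

namespace SpecCalc

open scoped ComplexConjugate

/-! ### Resolvents of unbounded operators, and the Fredholm alternative for relatively compact
perturbations -/

section Resolvent

variable {E : Type*} [NormedAddCommGroup E] [InnerProductSpace ℂ E]

/-! The operator `H` is a bounded perturbation of a semibounded self-adjoint one, so its spectrum
lies in a half-strip. For `c` large the half-strip shifted by `c` lies in the sector `|arg ζ| < π /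
(2 m)`, where `ζ ↦ ζ ^ m` is injective. Then `φ z = (z + c)^{-m}` is a biholomorphic map between a
thin strip around `I` and its image, which contains a complex neighbourhood of `[r₀, r₁]`, and `φ`
is real on the real axis.

Two facts carry the equality of the functional calculi. First (`exists_res_invPow`), `φ'(z) ((H +
c)^{-m} - φ z)⁻¹ = (H - z)⁻¹ + G z` with `G` holomorphic up to and across the real axis. Second,
substituting `w = φ z` in the Helffer-Sjöstrand integral produces the Jacobian `|φ'|² = conj φ' *
φ'`; the factor `conj φ'` turns `∂̄f̃ ∘ φ` into `∂̄(f̃ ∘ φ)`, and `φ'` is absorbed by the resolvent.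
The term with `G` integrates to zero by Stokes (`integral_dbar_smul_eq_zero`). What remains is the
integral for `H` with `f̃ ∘ φ` in place of the almost analytic extension of `g_m`. The two functions
differ by `O(|Im z|^{N+1})` (`exists_bound_taylorExt_comp`), and a Stokes argument that cuts out a
shrinking neighbourhood of the real axis (`integral_dbar_smul_eq_zero_of_bounds`) shows that such a
difference does not change the integral. The same argument gives the independence of `N` and `τ`.

The resolvent estimate passes to `(H + c)^{-m}` because its resolvent at `φ z` is a bounded factor
times an affine function of `(H - z)⁻¹`, and `|Im φ z| ≤ L |Im z|`. Given that estimate, the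
non-real eigenvalues over `J` stay at a positive distance from the real axis. There are finitely
many of them, since `(H + c)^{-m}` is a compact perturbation of the self-adjoint operator `(H₀ +
c)^{-m}` (`finite_eigenvalues_of_add_compact`). That non-real spectrum consists of eigenvalues, by
the Fredholm alternative, is what makes the supports of admissible extensions avoid it. -/

theorem IsResolventAt.res_eq {A : E →ₗ.[ℂ] E} {z : ℂ} {R : E →L[ℂ] E}
    (h : IsResolventAt A z R) : res A z = R :=
  (isResolventAt_res ⟨R, h⟩).unique h

theorem IsEigenvalue.notMem_rho {A : E →ₗ.[ℂ] E} {z : ℂ} (h : IsEigenvalue A z) :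
    z ∉ rho A := by
  rintro ⟨R, hR⟩
  obtain ⟨x, hx, hAx⟩ := h
  have := hR.2 x
  rw [hAx, sub_self, map_zero] at this
  exact hx this.symm

/-- The resolvent of an operator `B` with `B - z = (A - z₀) + K` on the common domain, when
`1 + K (A - z₀)⁻¹` is invertible. -/
theorem IsResolventAt.of_add {A B : E →ₗ.[ℂ] E} {z₀ z : ℂ} {R K : E →L[ℂ] E}
    (hR : IsResolventAt A z₀ R) (hdom : B.domain = A.domain)
    (hK : ∀ (x : E) (hA : x ∈ A.domain) (hB : x ∈ B.domain),
      B ⟨x, hB⟩ - z • x = A ⟨x, hA⟩ - z₀ • x + K x)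
    (hu : IsUnit (1 + K * R)) :
    IsResolventAt B z (R * Ring.inverse (1 + K * R)) := by
  have h1 := Ring.mul_inverse_cancel _ hu
  have h2 := Ring.inverse_mul_cancel _ hu
  set U := Ring.inverse (1 + K * R)
  refine ⟨fun y => ?_, fun x => ?_⟩
  · obtain ⟨h, hy⟩ := hR.1 (U y)
    refine ⟨hdom ▸ h, ?_⟩
    have h3 := hK (R (U y)) h (hdom ▸ h)
    rw [hy] at h3
    have h4 := congrArg (fun S : E →L[ℂ] E => S y) h1
    simp only [mul_apply_eq_comp, _root_.add_apply,
      one_apply_eq_self] at h4 h3 ⊢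
    rw [h3, h4]
  · have hxA : (x : E) ∈ A.domain := hdom ▸ x.2
    have h3 := hR.2 ⟨x, hxA⟩
    have h4 := hK x hxA x.2
    have h5 := congrArg (fun S : E →L[ℂ] E => S (A ⟨x, hxA⟩ - z₀ • (x : E))) h2
    simp only [mul_apply_eq_comp, _root_.add_apply,
      one_apply_eq_self] at h5 h3 ⊢
    rw [h3] at h5
    rw [Subtype.coe_eta] at h4
    rw [h4, h5, h3]

theorem resolvent_identity {A : E →ₗ.[ℂ] E} {z w : ℂ} (hz : z ∈ rho A) (hw : w ∈ rho A) :
    res A z - res A w = (z - w) • (res A z * res A w) := by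
  ext y
  obtain ⟨h, hy⟩ := (isResolventAt_res hw).1 y
  have h2 := (isResolventAt_res hz).2 ⟨_, h⟩
  rw [sub_eq_iff_eq_add] at hy
  simp only [hy, map_sub, map_add, map_smul] at h2
  simp only [_root_.sub_apply, _root_.smul_apply,
    mul_apply_eq_comp, sub_smul]
  rw [← sub_eq_zero] at h2 ⊢
  refine Eq.trans ?_ h2
  module

variable [CompleteSpace E]

omit [CompleteSpace E] in
theorem IsResolventAt.of_near {A : E →ₗ.[ℂ] E} {z₀ z : ℂ} {R : E →L[ℂ] E}
    (hR : IsResolventAt A z₀ R) (hu : IsUnit (1 + (-(z - z₀) • (1 : E →L[ℂ] E)) * R)) :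
    IsResolventAt A z (R * Ring.inverse (1 + (-(z - z₀) • (1 : E →L[ℂ] E)) * R)) := by
  refine hR.of_add rfl (fun x hA hB => ?_) hu
  simp only [_root_.smul_apply, one_apply_eq_self]
  module

theorem eventually_isUnit_one_add (R : E →L[ℂ] E) (z₀ : ℂ) :
    ∀ᶠ z in nhds z₀, IsUnit (1 + (-(z - z₀) • (1 : E →L[ℂ] E)) * R) := by
  have hc : Continuous fun z : ℂ => 1 + (-(z - z₀) • (1 : E →L[ℂ] E)) * R := by fun_prop
  have hopen := (Units.isOpen (R := E →L[ℂ] E)).preimage hc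
  exact hopen.mem_nhds (by simp)

theorem isOpen_rho (A : E →ₗ.[ℂ] E) : IsOpen (rho A) := by
  rw [isOpen_iff_mem_nhds]
  rintro z₀ ⟨R, hR⟩
  filter_upwards [eventually_isUnit_one_add R z₀] with z hz
  exact ⟨_, hR.of_near hz⟩

theorem differentiableOn_res (A : E →ₗ.[ℂ] E) : DifferentiableOn ℂ (res A) (rho A) := by
  rintro z₀ ⟨R, hR⟩
  have hev : res A =ᶠ[nhds z₀]
      fun z => R * Ring.inverse (1 + (-(z - z₀) • (1 : E →L[ℂ] E)) * R) := by
    filter_upwards [eventually_isUnit_one_add R z₀] with z hz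
    exact (hR.of_near hz).res_eq
  refine (DifferentiableAt.congr_of_eventuallyEq ?_ hev).differentiableWithinAt
  refine (differentiableAt_const R).mul ?_
  have h1 : DifferentiableAt ℂ (Ring.inverse : (E →L[ℂ] E) → (E →L[ℂ] E))
      (1 + (-(z₀ - z₀) • (1 : E →L[ℂ] E)) * R) := by
    have := differentiableAt_inverse (𝕜 := ℂ) (R := E →L[ℂ] E) (isUnit_one)
    simpa using this
  exact DifferentiableAt.comp z₀ (f := fun z => 1 + (-(z - z₀) • (1 : E →L[ℂ] E)) * R) h1
    (by fun_prop)

/-- By the resolvent identity `V (A - z)⁻¹` is `V (A - w)⁻¹` followed on the right by a bounded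
factor, so compactness at one point gives it at every point. -/
theorem RelativelyCompact.comp_res {V : E →L[ℂ] E} {A : E →ₗ.[ℂ] E} (h : RelativelyCompact V A)
    {z : ℂ} (hz : z ∈ rho A) : IsCompactOperator (V * res A z) := by
  obtain ⟨w, hw, hc⟩ := h
  have h1 : V * res A z = (V ∘L res A w) ∘L (1 + (z - w) • res A z) := by
    have h2 := resolvent_identity hw hz
    rw [sub_eq_iff_eq_add] at h2
    have h3 : V * res A z = V * (res A w * (1 + (z - w) • res A z)) := by
      congr 1
      rw [mul_add, mul_one, mul_smul_comm]
      rw [← sub_eq_zero] at h2 ⊢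
      refine Eq.trans ?_ (neg_eq_zero.2 h2)
      module
    rw [h3]; rfl
  rw [h1]
  exact hc.comp_clm _

omit [CompleteSpace E] in
theorem perturb_resolvent {A : E →ₗ.[ℂ] E} {V : E →L[ℂ] E} {z : ℂ} {R : E →L[ℂ] E}
    (hR : IsResolventAt A z R) (hu : IsUnit (1 + V * R)) :
    IsResolventAt (perturb A V) z (R * Ring.inverse (1 + V * R)) := by
  refine hR.of_add rfl (fun x hA hB => ?_) hu
  change V x + A ⟨x, hA⟩ - z • x = _
  module

/-- The Fredholm alternative: off the spectrum of `A`, the spectrum of `A + V` consists of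
eigenvalues, for `V` relatively compact. -/
theorem mem_rho_perturb_of_not_isEigenvalue {A : E →ₗ.[ℂ] E} {V : E →L[ℂ] E}
    (hV : RelativelyCompact V A) {z : ℂ} (hz : z ∈ rho A) (he : ¬ IsEigenvalue (perturb A V) z) :
    z ∈ rho (perturb A V) := by
  have hR := isResolventAt_res hz
  refine ⟨_, perturb_resolvent hR ?_⟩
  have hc := hV.comp_res hz
  rcases hc.hasEigenvalue_or_mem_resolventSet (μ := (-1 : ℂ)) (by simp) with h | h
  · exfalso
    apply he
    obtain ⟨y, hy⟩ := h.exists_hasEigenvector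
    have hy1 : V (res A z y) = -y := by
      have := hy.apply_eq_smul
      simpa using this
    obtain ⟨hd, hA⟩ := hR.1 y
    refine ⟨⟨res A z y, hd⟩, ?_, ?_⟩
    · intro h0
      have h0' : res A z y = 0 := h0
      rw [h0', map_zero] at hy1
      exact hy.2 (by simpa using hy1.symm)
    · change V (res A z y) + A ⟨res A z y, hd⟩ = z • res A z y
      rw [hy1, eq_add_of_sub_eq hA]
      abel
  · rw [spectrum.mem_resolventSet_iff] at h
    have h2 : (1 + V * res A z) = -(algebraMap ℂ (E →L[ℂ] E) (-1) - V * res A z) := by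
      simp [add_comm]
    rw [h2]
    exact h.neg

end Resolvent

/-! ### Resolvent bounds for self-adjoint operators and location of the perturbed spectrum -/

section SelfAdjoint

variable {E : Type*} [NormedAddCommGroup E] [InnerProductSpace ℂ E] [CompleteSpace E]

theorem inner_apply_symm {A : E →ₗ.[ℂ] E} (hA : IsSelfAdjoint A) (x y : A.domain) :
    inner ℂ (A x) (y : E) = inner ℂ (x : E) (A y) := by
  have h := LinearPMap.adjoint_isFormalAdjoint hA.dense_domain
  have h' : A.adjoint = A := hA
  rw [h'] at h
  exact h x y

/-- The bound at `z` gives injectivity and, as `A` is closed, a closed range. A vector orthogonal to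
the range lies in the domain of the adjoint, which is `A`, and is an eigenvector for `conj z` unless
it vanishes; the bound at `conj z` excludes this, so the range is everything. -/
theorem exists_isResolventAt_of_selfAdjoint {A : E →ₗ.[ℂ] E} (hA : IsSelfAdjoint A) {z : ℂ} {δ : ℝ}
    (hδ : 0 < δ) (h1 : ∀ x : A.domain, δ * ‖(x : E)‖ ≤ ‖A x - z • (x : E)‖)
    (h2 : ∀ x : A.domain, δ * ‖(x : E)‖ ≤ ‖A x - conj z • (x : E)‖) :
    ∃ R : E →L[ℂ] E, IsResolventAt A z R ∧ ‖R‖ ≤ δ⁻¹ := by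
  let M : A.domain →ₗ[ℂ] E := A.toFun - z • A.domain.subtype
  have hM : ∀ x, M x = A x - z • (x : E) := fun x => rfl
  have hclosed : IsClosed (LinearMap.range M : Set E) := by
    rw [← isSeqClosed_iff_isClosed]
    intro u y hu huy
    choose x hx using hu
    have hcauchy : CauchySeq fun k => (x k : E) := by
      have hc := huy.cauchySeq
      rw [Metric.cauchySeq_iff] at hc ⊢
      intro ε hε
      obtain ⟨N, hN⟩ := hc (δ * ε) (by positivity)
      refine ⟨N, fun p hp q hq => ?_⟩
      have h3 := hN p hp q hq
      rw [dist_eq_norm, ← hx p, ← hx q, ← map_sub, hM] at h3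
      have h4 := (h1 (x p - x q)).trans_lt h3
      rw [dist_eq_norm]
      exact lt_of_mul_lt_mul_left h4 hδ.le
    obtain ⟨x', hx'⟩ := cauchySeq_tendsto_of_complete hcauchy
    have hAx : Filter.Tendsto (fun k => A (x k)) Filter.atTop (nhds (y + z • x')) := by
      have : (fun k => A (x k)) = fun k => u k + z • (x k : E) := by
        funext k
        rw [← hx k, hM]; abel
      rw [this]
      exact huy.add (hx'.const_smul z)
    have hg : (x', y + z • x') ∈ A.graph := by
      have hgc : IsClosed (A.graph : Set (E × E)) := hA.isClosed
      refine hgc.mem_of_tendsto (hx'.prodMk_nhds hAx) (Filter.Eventually.of_forall fun k => ?_)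
      exact A.mem_graph (x k)
    obtain ⟨x'', hx1, hx2⟩ := (A.mem_graph_iff).1 hg
    refine ⟨x'', ?_⟩
    simp only at hx1 hx2
    rw [hM, hx2, hx1]; abel
  have hrange : LinearMap.range M = ⊤ := by
    have : CompleteSpace (LinearMap.range M) := hclosed.completeSpace_coe
    rw [← Submodule.orthogonal_eq_bot_iff, Submodule.eq_bot_iff]
    intro u hu
    rw [Submodule.mem_orthogonal'] at hu
    have hu' : ∀ x : A.domain, inner ℂ (conj z • u) (x : E) = inner ℂ u (A x) := by
      intro x
      have h := hu (M x) ⟨x, rfl⟩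
      rw [hM, inner_sub_right, inner_smul_right, sub_eq_zero] at h
      rw [inner_smul_left, h]; simp
    have hmem : u ∈ A.adjoint.domain := LinearPMap.mem_adjoint_domain_of_exists _ ⟨_, hu'⟩
    have hval := LinearPMap.adjoint_apply_eq hA.dense_domain ⟨u, hmem⟩ hu'
    have h' : A.adjoint = A := hA
    have key : ∀ (B : E →ₗ.[ℂ] E), B = A → ∀ hm : u ∈ B.domain, B ⟨u, hm⟩ = conj z • u → u = 0 := by
      rintro B rfl hm hB
      have := h2 ⟨u, hm⟩
      rw [hB] at this
      simp only [sub_self, norm_zero] at this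
      have h5 : ‖u‖ ≤ 0 := by
        by_contra hcon
        push Not at hcon
        nlinarith [mul_pos hδ hcon]
      exact norm_le_zero_iff.1 h5
    exact key _ h' hmem hval
  have hinj : Function.Injective M := by
    rw [injective_iff_map_eq_zero]
    intro x hx
    have := h1 x
    rw [← hM, hx, norm_zero] at this
    have h5 : ‖(x : E)‖ ≤ 0 := by
      by_contra hcon
      push Not at hcon
      nlinarith [mul_pos hδ hcon]
    exact Subtype.ext (norm_le_zero_iff.1 h5)
  let e := LinearEquiv.ofBijective M ⟨hinj, LinearMap.range_eq_top.1 hrange⟩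
  have hbound : ∀ y, ‖(A.domain.subtype ∘ₗ e.symm.toLinearMap) y‖ ≤ δ⁻¹ * ‖y‖ := by
    intro y
    have h := h1 (e.symm y)
    rw [← hM] at h
    have h3 : M (e.symm y) = y := e.apply_symm_apply y
    rw [h3] at h
    rw [← div_eq_inv_mul, le_div_iff₀' hδ]
    exact h
  refine ⟨LinearMap.mkContinuous _ _ hbound, ⟨fun y => ⟨(e.symm y).2, ?_⟩, fun x => ?_⟩,
    LinearMap.mkContinuous_norm_le _ (by positivity) _⟩
  · exact e.apply_symm_apply y
  · change ((e.symm (M x) : A.domain) : E) = x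
    congr 1
    exact e.symm_apply_apply x

theorem inner_apply_self_im {A : E →ₗ.[ℂ] E} (hA : IsSelfAdjoint A) (x : A.domain) :
    (inner ℂ (x : E) (A x)).im = 0 := by
  have h := inner_apply_symm hA x x
  rw [← inner_conj_symm] at h
  exact Complex.conj_eq_iff_im.1 h

omit [CompleteSpace E] in
theorem mul_norm_le_of_mul_sq_le_inner {a : ℝ} {x y : E}
    (h : a * ‖x‖ ^ 2 ≤ ‖inner ℂ x y‖) : a * ‖x‖ ≤ ‖y‖ := by
  rcases eq_or_ne x 0 with rfl | hx
  · simp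
  · have h1 := h.trans (norm_inner_le_norm x y)
    have : 0 < ‖x‖ := norm_pos_iff.2 hx
    nlinarith

/-- The form `⟨x, A x⟩` is real, so the imaginary part of `⟨x, (A - z) x⟩` is `-Im z ‖x‖²`;
Cauchy-Schwarz does the rest. -/
theorem abs_im_mul_norm_le {A : E →ₗ.[ℂ] E} (hA : IsSelfAdjoint A) (z : ℂ) (x : A.domain) :
    |z.im| * ‖(x : E)‖ ≤ ‖A x - z • (x : E)‖ := by
  apply mul_norm_le_of_mul_sq_le_inner
  refine le_trans ?_ (Complex.abs_im_le_norm _)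
  rw [inner_sub_right, inner_smul_right, inner_self_eq_norm_sq_to_K, Complex.sub_im,
    inner_apply_self_im hA]
  have : (z * ((‖(x : E)‖ : ℂ)) ^ 2).im = z.im * ‖(x : E)‖ ^ 2 := by
    rw [← Complex.ofReal_pow, Complex.im_mul_ofReal]
  erw [this]
  rw [zero_sub, abs_neg, abs_mul, abs_of_nonneg (sq_nonneg ‖(x : E)‖)]

theorem sub_re_mul_norm_le {A : E →ₗ.[ℂ] E} {γ : ℝ}
    (hγ : ∀ x : A.domain, γ * ‖(x : E)‖ ^ 2 ≤ (inner ℂ (x : E) (A x)).re) (z : ℂ) (x : A.domain) :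
    (γ - z.re) * ‖(x : E)‖ ≤ ‖A x - z • (x : E)‖ := by
  apply mul_norm_le_of_mul_sq_le_inner
  refine le_trans ?_ (Complex.re_le_norm _)
  rw [inner_sub_right, inner_smul_right, inner_self_eq_norm_sq_to_K, Complex.sub_re]
  have : (z * ((‖(x : E)‖ : ℂ)) ^ 2).re = z.re * ‖(x : E)‖ ^ 2 := by
    rw [← Complex.ofReal_pow, Complex.re_mul_ofReal]
  erw [this]
  linarith [hγ x]

theorem mem_rho_of_im_ne_zero {A : E →ₗ.[ℂ] E} (hA : IsSelfAdjoint A) {z : ℂ} (hz : z.im ≠ 0) :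
    z ∈ rho A := by
  obtain ⟨R, hR, -⟩ := exists_isResolventAt_of_selfAdjoint hA (abs_pos.2 hz)
    (abs_im_mul_norm_le hA z) (fun x => by simpa using abs_im_mul_norm_le hA (conj z) x)
  exact ⟨R, hR⟩

/-- The spectrum of `A + V` lies in the half-strip `{Re z ≥ γ - ‖V‖, |Im z| ≤ ‖V‖}`, for `A ≥ γ`
self-adjoint and `V` bounded. -/
theorem mem_rho_perturb_of_norm_lt {A : E →ₗ.[ℂ] E} (hA : IsSelfAdjoint A) {γ : ℝ}
    (hγ : ∀ x : A.domain, γ * ‖(x : E)‖ ^ 2 ≤ (inner ℂ (x : E) (A x)).re) (V : E →L[ℂ] E) {z : ℂ}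
    (hz : ‖V‖ < γ - z.re ∨ ‖V‖ < |z.im|) : z ∈ rho A ∧ z ∈ rho (perturb A V) := by
  obtain ⟨δ, hδ, R, hR, hRn⟩ : ∃ δ, ‖V‖ < δ ∧ ∃ R : E →L[ℂ] E, IsResolventAt A z R ∧ ‖R‖ ≤ δ⁻¹ := by
    rcases hz with h | h
    · exact ⟨_, h, exists_isResolventAt_of_selfAdjoint hA ((norm_nonneg V).trans_lt h)
        (sub_re_mul_norm_le hγ z) (fun x => by simpa using sub_re_mul_norm_le hγ (conj z) x)⟩
    · exact ⟨_, h, exists_isResolventAt_of_selfAdjoint hA ((norm_nonneg V).trans_lt h)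
        (abs_im_mul_norm_le hA z) (fun x => by simpa using abs_im_mul_norm_le hA (conj z) x)⟩
  refine ⟨⟨R, hR⟩, _, perturb_resolvent hR ?_⟩
  have hδ0 := (norm_nonneg V).trans_lt hδ
  have h1 : ‖-(V * R)‖ < 1 := by
    rw [norm_neg]
    calc ‖V * R‖ ≤ ‖V‖ * ‖R‖ := norm_mul_le _ _
      _ ≤ ‖V‖ * δ⁻¹ := by gcongr
      _ < 1 := by rwa [← div_eq_mul_inv, div_lt_one hδ0]
  have h2 := (Units.oneSub _ h1).isUnit
  rwa [Units.val_oneSub, sub_neg_eq_add] at h2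

theorem inner_res_symm {A : E →ₗ.[ℂ] E} (hA : IsSelfAdjoint A) {c : ℝ}
    (hc : (c : ℂ) ∈ rho A) (x y : E) :
    inner ℂ (res A c x) y = inner ℂ x (res A c y) := by
  obtain ⟨h1, hx⟩ := (isResolventAt_res hc).1 x
  obtain ⟨h2, hy⟩ := (isResolventAt_res hc).1 y
  have h := inner_apply_symm hA ⟨_, h1⟩ ⟨_, h2⟩
  rw [sub_eq_iff_eq_add.1 hx, sub_eq_iff_eq_add.1 hy, inner_add_left, inner_add_right,
    inner_smul_left, inner_smul_right, Complex.conj_ofReal, add_left_inj] at h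
  exact h.symm

end SelfAdjoint

end SpecCalc

namespace SpecCalc

open Filter Topology

/-! ### Non-real eigenvalues of compact perturbations of symmetric bounded operators -/

section Bounded

variable {E : Type*} [NormedAddCommGroup E] [InnerProductSpace ℂ E]

theorem isResolventAt_ofBounded {B S : E →L[ℂ] E} {z : ℂ}
    (h1 : (B - algebraMap ℂ (E →L[ℂ] E) z) * S = 1)
    (h2 : S * (B - algebraMap ℂ (E →L[ℂ] E) z) = 1) : IsResolventAt (ofBounded B) z S := by
  refine ⟨fun y => ⟨Submodule.mem_top, ?_⟩, fun x => ?_⟩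
  · have := congrArg (fun U : E →L[ℂ] E => U y) h1
    simp only [Algebra.algebraMap_eq_smul_one, mul_apply_eq_comp, _root_.sub_apply,
      _root_.smul_apply, one_apply_eq_self] at this
    exact this
  · have := congrArg (fun U : E →L[ℂ] E => U x) h2
    simp only [Algebra.algebraMap_eq_smul_one, mul_apply_eq_comp, _root_.sub_apply,
      _root_.smul_apply, one_apply_eq_self] at this
    exact this

theorem mem_rho_ofBounded {B : E →L[ℂ] E} {z : ℂ} (h : z ∉ spectrum ℂ B) :
    z ∈ rho (ofBounded B) := by
  rw [spectrum.notMem_iff] at h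
  obtain ⟨u, hu⟩ := h.neg
  rw [neg_sub] at hu
  exact ⟨(u⁻¹ : (E →L[ℂ] E)ˣ), isResolventAt_ofBounded (by rw [← hu]; simp) (by rw [← hu]; simp)⟩

/-- If a bounded operator has real quadratic form modulo a compact operator, its eigenvalues
can only accumulate at the real axis. -/
theorem finite_eigenvalues_of_add_compact [CompleteSpace E] {B S K : E →L[ℂ] E} (hB : B = S + K)
    (hS : ∀ x, (inner ℂ x (S x)).im = 0) (hK : IsCompactOperator K) {δ : ℝ} (hδ : 0 < δ) :
    {lam : ℂ | IsEigenvalue (ofBounded B) lam ∧ δ ≤ |lam.im|}.Finite := by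
  by_contra hinf
  have hinf' : Set.Infinite {lam : ℂ | IsEigenvalue (ofBounded B) lam ∧ δ ≤ |lam.im|} := hinf
  let e := hinf'.natEmbedding
  let lam : ℕ → ℂ := fun k => (e k : ℂ)
  have hlam : Function.Injective lam := Subtype.val_injective.comp e.injective
  have hlamim : ∀ k, δ ≤ |(lam k).im| := fun k => (e k).2.2
  have hev : ∀ k, ∃ x : E, x ≠ 0 ∧ B x = lam k • x := by
    intro k
    obtain ⟨x, hx, hBx⟩ := (e k).2.1
    exact ⟨x, hx, hBx⟩
  choose x hx0 hBx using hev
  have hli : LinearIndependent ℂ x :=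
    Module.End.eigenvectors_linearIndependent' (B : E →ₗ[ℂ] E) lam hlam x fun k =>
      ⟨Module.End.mem_eigenspace_iff.2 (hBx k), hx0 k⟩
  -- The eigenvectors need not be orthogonal. Gram-Schmidt makes `B` triangular on their span, with
  -- the eigenvalues on the diagonal, so that `lam k = ⟨y k, B (y k)⟩`.
  let y := InnerProductSpace.gramSchmidtNormed ℂ x
  have hy : Orthonormal ℂ y := InnerProductSpace.gramSchmidtNormed_orthonormal hli
  have hmem : ∀ k, y k ∈ Submodule.span ℂ (x '' Set.Iic k) := by
    intro k
    rw [← InnerProductSpace.span_gramSchmidt_Iic ℂ x k]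
    exact Submodule.smul_mem _ _ (Submodule.subset_span ⟨k, Set.mem_Iic.2 le_rfl, rfl⟩)
  have hlow : ∀ k, ∀ v ∈ Submodule.span ℂ (x '' Set.Iic k),
      B v - lam k • v ∈ Submodule.span ℂ (x '' Set.Iio k) := by
    intro k v hv
    induction hv using Submodule.span_induction with
    | mem v hv =>
      obtain ⟨j, hj, rfl⟩ := hv
      rw [hBx, ← sub_smul]
      rcases (Set.mem_Iic.1 hj).lt_or_eq with h | rfl
      · exact Submodule.smul_mem _ _ (Submodule.subset_span ⟨j, h, rfl⟩)
      · simp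
    | zero => simp
    | add u v _ _ hu hv =>
      have : B (u + v) - lam k • (u + v) = (B u - lam k • u) + (B v - lam k • v) := by
        rw [map_add]; module
      rw [this]; exact Submodule.add_mem _ hu hv
    | smul a v _ hv =>
      have : B (a • v) - lam k • a • v = a • (B v - lam k • v) := by
        rw [map_smul]; module
      rw [this]; exact Submodule.smul_mem _ _ hv
  have horth : ∀ k, ∀ v ∈ Submodule.span ℂ (x '' Set.Iio k), inner ℂ (y k) v = 0 := by
    intro k v hv
    rw [← InnerProductSpace.span_gramSchmidt_Iio ℂ x k,
      ← InnerProductSpace.span_gramSchmidtNormed x (Set.Iio k)] at hv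
    induction hv using Submodule.span_induction with
    | mem v hv =>
      obtain ⟨j, hj, rfl⟩ := hv
      exact hy.2 (ne_of_gt hj)
    | zero => simp
    | add u v _ _ hu hv => rw [inner_add_right, hu, hv, add_zero]
    | smul a v _ hv => rw [inner_smul_right, hv, mul_zero]
  -- Only `K` contributes to the imaginary part of the diagonal entry `lam k`.
  have hKy : ∀ k, δ ≤ ‖K (y k)‖ := by
    intro k
    have h := horth k _ (hlow k _ (hmem k))
    rw [inner_sub_right, inner_smul_right, inner_self_eq_norm_sq_to_K, hy.1 k, hB,
      _root_.add_apply, inner_add_right, sub_eq_zero] at h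
    have h2 : (lam k).im = (inner ℂ (y k) (K (y k))).im := by
      have := congrArg Complex.im h
      simp only [Complex.add_im, hS, zero_add] at this
      simpa using this.symm
    calc δ ≤ |(lam k).im| := hlamim k
      _ ≤ ‖(inner ℂ (y k) (K (y k)) : ℂ)‖ := h2 ▸ Complex.abs_im_le_norm _
      _ ≤ ‖y k‖ * ‖K (y k)‖ := norm_inner_le_norm _ _
      _ = ‖K (y k)‖ := by rw [hy.1 k, one_mul]
  -- An orthonormal sequence tends weakly to zero (Bessel), so any strong limit point of `K (y k)`
  -- is zero, against the lower bound `δ`.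
  have hcpt := hK.isCompact_closure_image_closedBall 1
  obtain ⟨v, -, φ, hφ, hv⟩ := hcpt.tendsto_subseq (x := fun k => K (y k)) fun k =>
    subset_closure ⟨y k, by simp [hy.1 k], rfl⟩
  have hweak : Tendsto (fun k => inner ℂ (ContinuousLinearMap.adjoint K v) (y k)) atTop (𝓝 0) := by
    have h1 := (hy.inner_products_summable (x := ContinuousLinearMap.adjoint K v)).tendsto_atTop_zero
    rw [tendsto_zero_iff_norm_tendsto_zero]
    have h2 := h1.sqrt
    simp only [Real.sqrt_zero] at h2
    refine h2.congr fun k => ?_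
    rw [Real.sqrt_sq (norm_nonneg _), norm_inner_symm]
  have h1 : Tendsto (fun k => inner ℂ v (K (y (φ k)))) atTop (𝓝 (inner ℂ v v)) :=
    (tendsto_const_nhds (x := v)).inner hv
  have h2 : Tendsto (fun k => inner ℂ v (K (y (φ k)))) atTop (𝓝 0) := by
    refine (hweak.comp hφ.tendsto_atTop).congr fun k => ?_
    simp only [Function.comp_apply]
    rw [ContinuousLinearMap.adjoint_inner_left]
  have hv0 : v = 0 := inner_self_eq_zero.1 (tendsto_nhds_unique h1 h2)
  have h3 := ge_of_tendsto' hv.norm fun k => hKy (φ k)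
  rw [hv0, norm_zero] at h3
  exact absurd h3 (not_le.2 hδ)

end Bounded

/-! ### The operator `(A + c)^{-m}`: sector geometry, resolvent and eigenvalues -/

section InvPow

/-- The sector `{Re ζ > 0, |arg ζ| < π / (2 m)}`, on which `ζ ↦ ζ ^ m` is injective. -/
def sector (m : ℕ) : Set ℂ := {ζ | 0 < ζ.re ∧ |ζ.arg| < Real.pi / (2 * m)}

theorem sector_ne_zero {m : ℕ} {ζ : ℂ} (h : ζ ∈ sector m) : ζ ≠ 0 := by
  rintro rfl
  exact absurd h.1 (by simp)

theorem inv_mem_sector {m : ℕ} {ζ : ℂ} (h : ζ ∈ sector m) : ζ⁻¹ ∈ sector m := by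
  refine ⟨?_, ?_⟩
  · rw [Complex.inv_re]
    exact div_pos h.1 (Complex.normSq_pos.2 (sector_ne_zero h))
  · rw [Complex.abs_arg_inv]
    exact h.2

/-- The argument of `ζ` times `m` stays in `(-π/2, π/2)`, so the principal logarithm has no jump.
This gives both the injectivity of the power and the formula for its inverse. -/
theorem log_pow_of_mem_sector {m : ℕ} (hm : 1 ≤ m) {ζ : ℂ} (h : ζ ∈ sector m) :
    Complex.log (ζ ^ m) = m * Complex.log ζ ∧ |(ζ ^ m).arg| < Real.pi / 2 := by
  have hm' : (0 : ℝ) < m := by exact_mod_cast hm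
  have h1 : |(m * Complex.log ζ).im| < Real.pi / 2 := by
    have : (m * Complex.log ζ).im = m * ζ.arg := by
      rw [← Complex.ofReal_natCast, Complex.im_ofReal_mul, Complex.log_im]
    rw [this, abs_mul, abs_of_pos hm']
    have h2 := mul_lt_mul_of_pos_left h.2 hm'
    calc _ < _ := h2
      _ = _ := by field_simp
  have h3 : Complex.log (ζ ^ m) = m * Complex.log ζ := by
    conv_lhs => rw [← Complex.exp_log (sector_ne_zero h), ← Complex.exp_nat_mul]
    apply Complex.log_exp
    · linarith [(abs_lt.1 h1).1, Real.pi_pos]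
    · linarith [(abs_lt.1 h1).2, Real.pi_pos]
  refine ⟨h3, ?_⟩
  rw [← Complex.log_im, h3]
  exact h1

theorem eq_of_pow_eq_of_mem_sector {m : ℕ} (hm : 1 ≤ m) {ζ η : ℂ} (h : ζ ∈ sector m)
    (h' : η ∈ sector m) (he : ζ ^ m = η ^ m) : ζ = η := by
  have h1 := (log_pow_of_mem_sector hm h).1
  rw [he, (log_pow_of_mem_sector hm h').1] at h1
  have h2 : Complex.log η = Complex.log ζ :=
    mul_left_cancel₀ (by exact_mod_cast (by omega : m ≠ 0)) h1
  rw [← Complex.exp_log (sector_ne_zero h), ← h2, Complex.exp_log (sector_ne_zero h')]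

/-- The half-plane shifted far to the right lies in the sector. -/
theorem exists_forall_mem_sector (m : ℕ) (hm : 1 ≤ m) (a b : ℝ) :
    ∃ c₀ : ℝ, ∀ c ≥ c₀, ∀ z : ℂ, a ≤ z.re → |z.im| ≤ b → z + c ∈ sector m := by
  have hm' : (0 : ℝ) < m := by exact_mod_cast hm
  have hev : ∀ᶠ w in 𝓝 (1 : ℂ), |w.arg| < Real.pi / (2 * m) := by
    refine (Complex.continuousAt_arg (Or.inl (by simp))).abs.eventually_lt_const ?_
    simp only [Complex.arg_one, abs_zero]
    positivity
  obtain ⟨ε, hε, hball⟩ := Metric.eventually_nhds_iff.1 hev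
  -- With this `c` the ratio `|Im z| / (Re z + c)` is below `ε`. Dividing by the positive number `Re
  -- z + c` keeps the argument and puts the point in the ball of radius `ε` around `1`. The summand
  -- `1` gives strict positivity also when `b = 0`.
  refine ⟨1 - a + |b| / ε, fun c hc z hz1 hz2 => ?_⟩
  have hb : b ≤ |b| := le_abs_self b
  have hbε : 0 ≤ |b| / ε := by positivity
  have hre : (z + c).re = z.re + c := by simp
  have him : (z + c).im = z.im := by simp
  have hpos : 1 + |b| / ε ≤ z.re + c := by linarith
  have hpos' : 0 < z.re + c := by linarith
  refine ⟨by rw [hre]; exact hpos', ?_⟩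
  have h1 : z + c = ((z.re + c : ℝ) : ℂ) * (1 + Complex.I * ((z.im / (z.re + c) : ℝ) : ℂ)) := by
    apply Complex.ext
    · simp only [hre, Complex.re_ofReal_mul, Complex.add_re, Complex.one_re, Complex.I_mul_re,
        Complex.ofReal_im]
      ring
    · simp only [him, Complex.im_ofReal_mul, Complex.add_im, Complex.one_im, Complex.I_mul_im,
        Complex.ofReal_re]
      field_simp
      ring
  rw [h1, Complex.arg_real_mul _ hpos']
  apply hball
  rw [dist_eq_norm, add_sub_cancel_left, norm_mul, Complex.norm_I, one_mul, Complex.norm_real,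
    Real.norm_eq_abs, abs_div, abs_of_pos hpos', div_lt_iff₀ hpos']
  calc |z.im| ≤ |b| := hz2.trans hb
    _ = ε * (|b| / ε) := by field_simp
    _ < ε * (z.re + c) := by
        apply mul_lt_mul_of_pos_left _ hε
        linarith

variable {E : Type*} [NormedAddCommGroup E] [InnerProductSpace ℂ E]

/-- The quotient `(T ^ m - t ^ m) / (T - t)`. -/
noncomputable def powQuot (T : E →L[ℂ] E) (m : ℕ) (t : ℂ) : E →L[ℂ] E :=
  ∑ i ∈ Finset.range m, T ^ i * algebraMap ℂ (E →L[ℂ] E) t ^ (m - 1 - i)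

theorem powQuot_mul (T : E →L[ℂ] E) (m : ℕ) (t : ℂ) :
    powQuot T m t * (T - algebraMap ℂ _ t) = T ^ m - algebraMap ℂ _ (t ^ m) := by
  rw [map_pow]
  exact (Algebra.commute_algebraMap_right t T).geom_sum₂_mul m

theorem mul_powQuot (T : E →L[ℂ] E) (m : ℕ) (t : ℂ) :
    (T - algebraMap ℂ _ t) * powQuot T m t = T ^ m - algebraMap ℂ _ (t ^ m) := by
  rw [map_pow]
  exact (Algebra.commute_algebraMap_right t T).mul_geom_sum₂ m

theorem differentiable_powQuot (T : E →L[ℂ] E) (m : ℕ) : Differentiable ℂ (powQuot T m) := by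
  have : Differentiable ℂ fun t : ℂ => algebraMap ℂ (E →L[ℂ] E) t := by
    simp_rw [Algebra.algebraMap_eq_smul_one]
    fun_prop
  unfold powQuot
  fun_prop

/-- By spectral mapping it suffices that the scalar quotient `(μ ^ m - t ^ m) / (μ - t)` has no zero
on the spectrum of `T`. A zero forces `μ ^ m = t ^ m`, hence `μ = t` by injectivity on the sector,
and on the diagonal the quotient equals `m t ^ (m - 1) ≠ 0`. -/
theorem isUnit_powQuot [CompleteSpace E] {T : E →L[ℂ] E} {m : ℕ} (hm : 1 ≤ m) {t : ℂ}
    (ht : t ∈ sector m) (hT : ∀ μ ∈ spectrum ℂ T, μ = 0 ∨ μ ∈ sector m) :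
    IsUnit (powQuot T m t) := by
  nontriviality (E →L[ℂ] E)
  let p : Polynomial ℂ := ∑ i ∈ Finset.range m, Polynomial.X ^ i * Polynomial.C t ^ (m - 1 - i)
  have hp : Polynomial.aeval T p = powQuot T m t := by
    simp [p, powQuot, map_sum, Polynomial.aeval_C]
  rw [← hp, ← spectrum.zero_notMem_iff ℂ,
    spectrum.map_polynomial_aeval_of_nonempty T p (spectrum.nonempty T)]
  rintro ⟨μ, hμ, h0⟩
  have h0' : ∑ i ∈ Finset.range m, μ ^ i * t ^ (m - 1 - i) = 0 := by
    simpa [p, Polynomial.eval_finsetSum] using h0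
  have hpow : μ ^ m = t ^ m := by
    have := (Commute.all μ t).geom_sum₂_mul m
    rw [h0', zero_mul] at this
    exact (sub_eq_zero.1 this.symm)
  have ht0 := sector_ne_zero ht
  rcases hT μ hμ with rfl | h
  · rw [zero_pow (by omega)] at hpow
    exact pow_ne_zero m ht0 hpow.symm
  · obtain rfl := eq_of_pow_eq_of_mem_sector hm h ht hpow
    have h3 : ∀ i ∈ Finset.range m, μ ^ i * μ ^ (m - 1 - i) = μ ^ (m - 1) := by
      intro i hi
      rw [← pow_add]
      congr 1
      have := Finset.mem_range.1 hi
      omega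
    rw [Finset.sum_congr rfl h3, Finset.sum_const, Finset.card_range, nsmul_eq_mul] at h0'
    rcases mul_eq_zero.1 h0' with h4 | h4
    · exact absurd (Nat.cast_eq_zero.1 h4) (by omega)
    · exact pow_ne_zero _ ht0 h4

/-- `T - t = -t T (A - z)` for `T = (A + c)⁻¹`, `t = (z + c)⁻¹`. -/
theorem res_sub_inv_mul {A : E →ₗ.[ℂ] E} {c : ℝ} (hc : -(c : ℂ) ∈ rho A) {z : ℂ} (hz : z ∈ rho A)
    (h0 : z + c ≠ 0) :
    (res A (-c) - algebraMap ℂ _ (z + c)⁻¹) * ((z + c) • 1 + (z + c) ^ 2 • res A z) = -1 ∧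
    ((z + c) • 1 + (z + c) ^ 2 • res A z) * (res A (-c) - algebraMap ℂ _ (z + c)⁻¹) = -1 ∧
    (res A (-c) - algebraMap ℂ _ (z + c)⁻¹) * res A z = -((z + c)⁻¹ • res A (-c)) := by
  have h1 := resolvent_identity hc hz
  have h2 := resolvent_identity hz hc
  have h3 : (-(c : ℂ) - z) = -(z + c) := by ring
  have h4 : (z - -(c : ℂ)) = z + c := by ring
  rw [h3] at h1
  rw [h4] at h2
  set T := res A (-c)
  set r := res A z
  set ζ := z + c
  have h5 : T * r = ζ⁻¹ • (r - T) := by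
    rw [← neg_sub T r, h1, neg_smul, neg_neg, inv_smul_smul₀ h0]
  have h6 : r * T = ζ⁻¹ • (r - T) := by
    rw [h2, inv_smul_smul₀ h0]
  simp only [Algebra.algebraMap_eq_smul_one, sub_mul, mul_sub, mul_add, add_mul, mul_smul_comm,
    smul_mul_assoc, mul_one, one_mul, h5, h6, smul_sub, smul_smul, smul_add]
  have e1 : ζ ^ 2 * ζ⁻¹ = ζ := by field_simp
  have e2 : ζ⁻¹ * ζ ^ 2 = ζ := by field_simp
  have e3 : ζ * ζ⁻¹ = 1 := by field_simp
  have e4 : ζ⁻¹ * ζ = 1 := by field_simp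
  simp only [e1, e2, e3, e4, one_smul]
  refine ⟨?_, ?_, ?_⟩ <;> abel

theorem spectrum_res_subset {A : E →ₗ.[ℂ] E} {c : ℝ} (hc : -(c : ℂ) ∈ rho A) {μ : ℂ}
    (hμ : μ ∈ spectrum ℂ (res A (-c))) : μ = 0 ∨ (μ⁻¹ - c) ∉ rho A := by
  by_contra! h
  obtain ⟨h0, hz⟩ := h
  have h1 : (μ⁻¹ - c) + c ≠ 0 := by simpa using h0
  obtain ⟨h2, h3, -⟩ := res_sub_inv_mul hc hz h1
  rw [sub_add_cancel, inv_inv] at h2 h3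
  refine hμ ?_
  change IsUnit (algebraMap ℂ _ μ - res A (-c))
  refine ⟨⟨_, μ⁻¹ • 1 + μ⁻¹ ^ 2 • res A (μ⁻¹ - c), ?_, ?_⟩, rfl⟩
  · rw [← neg_sub, neg_mul, h2, neg_neg]
  · rw [← neg_sub (res A (-c)), mul_neg, h3, neg_neg]

/-- The resolvent of `(A + c)^{-m}` at `(z + c)^{-m}`, in terms of the resolvent of `A` at `z`: up
to the Jacobian it differs from it by a holomorphic function. -/
theorem exists_res_invPow [CompleteSpace E] {A : E →ₗ.[ℂ] E} {c : ℝ} (hc : -(c : ℂ) ∈ rho A) {m : ℕ}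
    (hm : 1 ≤ m) (hsec : ∀ z : ℂ, z ∉ rho A → z + c ∈ sector m) :
    ∃ G Y : ℂ → E →L[ℂ] E,
      DifferentiableOn ℂ G {z | z + c ∈ sector m} ∧ DifferentiableOn ℂ Y {z | z + c ∈ sector m} ∧
      ∀ z ∈ rho A, z + c ∈ sector m → ((z + c) ^ m)⁻¹ ∈ rho (ofBounded (invPow A c m)) ∧
        res (ofBounded (invPow A c m)) ((z + c) ^ m)⁻¹ =
          -(Y z * ((z + c) • 1 + (z + c) ^ 2 • res A z)) ∧
        (-(m : ℂ) * (z + c)⁻¹ ^ (m + 1)) • res (ofBounded (invPow A c m)) ((z + c) ^ m)⁻¹ =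
          res A z + G z := by
  let T := res A (-c)
  have hT : ∀ μ ∈ spectrum ℂ T, μ = 0 ∨ μ ∈ sector m := by
    intro μ hμ
    rcases spectrum_res_subset hc hμ with h | h
    · exact Or.inl h
    · have := inv_mem_sector (hsec _ h)
      rw [sub_add_cancel, inv_inv] at this
      exact Or.inr this
  -- `Y` inverts the first difference quotient of `T ^ m` at `t = (z + c)⁻¹`. `Q₂` is the second
  -- one: `Q₂ t * (T - t)` is the first quotient minus its diagonal value `m t ^ (m - 1)`. Both are
  -- holomorphic on the sector, and so is `G`, in which no resolvent of `A` at `z` occurs.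
  let Y : ℂ → E →L[ℂ] E := fun z => Ring.inverse (powQuot T m (z + c)⁻¹)
  let Q₂ : ℂ → E →L[ℂ] E := fun t => ∑ j ∈ Finset.range m, t ^ (m - 1 - j) • powQuot T j t
  let G : ℂ → E →L[ℂ] E := fun z =>
    Y z * (((m : ℂ) * (z + c)⁻¹ ^ m) • 1 + (z + c)⁻¹ • (Q₂ (z + c)⁻¹ * T))
  have hinv : DifferentiableOn ℂ (fun z : ℂ => (z + c)⁻¹) {z | z + c ∈ sector m} := by
    intro z hz
    have := sector_ne_zero hz
    have h : DifferentiableAt ℂ (fun z : ℂ => z + c) z := by fun_prop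
    exact (h.inv this).differentiableWithinAt
  have hY : DifferentiableOn ℂ Y {z | z + c ∈ sector m} := by
    intro z hz
    have hu := isUnit_powQuot hm (inv_mem_sector hz) hT
    exact (differentiableAt_inverse (𝕜 := ℂ) hu).comp_differentiableWithinAt z
      ((differentiable_powQuot T m _).comp_differentiableWithinAt z (hinv z hz))
  have hQ₂ : Differentiable ℂ Q₂ := by
    have := fun j => differentiable_powQuot T j
    fun_prop
  refine ⟨G, Y, ?_, hY, fun z hz hzs => ?_⟩
  · refine hY.mul (DifferentiableOn.add ?_ ?_)
    · exact ((hinv.pow m).const_mul _).smul_const _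
    · exact hinv.smul ((hQ₂.comp_differentiableOn hinv).mul_const T)
  have h0 := sector_ne_zero hzs
  obtain ⟨h1, h2, h3⟩ := res_sub_inv_mul hc hz h0
  have hu := isUnit_powQuot hm (inv_mem_sector hzs) hT
  have hu1 := Ring.mul_inverse_cancel _ hu
  have hu2 := Ring.inverse_mul_cancel _ hu
  have hres : IsResolventAt (ofBounded (invPow A c m)) ((z + c) ^ m)⁻¹
      (-(Y z * ((z + c) • 1 + (z + c) ^ 2 • res A z))) := by
    rw [← inv_pow]
    apply isResolventAt_ofBounded
    · change (T ^ m - _) * _ = 1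
      rw [← mul_powQuot, mul_neg, mul_assoc, ← mul_assoc (powQuot T m _), hu1, one_mul, h1, neg_neg]
    · change _ * (T ^ m - _) = 1
      rw [← mul_powQuot, neg_mul, mul_assoc, ← mul_assoc ((z + c) • 1 + _), h2, neg_mul, one_mul,
        mul_neg, neg_neg, hu2]
  refine ⟨⟨_, hres⟩, hres.res_eq, ?_⟩
  rw [hres.res_eq]
  set ζ := z + c
  set t := ζ⁻¹ with ht
  have hQD : Q₂ t * (T - algebraMap ℂ _ t) = powQuot T m t - ((m : ℂ) * t ^ (m - 1)) • 1 := by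
    have h5 : ∀ j ∈ Finset.range m, (t ^ (m - 1 - j) • powQuot T j t) * (T - algebraMap ℂ _ t) =
        T ^ j * algebraMap ℂ (E →L[ℂ] E) t ^ (m - 1 - j) - t ^ (m - 1) • 1 := by
      intro j hj
      have hj' := Finset.mem_range.1 hj
      rw [smul_mul_assoc, powQuot_mul, smul_sub, ← map_pow,
        Algebra.algebraMap_eq_smul_one, Algebra.algebraMap_eq_smul_one, mul_smul_comm, mul_one,
        smul_smul, ← pow_add]
      congr 3
      omega
    simp only [Q₂]
    rw [Finset.sum_mul, Finset.sum_congr rfl h5, Finset.sum_sub_distrib, Finset.sum_const,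
      Finset.card_range, powQuot, ← Nat.cast_smul_eq_nsmul ℂ, smul_smul]
  -- Since `(T - t) (A - z)⁻¹ = -t T` is free of the resolvent at `z`, replacing the quotient by the
  -- scalar `m t ^ (m - 1)` in front of the resolvent costs only a holomorphic term.
  have hQr : powQuot T m t * res A z =
      ((m : ℂ) * t ^ (m - 1)) • res A z - t • (Q₂ t * T) := by
    have h6 := congrArg (fun X => X * res A z) hQD
    simp only [mul_assoc, sub_mul] at h6
    rw [← sub_mul, h3, smul_mul_assoc, one_mul, mul_neg, mul_smul_comm] at h6
    rw [eq_sub_iff_add_eq] at h6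
    rw [← h6]; abel
  have hr : res A z = Y z * (((m : ℂ) * t ^ (m - 1)) • res A z - t • (Q₂ t * T)) := by
    rw [← hQr, ← mul_assoc, hu2, one_mul]
  have hr' : res A z + G z = Y z * (((m : ℂ) * t ^ (m - 1)) • res A z - t • (Q₂ t * T)) + G z := by
    rw [← hr]
  rw [hr']
  simp only [G]
  rw [← mul_add, smul_neg, ← neg_smul, ← mul_smul_comm]
  congr 1
  have e1 : -(-(m : ℂ) * t ^ (m + 1)) * ζ = m * t ^ m := by
    rw [pow_succ, ht]; field_simp
  have e2 : -(-(m : ℂ) * t ^ (m + 1)) * ζ ^ 2 = m * t ^ (m - 1) := by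
    obtain ⟨k, rfl⟩ : ∃ k, m = k + 1 := ⟨m - 1, by omega⟩
    rw [pow_succ, pow_succ, ht, Nat.add_sub_cancel]; field_simp
  rw [smul_add, smul_smul, smul_smul, e1, e2]
  abel

theorem isEigenvalue_invPow {A : E →ₗ.[ℂ] E} {c : ℝ} (hc : -(c : ℂ) ∈ rho A) {lam : ℂ}
    (h : IsEigenvalue A lam) (m : ℕ) :
    IsEigenvalue (ofBounded (invPow A c m)) ((lam + c)⁻¹ ^ m) := by
  obtain ⟨x, hx0, hx⟩ := h
  have h1 := (isResolventAt_res hc).2 x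
  rw [hx, ← sub_smul, map_smul, sub_neg_eq_add] at h1
  have h0 : lam + c ≠ 0 := by
    intro h0
    rw [h0, zero_smul] at h1
    exact hx0 h1.symm
  have h2 : res A (-c) x = (lam + c)⁻¹ • (x : E) := by
    rw [eq_inv_smul_iff₀ h0, h1]
  refine ⟨⟨x, Submodule.mem_top⟩, hx0, ?_⟩
  change (res A (-c) ^ m) x = _
  induction m with
  | zero => simp
  | succ k ih =>
    rw [pow_succ, mul_apply_eq_comp, h2, map_smul, ih, smul_smul, pow_succ, mul_comm]

/-- A non-real spectral point of `T ^ m` is `μ ^ m` with `μ` in the spectrum of `T`, and `μ` is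
non-real because real numbers have real powers. Then `μ⁻¹ - c` is a non-real spectral point of `A`,
hence an eigenvalue, and its eigenvector serves for `T ^ m`. -/
theorem isEigenvalue_or_mem_rho_invPow {A : E →ₗ.[ℂ] E} {c : ℝ} (hc : -(c : ℂ) ∈ rho A) {m : ℕ}
    (hm : 1 ≤ m) [CompleteSpace E]
    (hA : ∀ z : ℂ, z.im ≠ 0 → IsEigenvalue A z ∨ z ∈ rho A) {w : ℂ} (hw : w.im ≠ 0) :
    IsEigenvalue (ofBounded (invPow A c m)) w ∨ w ∈ rho (ofBounded (invPow A c m)) := by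
  by_cases hs : w ∈ spectrum ℂ (invPow A c m)
  · left
    rw [invPow, spectrum.map_pow_of_pos _ (by omega)] at hs
    obtain ⟨μ, hμ, rfl⟩ := hs
    have hμim : μ.im ≠ 0 := by
      intro h
      apply hw
      have : μ = (μ.re : ℂ) := Complex.ext rfl (by simp [h])
      simp only
      rw [this, ← Complex.ofReal_pow, Complex.ofReal_im]
    rcases spectrum_res_subset hc hμ with rfl | h
    · simp at hμim
    · have hlim : (μ⁻¹ - c).im ≠ 0 := by
        have hμ0 : μ ≠ 0 := by rintro rfl; simp at hμim
        simp [Complex.inv_im, hμim, hμ0]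
      have h3 := isEigenvalue_invPow hc ((hA _ hlim).resolve_right h) m
      rwa [sub_add_cancel, inv_inv] at h3
  · exact Or.inr (mem_rho_ofBounded hs)

theorem res_perturb_sub {A : E →ₗ.[ℂ] E} {V : E →L[ℂ] E} {z : ℂ} (h1 : z ∈ rho A)
    (h2 : z ∈ rho (perturb A V)) :
    res (perturb A V) z = res A z + -(res (perturb A V) z * (V * res A z)) := by
  ext y
  obtain ⟨hd, hy⟩ := (isResolventAt_res h1).1 y
  have h3 := (isResolventAt_res h2).2 ⟨res A z y, hd⟩
  have h4 : perturb A V ⟨res A z y, hd⟩ - z • res A z y = V (res A z y) + y := by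
    change V (res A z y) + A ⟨res A z y, hd⟩ - z • res A z y = _
    rw [add_sub_assoc, hy]
  simp only at h3
  rw [h4, map_add] at h3
  simp only [_root_.add_apply, _root_.neg_apply, mul_apply_eq_comp]
  rw [← sub_eq_add_neg, eq_sub_iff_add_eq, add_comm, h3]

/-- The non-real eigenvalues of `(A + V + c)^{-m}` can only accumulate at the real axis. -/
theorem finite_eigenvalues_invPow [CompleteSpace E] {A : E →ₗ.[ℂ] E} (hA : IsSelfAdjoint A)
    {V : E →L[ℂ] E} (hV : RelativelyCompact V A) {c : ℝ} (h1 : -(c : ℂ) ∈ rho A)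
    (h2 : -(c : ℂ) ∈ rho (perturb A V)) (m : ℕ) {δ : ℝ} (hδ : 0 < δ) :
    {lam : ℂ | IsEigenvalue (ofBounded (invPow (perturb A V) c m)) lam ∧ δ ≤ |lam.im|}.Finite := by
  have hc : ((-c : ℝ) : ℂ) ∈ rho A := by simpa using h1
  have hsym : ∀ x y, inner ℂ (res A (-c) x) y = inner ℂ x (res A (-c) y) := by
    simpa using inner_res_symm hA hc
  have hsymm : ∀ (k : ℕ) x y,
      inner ℂ ((res A (-c) ^ k) x) y = inner ℂ x ((res A (-c) ^ k) y) := by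
    intro k
    induction k with
    | zero => simp
    | succ k ih =>
      intro x y
      rw [pow_succ, mul_apply_eq_comp, ih, hsym, ← mul_apply_eq_comp, ← pow_succ', pow_succ]
  have hK : ∀ k : ℕ, IsCompactOperator
      (res (perturb A V) (-c) ^ k - res A (-c) ^ k : E →L[ℂ] E) := by
    intro k
    induction k with
    | zero => simpa using isCompactOperator_zero
    | succ k ih =>
      -- The second resolvent identity is used on the last factor only: this isolates the compact
      -- operator `V * res A (-c)` and leaves the difference of `k`-th powers.
      have h3 : res (perturb A V) (-c) ^ (k + 1) - res A (-c) ^ (k + 1) =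
          -(res (perturb A V) (-c) ^ (k + 1) * (V * res A (-c))) +
            (res (perturb A V) (-c) ^ k - res A (-c) ^ k) * res A (-c) := by
        have h4 := congrArg (fun X => res (perturb A V) (-c) ^ k * X) (res_perturb_sub h1 h2)
        simp only [mul_add, ← pow_succ, mul_neg, ← mul_assoc] at h4
        rw [← mul_assoc, sub_mul, ← pow_succ]
        refine Eq.trans (congrArg (fun X => X - res A (-c) ^ (k + 1)) h4) ?_
        abel
      rw [h3]
      refine IsCompactOperator.add ?_ (ih.comp_clm _)
      exact ((hV.comp_res h1).clm_comp (res (perturb A V) (-c) ^ (k + 1))).neg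
  refine finite_eigenvalues_of_add_compact (S := res A (-c) ^ m)
    (K := res (perturb A V) (-c) ^ m - res A (-c) ^ m) (by rw [invPow]; abel) (fun x => ?_)
    (hK m) hδ
  have h := hsymm m x x
  rw [← inner_conj_symm] at h
  exact Complex.conj_eq_iff_im.1 h

end InvPow

end SpecCalc

namespace SpecCalc

open Filter Topology

/-! ### The operator `∂̄`, integrability near the real axis, and Stokes' theorem -/

section Dbar

theorem dbar_congr {F G : ℂ → ℂ} {z : ℂ} (h : F =ᶠ[𝓝 z] G) : dbar F z = dbar G z := by
  rw [dbar, dbar, h.fderiv_eq]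

theorem continuous_dbar {F : ℂ → ℂ} (hF : ContDiff ℝ 1 F) : Continuous (dbar F) := by
  have := hF.continuous_fderiv (by simp)
  unfold dbar
  fun_prop

theorem dbar_eq_zero_of_notMem {F : ℂ → ℂ} {z : ℂ} (h : z ∉ tsupport F) : dbar F z = 0 := by
  have h1 : fderiv ℝ F z = 0 := by
    by_contra h2
    exact h (tsupport_fderiv_subset ℝ (subset_tsupport _ h2))
  simp [dbar, h1]

theorem tsupport_dbar_subset (F : ℂ → ℂ) : tsupport (dbar F) ⊆ tsupport F := by
  refine closure_minimal (fun z hz => ?_) (isClosed_tsupport F)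
  by_contra h
  exact hz (dbar_eq_zero_of_notMem h)

theorem hasCompactSupport_dbar {F : ℂ → ℂ} (hF : HasCompactSupport F) :
    HasCompactSupport (dbar F) :=
  hF.of_isClosed_subset (isClosed_tsupport _) (tsupport_dbar_subset F)

theorem dbar_sub {F G : ℂ → ℂ} {z : ℂ} (hF : DifferentiableAt ℝ F z)
    (hG : DifferentiableAt ℝ G z) : dbar (fun w => F w - G w) z = dbar F z - dbar G z := by
  rw [dbar, dbar, dbar, fderiv_fun_sub hF hG]
  simp only [_root_.sub_apply]
  ring

theorem dbar_mul {F G : ℂ → ℂ} {z : ℂ} (hF : DifferentiableAt ℝ F z)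
    (hG : DifferentiableAt ℝ G z) :
    dbar (fun w => F w * G w) z = dbar F z * G z + F z * dbar G z := by
  rw [dbar, dbar, dbar, fderiv_fun_mul hF hG]
  simp only [_root_.add_apply, _root_.smul_apply, smul_eq_mul]
  ring

theorem volume_im_eq_zero : volume {z : ℂ | z.im = 0} = 0 := by
  have h := Measure.addHaar_submodule (volume : Measure ℂ) (LinearMap.ker Complex.imLm) (by
    intro h
    have : Complex.I ∈ LinearMap.ker Complex.imLm := h ▸ Submodule.mem_top
    simp at this)
  exact h

theorem ae_im_ne_zero : ∀ᵐ z : ℂ, z.im ≠ 0 := by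
  rw [ae_iff]
  simpa using volume_im_eq_zero

theorem isOpen_im_ne_zero : IsOpen {z : ℂ | z.im ≠ 0} :=
  isOpen_ne.preimage Complex.continuous_im

/-- `|Im z|^s` is locally integrable for `s > -1`. -/
theorem integrableOn_abs_im_rpow {s : ℝ} (hs : -1 < s) {K : Set ℂ} (hK : IsCompact K) :
    IntegrableOn (fun z : ℂ => |z.im| ^ s) K := by
  obtain ⟨R, hR⟩ := hK.isBounded.exists_norm_le
  have h1 : IntegrableOn (fun y : ℝ => |y| ^ s) (Set.Icc (-R) R) := by
    have h2 : IntegrableOn (fun y : ℝ => y ^ s) (Set.Ioc 0 R) := by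
      rcases le_total 0 R with hR0 | hR0
      · exact (intervalIntegrable_iff_integrableOn_Ioc_of_le hR0).1
          (intervalIntegral.intervalIntegrable_rpow' hs)
      · rw [Set.Ioc_eq_empty (not_lt.2 hR0)]; exact integrableOn_empty
    have h3 : Integrable (Set.indicator (Set.Ioc 0 R) fun y : ℝ => y ^ s) :=
      (integrable_indicator_iff measurableSet_Ioc).2 h2
    refine ((h3.add h3.comp_neg).integrableOn (s := Set.Icc (-R) R)).congr ?_
    have h4 : ∀ᵐ y : ℝ, y ≠ 0 := by simp [ae_iff]
    filter_upwards [ae_restrict_of_ae h4, ae_restrict_mem measurableSet_Icc] with y hy0 hy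
    rcases lt_or_gt_of_ne hy0 with h | h
    · have e1 : y ∉ Set.Ioc 0 R := fun h' => absurd h'.1 h.not_gt
      have e2 : -y ∈ Set.Ioc 0 R := ⟨by linarith, by linarith [hy.1]⟩
      simp only [Pi.add_apply, Set.indicator_of_notMem e1, Set.indicator_of_mem e2, zero_add,
        abs_of_neg h]
    · have e1 : -y ∉ Set.Ioc 0 R := fun h' => by linarith [h'.1]
      have e2 : y ∈ Set.Ioc 0 R := ⟨h, hy.2⟩
      simp only [Pi.add_apply, Set.indicator_of_notMem e1, Set.indicator_of_mem e2, add_zero,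
        abs_of_pos h]
  have h5 : IntegrableOn (fun p : ℝ × ℝ => |p.2| ^ s) (Set.Icc (-R) R ×ˢ Set.Icc (-R) R) := by
    rw [IntegrableOn, Measure.volume_eq_prod, ← Measure.prod_restrict]
    exact Integrable.comp_snd h1 _
  have h6 := (Complex.volume_preserving_equiv_real_prod.integrableOn_comp_preimage
    Complex.measurableEquivRealProd.measurableEmbedding).2 h5
  refine IntegrableOn.mono_set h6 fun z hz => ?_
  have h7 := hR z hz
  simp only [Set.mem_preimage, Set.mem_prod, Set.mem_Icc, Complex.measurableEquivRealProd_apply]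
  exact ⟨abs_le.1 ((Complex.abs_re_le_norm z).trans h7),
    abs_le.1 ((Complex.abs_im_le_norm z).trans h7)⟩

variable {B : Type*} [NormedAddCommGroup B] [NormedSpace ℂ B]

theorem continuous_smul_of_tsupport_subset {u : ℂ → ℂ} {G : ℂ → B} {U : Set ℂ} (hU : IsOpen U)
    (hu : Continuous u) (hs : tsupport u ⊆ U) (hG : ContinuousOn G U) :
    Continuous fun z => u z • G z :=
  (hu.continuousOn.smul hG).continuous_of_tsupport_subset hU
    ((tsupport_smul_subset_left u G).trans hs)

theorem integrable_smul_of_tsupport_subset {u : ℂ → ℂ} {G : ℂ → B} {U : Set ℂ} (hU : IsOpen U)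
    (hu : Continuous u) (hc : HasCompactSupport u) (hs : tsupport u ⊆ U) (hG : ContinuousOn G U) :
    Integrable fun z => u z • G z :=
  (continuous_smul_of_tsupport_subset hU hu hs hG).integrable_of_hasCompactSupport hc.smul_right

/-- Stokes' theorem for a compactly supported function and a function holomorphic near its
support. -/
theorem integral_dbar_smul_eq_zero [CompleteSpace B] {Φ : ℂ → ℂ} {G : ℂ → B} {U : Set ℂ}
    (hU : IsOpen U) (hΦ : ContDiff ℝ 1 Φ) (hc : HasCompactSupport Φ) (hs : tsupport Φ ⊆ U)
    (hG : DifferentiableOn ℂ G U) : ∫ z, dbar Φ z • G z = 0 := by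
  have hG' : DifferentiableOn ℂ (deriv G) U := hG.deriv hU
  have hd : Differentiable ℝ Φ := hΦ.differentiable (by simp)
  have hfc : ∀ v : ℂ, Continuous fun z => fderiv ℝ Φ z v := fun v => by
    have := hΦ.continuous_fderiv (by simp)
    fun_prop
  have hfs : ∀ v : ℂ, tsupport (fun z => fderiv ℝ Φ z v) ⊆ tsupport Φ := fun v => by
    refine closure_minimal (fun z hz => ?_) (isClosed_tsupport Φ)
    by_contra h
    apply hz
    have h1 : fderiv ℝ Φ z = 0 := by
      by_contra h2
      exact h (tsupport_fderiv_subset ℝ (subset_tsupport _ h2))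
    simp [h1]
  have hfcs : ∀ v : ℂ, HasCompactSupport (fun z => fderiv ℝ Φ z v) := fun v =>
    hc.of_isClosed_subset (isClosed_tsupport _) (hfs v)
  have hder : ∀ z v, DifferentiableAt ℝ (fun z => Φ z • G z) z ∧
      fderiv ℝ (fun z => Φ z • G z) z v = fderiv ℝ Φ z v • G z + Φ z • v • deriv G z := by
    intro z v
    by_cases hz : z ∈ tsupport Φ
    · have hGz : HasDerivAt G (deriv G z) z := (hG.differentiableAt (hU.mem_nhds (hs hz))).hasDerivAt
      have hGz' := hGz.hasFDerivAt.restrictScalars ℝ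
      have h2 := (hd z).hasFDerivAt.smul hGz'
      refine ⟨h2.differentiableAt, ?_⟩
      have h3 := congrArg (fun L => L v) h2.fderiv
      simp only [_root_.add_apply, _root_.smul_apply, ContinuousLinearMap.smulRight_apply,
        ContinuousLinearMap.coe_restrictScalars', ContinuousLinearMap.toSpanSingleton_apply] at h3
      rw [add_comm]
      exact h3
    · have h1 : (fun z => Φ z • G z) =ᶠ[𝓝 z] fun _ => 0 := by
        have := (isClosed_tsupport Φ).isOpen_compl.mem_nhds hz
        filter_upwards [this] with w hw
        rw [image_eq_zero_of_notMem_tsupport hw, zero_smul]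
      have h2 : fderiv ℝ Φ z = 0 := by
        by_contra h2
        exact hz (tsupport_fderiv_subset ℝ (subset_tsupport _ h2))
      refine ⟨(differentiableAt_const _).congr_of_eventuallyEq h1, ?_⟩
      rw [h1.fderiv_eq, h2, image_eq_zero_of_notMem_tsupport hz]
      simp
  have hint0 : Integrable fun z => Φ z • G z :=
    integrable_smul_of_tsupport_subset hU hΦ.continuous hc hs hG.continuousOn
  have hint1 : ∀ v : ℂ, Integrable fun z => fderiv ℝ Φ z v • G z := fun v =>
    integrable_smul_of_tsupport_subset hU (hfc v) (hfcs v) ((hfs v).trans hs) hG.continuousOn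
  have hint2 : ∀ v : ℂ, Integrable fun z => Φ z • v • deriv G z := fun v =>
    integrable_smul_of_tsupport_subset hU hΦ.continuous hc hs (hG'.continuousOn.const_smul v)
  -- Integration by parts against the constant function `1`.
  have hzero : ∀ v : ℂ, ∫ z, fderiv ℝ (fun z => Φ z • G z) z v = 0 := by
    intro v
    have hi : Integrable fun z => fderiv ℝ (fun z => Φ z • G z) z v := by
      simp_rw [(hder _ v).2]
      exact (hint1 v).add (hint2 v)
    have := integral_smul_fderiv_eq_neg_fderiv_smul_of_integrable (𝕜 := ℝ) (μ := (volume : Measure ℂ))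
      (f := fun _ => (1 : ℝ)) (g := fun z => Φ z • G z) (v := v) (by simp) (by simpa using hi)
      (by simpa using hint0) (fun x _ => differentiableAt_const _) (fun x _ => (hder x v).1)
    simpa using this
  have hi1 : Integrable fun z => fderiv ℝ (fun z => Φ z • G z) z 1 := by
    simp_rw [(hder _ 1).2]
    exact (hint1 1).add (hint2 1)
  have hi2 : Integrable fun z => Complex.I • fderiv ℝ (fun z => Φ z • G z) z Complex.I := by
    simp_rw [(hder _ Complex.I).2]
    exact ((hint1 _).add (hint2 _)).smul Complex.I
  -- As `G` is holomorphic, the terms with `deriv G` cancel: `1 + I * I = 0`.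
  have hkey : ∀ z, dbar Φ z • G z = (1 / 2 : ℂ) • (fderiv ℝ (fun z => Φ z • G z) z 1 +
      Complex.I • fderiv ℝ (fun z => Φ z • G z) z Complex.I) := by
    intro z
    rw [(hder z 1).2, (hder z Complex.I).2, dbar, smul_add Complex.I, smul_comm (Φ z) Complex.I,
      smul_smul Complex.I Complex.I, Complex.I_mul_I]
    module
  simp_rw [hkey]
  rw [integral_smul, integral_add hi1 hi2, integral_smul, hzero, hzero]
  simp

end Dbar

end SpecCalc

namespace SpecCalc

open Filter Topology

/-! ### Stokes' theorem with a singularity on the real axis -/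

section Singular

variable {B : Type*} [NormedAddCommGroup B] [NormedSpace ℂ B]

/-- The condition `N > n` says exactly that the exponent `N - 1 - n` exceeds `-1`. -/
theorem integrable_abs_im_rpow_indicator {N : ℕ} {n : ℝ} (hN : n < N) {K : Set ℂ}
    (hK : IsCompact K) (C : ℝ) :
    Integrable (K.indicator fun z : ℂ => C * |z.im| ^ ((N : ℝ) - (1 + n))) :=
  (integrable_indicator_iff hK.measurableSet).2
    ((integrableOn_abs_im_rpow (by linarith) hK).const_mul C)

theorem norm_smul_le_abs_im_rpow {N : ℕ} {n C D : ℝ} {u : ℂ} {g : B} {z : ℂ} (hz : z.im ≠ 0)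
    (hu : ‖u‖ ≤ C * |z.im| ^ N) (hg : ‖g‖ ≤ D * |z.im| ^ (-(1 + n))) :
    ‖u • g‖ ≤ C * D * |z.im| ^ ((N : ℝ) - (1 + n)) := by
  have hpos := abs_pos.2 hz
  rw [norm_smul]
  calc ‖u‖ * ‖g‖ ≤ (C * |z.im| ^ N) * (D * |z.im| ^ (-(1 + n))) :=
        mul_le_mul hu hg (norm_nonneg _) ((norm_nonneg _).trans hu)
    _ = C * D * |z.im| ^ ((N : ℝ) - (1 + n)) := by
        rw [sub_eq_add_neg, Real.rpow_add hpos, Real.rpow_natCast]; ring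

/-- Integrability of `u • G` for `u = O(|Im z|^N)` and `G = O(|Im z|^{-1-n})`, `N > n`. -/
theorem integrable_smul_of_bounds {u : ℂ → ℂ} {G : ℂ → B} {U : Set ℂ} {N : ℕ} {n C D : ℝ}
    (hN : n < N) (hu : Continuous u) (hc : HasCompactSupport u)
    (hub : ∀ z, ‖u z‖ ≤ C * |z.im| ^ N) (hU : IsOpen U)
    (hs : ∀ z ∈ tsupport u, z.im ≠ 0 → z ∈ U) (hG : ContinuousOn G U)
    (hGb : ∀ z ∈ tsupport u, z.im ≠ 0 → ‖G z‖ ≤ D * |z.im| ^ (-(1 + n))) :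
    Integrable fun z => u z • G z := by
  refine (integrable_abs_im_rpow_indicator hN hc (C * D)).mono' ?_ ?_
  · have hUm : MeasurableSet (U ∩ {z : ℂ | z.im ≠ 0}) := (hU.inter isOpen_im_ne_zero).measurableSet
    have h1 : AEStronglyMeasurable ((U ∩ {z : ℂ | z.im ≠ 0}).indicator fun z => u z • G z)
        (volume : Measure ℂ) := by
      rw [aestronglyMeasurable_indicator_iff hUm]
      exact ((hu.continuousOn.smul hG).mono Set.inter_subset_left).aestronglyMeasurable hUm
    refine h1.congr ?_
    filter_upwards [ae_im_ne_zero] with z hz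
    by_cases h : z ∈ tsupport u
    · have hm : z ∈ U ∩ {z : ℂ | z.im ≠ 0} := ⟨hs z h hz, hz⟩
      rw [Set.indicator_of_mem hm]
    · by_cases h' : z ∈ U ∩ {z : ℂ | z.im ≠ 0}
      · rw [Set.indicator_of_mem h']
      · rw [Set.indicator_of_notMem h', image_eq_zero_of_notMem_tsupport h, zero_smul]
  · filter_upwards [ae_im_ne_zero] with z hz
    by_cases h : z ∈ tsupport u
    · rw [Set.indicator_of_mem h]
      exact norm_smul_le_abs_im_rpow hz (hub z) (hGb z h hz)
    · rw [Set.indicator_of_notMem h, image_eq_zero_of_notMem_tsupport h, zero_smul, norm_zero]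

/-- A smooth function that vanishes on `[-1, 1]` and equals `1` off `(-2, 2)`. -/
noncomputable def awayCutoff (s : ℝ) : ℝ := Real.smoothTransition (s ^ 2 - 1)

theorem contDiff_awayCutoff : ContDiff ℝ 1 awayCutoff :=
  (Real.smoothTransition.contDiff (n := 1)).comp (by fun_prop)

theorem awayCutoff_eq_zero {s : ℝ} (h : |s| ≤ 1) : awayCutoff s = 0 := by
  apply Real.smoothTransition.zero_of_nonpos
  have := (sq_le_one_iff_abs_le_one s).2 h
  linarith

theorem awayCutoff_eq_one {s : ℝ} (h : 2 ≤ |s|) : awayCutoff s = 1 := by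
  apply Real.smoothTransition.one_of_one_le
  have := sq_abs s
  nlinarith

theorem abs_awayCutoff_le (s : ℝ) : |awayCutoff s| ≤ 1 := by
  rw [awayCutoff, abs_of_nonneg (Real.smoothTransition.nonneg _)]
  exact Real.smoothTransition.le_one _

/-- The quantity `|s| |ρ'(s)|` is invariant under scaling, so the bound holds for all `ρ(k ·)` at
once: the factor `k` from differentiating the cut-off is paid for by one power of `|Im z|`. -/
theorem exists_bound_deriv_awayCutoff : ∃ M, ∀ s, |s| * |deriv awayCutoff s| ≤ M := by
  have hcont : Continuous (deriv awayCutoff) := contDiff_awayCutoff.continuous_deriv (by simp)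
  obtain ⟨M, hM⟩ := (isCompact_Icc (a := (-2 : ℝ)) (b := 2)).exists_bound_of_continuousOn
    hcont.continuousOn
  have hM0 : 0 ≤ M := (norm_nonneg _).trans (hM 0 (by simp))
  refine ⟨2 * M, fun s => ?_⟩
  by_cases h : |s| ≤ 2
  · exact mul_le_mul h (hM s (abs_le.1 h)) (abs_nonneg _) (by norm_num)
  · push Not at h
    have h1 : awayCutoff =ᶠ[𝓝 s] fun _ => 1 := by
      filter_upwards [(continuous_abs.continuousAt (x := s)).eventually_const_lt h] with t ht
      exact awayCutoff_eq_one ht.le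
    rw [h1.deriv_eq]
    simp only [deriv_const, abs_zero, mul_zero]
    positivity

theorem contDiff_awayCutoff_im (k : ℝ) : ContDiff ℝ 1 fun z : ℂ => (awayCutoff (k * z.im) : ℂ) := by
  have h1 : ContDiff ℝ 1 fun z : ℂ => k * z.im := contDiff_const.mul Complex.imCLM.contDiff
  exact Complex.ofRealCLM.contDiff.comp (contDiff_awayCutoff.comp h1)

theorem dbar_awayCutoff_im (k : ℝ) (z : ℂ) :
    dbar (fun z : ℂ => (awayCutoff (k * z.im) : ℂ)) z =
      Complex.I / 2 * (k * deriv awayCutoff (k * z.im) : ℝ) := by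
  have h1 : HasFDerivAt (fun z : ℂ => k * z.im) (k • Complex.imCLM) z := by
    simpa using Complex.imCLM.hasFDerivAt.const_mul k
  have h2 : HasDerivAt awayCutoff (deriv awayCutoff (k * z.im)) (k * z.im) :=
    (contDiff_awayCutoff.differentiable (by simp) _).hasDerivAt
  have h3 := Complex.ofRealCLM.hasFDerivAt.comp z (h2.hasFDerivAt.comp z h1)
  have h4 : fderiv ℝ (fun z : ℂ => (awayCutoff (k * z.im) : ℂ)) z = _ := h3.fderiv
  rw [dbar, h4]
  simp
  ring

/-- Stokes' theorem for a compactly supported function that vanishes on the real axis to order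
`N + 1`, and a function with a singularity of order `1 + n < 1 + N` there. -/
theorem integral_dbar_smul_eq_zero_of_bounds [CompleteSpace B] {Φ : ℂ → ℂ} {G : ℂ → B} {U : Set ℂ}
    {N : ℕ} {n C D : ℝ} (hN : n < N) (hΦ : ContDiff ℝ 1 Φ) (hc : HasCompactSupport Φ)
    (hΦb : ∀ z, ‖Φ z‖ ≤ C * |z.im| ^ (N + 1)) (hub : ∀ z, ‖dbar Φ z‖ ≤ C * |z.im| ^ N)
    (hU : IsOpen U) (hs : ∀ z ∈ tsupport Φ, z.im ≠ 0 → z ∈ U) (hG : DifferentiableOn ℂ G U)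
    (hGb : ∀ z ∈ tsupport Φ, z.im ≠ 0 → ‖G z‖ ≤ D * |z.im| ^ (-(1 + n))) :
    ∫ z, dbar Φ z • G z = 0 := by
  obtain ⟨M, hM⟩ := exists_bound_deriv_awayCutoff
  have hM0 : 0 ≤ M := le_trans (by positivity) (hM 0)
  -- `P k` vanishes for `|Im z| ≤ 1 / k`, so the regular version of Stokes applies to it; the limit
  -- `k → ∞` is taken by dominated convergence.
  let P : ℕ → ℂ → ℂ := fun k z => (awayCutoff (k * z.im) : ℂ) * Φ z
  have hP1 : ∀ k, ContDiff ℝ 1 (P k) := fun k => (contDiff_awayCutoff_im k).mul hΦ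
  have hPs : ∀ k, tsupport (P k) ⊆ tsupport Φ := fun k => tsupport_mul_subset_right
  have hPc : ∀ k, HasCompactSupport (P k) := fun k => hc.mul_left
  have hUo : IsOpen (U ∩ {z : ℂ | z.im ≠ 0}) := hU.inter isOpen_im_ne_zero
  have hPU : ∀ k, tsupport (P k) ⊆ U ∩ {z : ℂ | z.im ≠ 0} := by
    intro k z hz
    have hz0 : z.im ≠ 0 := by
      intro h0
      have hsub : tsupport (P k) ⊆ {z : ℂ | 1 ≤ |k * z.im|} := by
        refine closure_minimal (fun w hw => ?_) (isClosed_le continuous_const (by fun_prop))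
        by_contra h
        simp only [Set.mem_ofPred_eq, not_le] at h
        apply hw
        simp [P, awayCutoff_eq_zero h.le]
      have := hsub hz
      simp only [Set.mem_ofPred_eq, h0, mul_zero, abs_zero] at this
      linarith
    exact ⟨hs z (hPs k hz) hz0, hz0⟩
  have hzero : ∀ k, ∫ z, dbar (P k) z • G z = 0 := fun k =>
    integral_dbar_smul_eq_zero hUo (hP1 k) (hPc k) (hPU k) (hG.mono Set.inter_subset_left)
  have hint : ∀ k, Integrable fun z => dbar (P k) z • G z := fun k =>
    integrable_smul_of_tsupport_subset hUo (continuous_dbar (hP1 k)) (hasCompactSupport_dbar (hPc k))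
      ((tsupport_dbar_subset _).trans (hPU k)) (hG.mono Set.inter_subset_left).continuousOn
  have hC : ∀ z : ℂ, z.im ≠ 0 → 0 ≤ C := by
    intro z hz
    have h1 := (norm_nonneg _).trans (hub z)
    have : 0 < |z.im| ^ N := by positivity
    exact nonneg_of_mul_nonneg_left h1 this
  -- The bound must not depend on `k`. The derivative of the cut-off meets `Φ`, which is one order
  -- smaller than `∂̄Φ`; this is why order `N + 1` is asked of `Φ`.
  have hbound : ∀ (k : ℕ) (z : ℂ), z.im ≠ 0 → ‖dbar (P k) z‖ ≤ (C + M * C) * |z.im| ^ N := by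
    intro k z hz
    have hpos : 0 < |z.im| := abs_pos.2 hz
    have hC0 := hC z hz
    have hd := dbar_mul ((contDiff_awayCutoff_im k).differentiable (by simp) z)
      (hΦ.differentiable (by simp) z)
    change ‖dbar (fun z : ℂ => (awayCutoff (k * z.im) : ℂ) * Φ z) z‖ ≤ _
    rw [hd, dbar_awayCutoff_im]
    refine (norm_add_le _ _).trans ?_
    rw [norm_mul, norm_mul, norm_mul, Complex.norm_real, Complex.norm_real, norm_div,
      Complex.norm_I, Real.norm_eq_abs, Real.norm_eq_abs, abs_mul]
    have h1 : |(k : ℝ)| * |deriv awayCutoff (k * z.im)| * |z.im| ≤ M := by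
      have := hM (k * z.im)
      rw [abs_mul] at this
      linarith
    have h2 : 1 / ‖(2 : ℂ)‖ * (|(k : ℝ)| * |deriv awayCutoff (k * z.im)|) * ‖Φ z‖ ≤
        M * C * |z.im| ^ N := by
      have h3 : ‖(2 : ℂ)‖ = 2 := by simp
      calc _ ≤ 1 / ‖(2 : ℂ)‖ * (|(k : ℝ)| * |deriv awayCutoff (k * z.im)|) *
            (C * |z.im| ^ (N + 1)) := by gcongr; exact hΦb z
        _ = 1 / 2 * (|(k : ℝ)| * |deriv awayCutoff (k * z.im)| * |z.im|) * (C * |z.im| ^ N) := by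
            rw [h3]; ring
        _ ≤ 1 * M * (C * |z.im| ^ N) := by gcongr; norm_num
        _ = _ := by ring
    have h4 : |awayCutoff (k * z.im)| * ‖dbar Φ z‖ ≤ C * |z.im| ^ N := by
      calc _ ≤ 1 * ‖dbar Φ z‖ := by gcongr; exact abs_awayCutoff_le _
        _ ≤ _ := by rw [one_mul]; exact hub z
    calc _ ≤ _ := add_le_add h2 h4
      _ = _ := by ring
  have hlim := tendsto_integral_of_dominated_convergence (μ := (volume : Measure ℂ))
    (F := fun k z => dbar (P k) z • G z) (f := fun z => dbar Φ z • G z)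
    ((tsupport Φ).indicator fun z : ℂ => (C + M * C) * D * |z.im| ^ ((N : ℝ) - (1 + n)))
    (fun k => (hint k).aestronglyMeasurable) (integrable_abs_im_rpow_indicator hN hc _) ?_ ?_
  · simp only [hzero] at hlim
    exact (tendsto_nhds_unique hlim tendsto_const_nhds)
  · intro k
    filter_upwards [ae_im_ne_zero] with z hz
    by_cases h : z ∈ tsupport Φ
    · rw [Set.indicator_of_mem h]
      exact norm_smul_le_abs_im_rpow hz (hbound k z hz) (hGb z h hz)
    · rw [Set.indicator_of_notMem h, dbar_eq_zero_of_notMem (fun h' => h (hPs k h')), zero_smul,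
        norm_zero]
  · filter_upwards [ae_im_ne_zero] with z hz
    refine tendsto_const_nhds.congr' ?_
    have hpos : 0 < |z.im| := abs_pos.2 hz
    obtain ⟨k₀, hk₀⟩ := exists_nat_gt (2 / |z.im|)
    filter_upwards [eventually_ge_atTop k₀] with k hk
    congr 1
    apply dbar_congr
    have h1 : 2 < |(k : ℝ) * z.im| := by
      rw [abs_mul, Nat.abs_cast]
      rw [div_lt_iff₀ hpos] at hk₀
      refine hk₀.trans_le ?_
      gcongr
    have h2 : ∀ᶠ w : ℂ in 𝓝 z, 2 < |(k : ℝ) * w.im| := by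
      have hcont : Continuous fun w : ℂ => |(k : ℝ) * w.im| := by fun_prop
      exact hcont.continuousAt.eventually_const_lt h1
    filter_upwards [h2] with w hw
    simp [P, awayCutoff_eq_one hw.le]

end Singular

end SpecCalc

namespace SpecCalc

open Filter Topology

/-! ### Taylor polynomials in the imaginary direction -/

section Taylor

/-- The Taylor polynomial of `f` at `Re w` with `N` terms, evaluated at the imaginary increment
`i Im w`. -/
noncomputable def taylorExt (N : ℕ) (f : ℝ → ℂ) (w : ℂ) : ℂ :=
  ∑ k ∈ Finset.range N,
    iteratedDeriv k f w.re / (k.factorial : ℂ) * (Complex.I * (w.im : ℂ)) ^ k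

theorem taylorExt_succ (N : ℕ) (f : ℝ → ℂ) (w : ℂ) :
    taylorExt (N + 1) f w = taylorExt N f w +
      iteratedDeriv N f w.re / (N.factorial : ℂ) * (Complex.I * (w.im : ℂ)) ^ N :=
  Finset.sum_range_succ _ _

theorem contDiff_iteratedDeriv {f : ℝ → ℂ} (hf : ContDiff ℝ ∞ f) (k : ℕ) :
    ContDiff ℝ ∞ (iteratedDeriv k f) := by
  rw [iteratedDeriv_eq_iterate]
  exact hf.iterate_deriv k

theorem contDiff_taylorExt {f : ℝ → ℂ} (hf : ContDiff ℝ ∞ f) (N : ℕ) :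
    ContDiff ℝ ∞ (taylorExt N f) := by
  unfold taylorExt
  refine ContDiff.sum fun k _ => ?_
  have h1 : ContDiff ℝ ∞ fun w : ℂ => iteratedDeriv k f w.re :=
    (contDiff_iteratedDeriv hf k).comp Complex.reCLM.contDiff
  have h2 : ContDiff ℝ ∞ fun w : ℂ => (w.im : ℂ) :=
    Complex.ofRealCLM.contDiff.comp Complex.imCLM.contDiff
  exact (h1.div_const _).mul ((contDiff_const.mul h2).pow k)

theorem taylorExt_of_im_eq_zero (N : ℕ) (f : ℝ → ℂ) {w : ℂ} (hw : w.im = 0) :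
    taylorExt (N + 1) f w = f w.re := by
  rw [taylorExt, Finset.sum_range_succ']
  simp [hw]

theorem hasDerivAt_I_mul_pow (k : ℕ) (y : ℝ) :
    HasDerivAt (fun t : ℝ => (Complex.I * (t : ℂ)) ^ (k + 1))
      (((k : ℂ) + 1) * (Complex.I * (y : ℂ)) ^ k * Complex.I) y := by
  have h := ((Complex.ofRealCLM.hasDerivAt (x := y)).const_mul Complex.I).fun_pow (k + 1)
  simpa using h

/-- The `x`-derivative keeps all `N + 1` terms, while the `y`-derivative lowers each degree by one
and loses a term. The mismatch is the top-degree term, which is all that survives in `∂̄`. -/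
theorem hasFDerivAt_taylorExt {f : ℝ → ℂ} (hf : ContDiff ℝ ∞ f) (N : ℕ) (w : ℂ) :
    HasFDerivAt (taylorExt (N + 1) f)
      (Complex.reCLM.smulRight (taylorExt (N + 1) (deriv f) w) +
        Complex.imCLM.smulRight (Complex.I * taylorExt N (deriv f) w)) w := by
  have hre : ∀ k, HasFDerivAt (fun w : ℂ => iteratedDeriv k f w.re / (k.factorial : ℂ))
      (Complex.reCLM.smulRight (iteratedDeriv k (deriv f) w.re / (k.factorial : ℂ))) w := by
    intro k
    have h1 : HasDerivAt (iteratedDeriv k f) (iteratedDeriv k (deriv f) w.re) w.re := by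
      rw [← iteratedDeriv_succ', iteratedDeriv_succ]
      exact ((contDiff_iteratedDeriv hf k).differentiable (by simp) _).hasDerivAt
    have h2 := ((h1.div_const (k.factorial : ℂ)).hasFDerivAt.comp w Complex.reCLM.hasFDerivAt)
    refine h2.congr_fderiv ?_
    ext v <;> simp
  have him : ∀ k : ℕ, HasFDerivAt (fun w : ℂ => (Complex.I * (w.im : ℂ)) ^ (k + 1))
      (Complex.imCLM.smulRight
        (((k : ℂ) + 1) * (Complex.I * (w.im : ℂ)) ^ k * Complex.I)) w := by
    intro k
    have h2 := (hasDerivAt_I_mul_pow k w.im).hasFDerivAt.comp w Complex.imCLM.hasFDerivAt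
    refine h2.congr_fderiv ?_
    ext v <;> simp
  induction N with
  | zero =>
    have : taylorExt (0 + 1) f =
        fun w : ℂ => iteratedDeriv 0 f w.re / ((Nat.factorial 0 : ℕ) : ℂ) := by
      ext w; simp [taylorExt]
    rw [this]
    refine (hre 0).congr_fderiv ?_
    ext v <;> simp [taylorExt]
  | succ N ih =>
    have h1 : taylorExt (N + 1 + 1) f = fun w => taylorExt (N + 1) f w +
        iteratedDeriv (N + 1) f w.re / ((N + 1).factorial : ℂ) *
          (Complex.I * (w.im : ℂ)) ^ (N + 1) := by
      ext w; exact taylorExt_succ _ _ _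
    rw [h1]
    refine (ih.add ((hre (N + 1)).mul (him N))).congr_fderiv ?_
    have h2 : iteratedDeriv (N + 1) f w.re = iteratedDeriv N (deriv f) w.re := by
      rw [iteratedDeriv_succ']
    have h3 : ((N + 1).factorial : ℂ) = ((N : ℂ) + 1) * (N.factorial : ℂ) := by
      rw [Nat.factorial_succ]; push_cast; ring
    have h4 : (N.factorial : ℂ) ≠ 0 := by exact_mod_cast N.factorial_ne_zero
    have h5 : (N : ℂ) + 1 ≠ 0 := by exact_mod_cast N.succ_ne_zero
    ext v
    simp only [_root_.add_apply, _root_.smul_apply, ContinuousLinearMap.smulRight_apply,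
      Complex.reCLM_apply, Complex.imCLM_apply, Complex.real_smul, smul_eq_mul,
      taylorExt_succ _ _ w, h2, h3]
    field_simp
    ring

theorem dbar_taylorExt {f : ℝ → ℂ} (hf : ContDiff ℝ ∞ f) (N : ℕ) (w : ℂ) :
    dbar (taylorExt (N + 1) f) w = 1 / 2 * (iteratedDeriv N (deriv f) w.re / (N.factorial : ℂ) *
      (Complex.I * (w.im : ℂ)) ^ N) := by
  rw [dbar, (hasFDerivAt_taylorExt hf N w).fderiv]
  simp only [_root_.add_apply, ContinuousLinearMap.smulRight_apply, Complex.reCLM_apply,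
    Complex.imCLM_apply, Complex.one_re, Complex.one_im, Complex.I_re, Complex.I_im, one_smul,
    zero_smul, add_zero, zero_add, taylorExt_succ]
  linear_combination (1 / 2 * taylorExt N (deriv f) w) * Complex.I_mul_I

/-- On a vertical line the expression is a polynomial in `y`, so no smoothness of `h` is needed. It
is applied to functions such as `a * f ∘ φ`, which are smooth only where `φ` is holomorphic. -/
theorem hasDerivAt_taylorExt_vertical (h : ℝ → ℂ) (N : ℕ) (x y : ℝ) :
    HasDerivAt (fun t : ℝ => taylorExt (N + 1) h ⟨x, t⟩)
      (Complex.I * taylorExt N (deriv h) ⟨x, y⟩) y := by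
  induction N with
  | zero =>
    have : (fun t : ℝ => taylorExt (0 + 1) h ⟨x, t⟩) = fun _ => h x := by
      ext t; simp [taylorExt]
    rw [this]
    simpa [taylorExt] using hasDerivAt_const y (h x)
  | succ N ih =>
    simp_rw [taylorExt_succ (N + 1)]
    have h1 := hasDerivAt_I_mul_pow N y
    refine (ih.add (h1.const_mul (iteratedDeriv (N + 1) h x / ((N + 1).factorial : ℂ)))).congr_deriv ?_
    have h3 : ((N + 1).factorial : ℂ) = ((N : ℂ) + 1) * (N.factorial : ℂ) := by
      rw [Nat.factorial_succ]; push_cast; ring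
    have h4 : (N.factorial : ℂ) ≠ 0 := by exact_mod_cast N.factorial_ne_zero
    have h5 : (N : ℂ) + 1 ≠ 0 := by exact_mod_cast N.succ_ne_zero
    rw [taylorExt_succ, iteratedDeriv_succ', h3]
    field_simp

theorem taylorExt_congr {g h : ℝ → ℂ} {w : ℂ} (hgh : g =ᶠ[𝓝 w.re] h) (N : ℕ) :
    taylorExt N g w = taylorExt N h w := by
  unfold taylorExt
  refine Finset.sum_congr rfl fun k _ => ?_
  rw [hgh.iteratedDeriv_eq]

theorem taylorExt_add {g h : ℝ → ℂ} {w : ℂ} (hg : ContDiffAt ℝ ∞ g w.re)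
    (hh : ContDiffAt ℝ ∞ h w.re) (N : ℕ) :
    taylorExt N (fun x => g x + h x) w = taylorExt N g w + taylorExt N h w := by
  unfold taylorExt
  rw [← Finset.sum_add_distrib]
  refine Finset.sum_congr rfl fun k _ => ?_
  rw [iteratedDeriv_fun_add (hg.of_le (by exact_mod_cast le_top)) (hh.of_le (by exact_mod_cast le_top))]
  ring

theorem exists_bound_iteratedDeriv {f : ℝ → ℂ} (hf : ContDiff ℝ ∞ f) (hc : HasCompactSupport f)
    (k : ℕ) : ∃ M, 0 ≤ M ∧ ∀ x, ‖iteratedDeriv k f x‖ ≤ M := by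
  have h1 : HasCompactSupport (iteratedDeriv k f) := by
    induction k with
    | zero => simpa using hc
    | succ k ih => rw [iteratedDeriv_succ]; exact ih.deriv
  obtain ⟨M, hM⟩ := h1.exists_bound_of_continuous (contDiff_iteratedDeriv hf k).continuous
  exact ⟨M, (norm_nonneg _).trans (hM 0), hM⟩

theorem exists_bound_taylor_term {f : ℝ → ℂ} (hf : ContDiff ℝ ∞ f) (hc : HasCompactSupport f)
    (k : ℕ) : ∃ M, 0 ≤ M ∧ ∀ w : ℂ,
      ‖iteratedDeriv k f w.re / (k.factorial : ℂ) * (Complex.I * (w.im : ℂ)) ^ k‖ ≤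
        M * |w.im| ^ k := by
  obtain ⟨M, hM0, hM⟩ := exists_bound_iteratedDeriv hf hc k
  refine ⟨M, hM0, fun w => ?_⟩
  rw [norm_mul, norm_div, norm_pow, norm_mul, Complex.norm_I, one_mul, Complex.norm_real,
    Real.norm_eq_abs]
  have h1 : (1 : ℝ) ≤ ‖(k.factorial : ℂ)‖ := by
    rw [Complex.norm_natCast]
    exact_mod_cast Nat.succ_le_of_lt k.factorial_pos
  have h2 : ‖iteratedDeriv k f w.re‖ / ‖(k.factorial : ℂ)‖ ≤ M :=
    (div_le_self (norm_nonneg _) h1).trans (hM _)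
  gcongr

end Taylor

/-! ### Supports and `∂̄`-bounds of the almost analytic extensions -/

section AlmostAnalytic

theorem one_le_bracket (x : ℝ) : 1 ≤ bracket x := by
  rw [bracket, Real.one_le_sqrt]
  nlinarith [sq_nonneg x]

theorem bracket_pos (x : ℝ) : 0 < bracket x := zero_lt_one.trans_le (one_le_bracket x)

theorem contDiff_bracket : ContDiff ℝ ∞ bracket := by
  unfold bracket
  refine ContDiff.sqrt (by fun_prop) fun x => ?_
  nlinarith [sq_nonneg x]

theorem bracket_le (x : ℝ) : bracket x ≤ 1 + |x| := by
  rw [bracket, Real.sqrt_le_left (by positivity)]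
  nlinarith [abs_nonneg x, sq_abs x]

theorem contDiff_chi {τ : ℝ → ℂ} (hτ : IsCutoff τ) : ContDiff ℝ ∞ (chi τ) := by
  refine hτ.1.comp ?_
  exact Complex.imCLM.contDiff.div (contDiff_bracket.comp Complex.reCLM.contDiff)
    fun z => (bracket_pos _).ne'

theorem contDiff_almostAnalytic {τ f : ℝ → ℂ} (hτ : IsCutoff τ) (hf : ContDiff ℝ ∞ f) (N : ℕ) :
    ContDiff ℝ ∞ (almostAnalytic N τ f) :=
  (contDiff_taylorExt hf (N + 1)).mul (contDiff_chi hτ)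

theorem taylorExt_eq_zero {f : ℝ → ℂ} {w : ℂ} (h : w.re ∉ tsupport f) (N : ℕ) :
    taylorExt N f w = 0 := by
  have h1 : f =ᶠ[𝓝 w.re] fun _ => 0 := by
    filter_upwards [(isClosed_tsupport f).isOpen_compl.mem_nhds h] with x hx
    exact image_eq_zero_of_notMem_tsupport hx
  rw [taylorExt_congr h1]
  simp [taylorExt]

theorem tsupport_almostAnalytic_subset (N : ℕ) (τ f : ℝ → ℂ) :
    tsupport (almostAnalytic N τ f) ⊆ {z | z.re ∈ tsupport f ∧ z ∈ tsupport (chi τ)} := by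
  refine closure_minimal (fun z hz => ⟨?_, ?_⟩)
    (((isClosed_tsupport f).preimage Complex.continuous_re).inter (isClosed_tsupport _))
  · by_contra h
    apply hz
    change taylorExt (N + 1) f z * chi τ z = 0
    rw [taylorExt_eq_zero h, zero_mul]
  · by_contra h
    apply hz
    change taylorExt (N + 1) f z * chi τ z = 0
    rw [image_eq_zero_of_notMem_tsupport h, mul_zero]

theorem tsupport_chi_subset {τ : ℝ → ℂ} {R : ℝ} (hR : ∀ s, τ s ≠ 0 → |s| ≤ R) :
    tsupport (chi τ) ⊆ {z | |z.im| ≤ R * bracket z.re} := by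
  have hb := contDiff_bracket.continuous
  refine closure_minimal (fun z hz => ?_) (isClosed_le (f := fun z : ℂ => |z.im|)
    (g := fun z => R * bracket z.re) (by fun_prop) (by fun_prop))
  have h1 := hR _ hz
  rwa [abs_div, abs_of_pos (bracket_pos _), div_le_iff₀ (bracket_pos _)] at h1

theorem isCompact_reProdIm_bracket {S : Set ℝ} (hS : IsCompact S) (R : ℝ) :
    IsCompact {z : ℂ | z.re ∈ S ∧ |z.im| ≤ R * bracket z.re} := by
  have hb := contDiff_bracket.continuous
  obtain ⟨M, hM⟩ := hS.exists_bound_of_continuousOn hb.continuousOn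
  obtain ⟨M', hM'⟩ := hS.isBounded.exists_norm_le
  refine Metric.isCompact_of_isClosed_isBounded
    ((hS.isClosed.preimage Complex.continuous_re).inter (isClosed_le (f := fun z : ℂ => |z.im|)
      (g := fun z => R * bracket z.re) (by fun_prop) (by fun_prop))) ?_
  rw [isBounded_iff_forall_norm_le]
  refine ⟨M' + |R| * M, fun z hz => (Complex.norm_le_abs_re_add_abs_im z).trans ?_⟩
  refine add_le_add (hM' _ hz.1) (hz.2.trans ?_)
  have h1 := hM _ hz.1
  rw [Real.norm_eq_abs, abs_of_pos (bracket_pos _)] at h1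
  exact mul_le_mul (le_abs_self R) h1 (bracket_pos _).le (abs_nonneg _)

theorem IsCutoff.exists_bound {τ : ℝ → ℂ} (hτ : IsCutoff τ) : ∃ R, ∀ s, τ s ≠ 0 → |s| ≤ R := by
  have h1 : HasCompactSupport τ := hτ.2.1
  obtain ⟨R, hR⟩ := h1.isBounded.exists_norm_le
  exact ⟨R, fun s hs => hR s (subset_tsupport _ hs)⟩

theorem hasCompactSupport_almostAnalytic {τ f : ℝ → ℂ} (hτ : IsCutoff τ)
    (hf : HasCompactSupport f) (N : ℕ) : HasCompactSupport (almostAnalytic N τ f) := by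
  obtain ⟨R, hR⟩ := hτ.exists_bound
  refine (isCompact_reProdIm_bracket (S := tsupport f) hf R).of_isClosed_subset (isClosed_tsupport _) ?_
  exact (tsupport_almostAnalytic_subset N τ f).trans fun z hz => ⟨hz.1, tsupport_chi_subset hR hz.2⟩

/-- Because `⟨x⟩ ≥ 1`, the function `χ` equals `1` on a strip whose width does not depend on `x`. -/
theorem IsCutoff.exists_almostAnalytic_eq {τ : ℝ → ℂ} (hτ : IsCutoff τ) : ∃ ε > 0,
    ∀ (N : ℕ) (f : ℝ → ℂ) (z : ℂ), |z.im| < ε → almostAnalytic N τ f z = taylorExt (N + 1) f z := by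
  obtain ⟨ε, hε, h⟩ := hτ.2.2
  refine ⟨ε, hε, fun N f z hz => ?_⟩
  have h1 : chi τ z = 1 := by
    apply h
    rw [abs_div, abs_of_pos (bracket_pos _), div_lt_iff₀ (bracket_pos _)]
    nlinarith [one_le_bracket z.re]
  change taylorExt (N + 1) f z * chi τ z = _
  rw [h1, mul_one]

/-- Away from the real axis `|Im z| ^ N` is at least `ε ^ N`, and a continuous compactly supported
function is bounded. -/
theorem exists_bound_of_near {u : ℂ → ℂ} (hu : Continuous u) (hc : HasCompactSupport u) {N : ℕ}
    {ε C : ℝ} (hε : 0 < ε) (h : ∀ z, |z.im| < ε → ‖u z‖ ≤ C * |z.im| ^ N) :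
    ∃ C', 0 ≤ C' ∧ ∀ z, ‖u z‖ ≤ C' * |z.im| ^ N := by
  obtain ⟨M, hM⟩ := hc.exists_bound_of_continuous hu
  have hM0 : 0 ≤ M := (norm_nonneg _).trans (hM 0)
  refine ⟨|C| + M / ε ^ N, by positivity, fun z => ?_⟩
  rcases lt_or_ge |z.im| ε with hz | hz
  · refine (h z hz).trans ?_
    gcongr
    have : 0 ≤ M / ε ^ N := by positivity
    linarith [le_abs_self C]
  · refine (hM z).trans ?_
    have h1 : M = M / ε ^ N * ε ^ N := by field_simp
    calc M = M / ε ^ N * ε ^ N := h1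
      _ ≤ M / ε ^ N * |z.im| ^ N := by gcongr
      _ ≤ _ := by
          gcongr
          linarith [abs_nonneg C]

theorem exists_bound_dbar_almostAnalytic {τ f : ℝ → ℂ} (hτ : IsCutoff τ) (hf : ContDiff ℝ ∞ f)
    (hc : HasCompactSupport f) (N : ℕ) :
    ∃ C, 0 ≤ C ∧ ∀ z, ‖dbar (almostAnalytic N τ f) z‖ ≤ C * |z.im| ^ N := by
  obtain ⟨ε, hε, h⟩ := hτ.exists_almostAnalytic_eq
  have hd : ContDiff ℝ ∞ (deriv f) := by simpa using hf.iterate_deriv 1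
  obtain ⟨M, hM0, hM⟩ := exists_bound_taylor_term hd hc.deriv N
  refine exists_bound_of_near (continuous_dbar ((contDiff_almostAnalytic hτ hf N).of_le (by simp)))
    (hasCompactSupport_dbar (hasCompactSupport_almostAnalytic hτ hc N)) hε (C := M) fun z hz => ?_
  have h1 : almostAnalytic N τ f =ᶠ[𝓝 z] taylorExt (N + 1) f := by
    have hcont : Continuous fun w : ℂ => |w.im| := by fun_prop
    filter_upwards [hcont.continuousAt.eventually_lt_const hz] with w hw using h N f w hw
  rw [dbar_congr h1, dbar_taylorExt hf, norm_mul]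
  refine le_trans ?_ (hM z)
  have h2 : ‖(1 / 2 : ℂ)‖ ≤ 1 := by norm_num
  exact mul_le_of_le_one_left (norm_nonneg _) h2

end AlmostAnalytic

end SpecCalc

namespace SpecCalc

open Filter Topology

/-! ### Independence of the Helffer-Sjöstrand integral from `N` and `τ` -/

section WellDefined

variable {E : Type*} [NormedAddCommGroup E] [InnerProductSpace ℂ E]

theorem exists_cutoff {δ : ℝ} (hδ : 0 < δ) : ∃ τ : ℝ → ℂ, IsCutoff τ ∧ ∀ s, τ s ≠ 0 → |s| ≤ δ := by
  let b : ContDiffBump (0 : ℝ) := ⟨δ / 2, δ, by positivity, by linarith⟩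
  refine ⟨fun s => (b s : ℂ), ⟨?_, ?_, δ / 2, by positivity, fun s hs => ?_⟩, fun s hs => ?_⟩
  · exact Complex.ofRealCLM.contDiff.comp b.contDiff
  · exact b.hasCompactSupport.comp_left Complex.ofReal_zero
  · change ((b s : ℝ) : ℂ) = 1
    rw [b.one_of_mem_closedBall (by simpa using hs.le), Complex.ofReal_one]
  · by_contra h
    push Not at h
    apply hs
    change ((b s : ℝ) : ℂ) = 0
    rw [b.zero_of_le_dist (by simpa using h.le), Complex.ofReal_zero]

theorem bracket_le_of_mem {s₀ s₁ x : ℝ} (hx : x ∈ Set.Ioo s₀ s₁) :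
    bracket x ≤ 1 + (|s₀| + |s₁|) := by
  refine (bracket_le x).trans ?_
  have : |x| ≤ |s₀| + |s₁| := by
    rw [abs_le]
    constructor
    · linarith [hx.1, neg_abs_le s₀, abs_nonneg s₁]
    · linarith [hx.2, le_abs_self s₁, abs_nonneg s₀]
  linarith

/-- On a bounded interval the resolvent estimate reads `‖(A - z)⁻¹‖ ≤ C |Im z|^{-1-n}`. -/
theorem ResolventEstimate.exists_bound {A : E →ₗ.[ℂ] E} {s₀ s₁ n : ℝ}
    (h : ResolventEstimate A (Set.Ioo s₀ s₁) n) :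
    ∃ a > (0 : ℝ), ∃ C ≥ (0 : ℝ), tube a (Set.Ioo s₀ s₁) ⊆ rho A ∧
      ∀ z ∈ tube a (Set.Ioo s₀ s₁), ‖res A z‖ ≤ C * |z.im| ^ (-(1 + n)) := by
  obtain ⟨hn, a, ha, C, hC, hsub, hest⟩ := h
  refine ⟨a, ha, C * (1 + (|s₀| + |s₁|)) ^ n, by positivity, hsub, fun z hz => ?_⟩
  refine (hest z hz).trans ?_
  have hpos : 0 < |z.im| := hz.2.1
  have hb := bracket_pos z.re
  rw [Real.div_rpow hb.le hpos.le, neg_add, Real.rpow_add hpos, Real.rpow_neg_one,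
    Real.rpow_neg hpos.le]
  have h1 := Real.rpow_le_rpow hb.le (bracket_le_of_mem hz.1) hn.le
  calc C * |z.im|⁻¹ * (bracket z.re ^ n / |z.im| ^ n)
      ≤ C * |z.im|⁻¹ * ((1 + (|s₀| + |s₁|)) ^ n / |z.im| ^ n) := by gcongr
    _ = _ := by ring

theorem ResolventEstimate.of_bound {A : E →ₗ.[ℂ] E} {I : Set ℝ} {n : ℝ} (hn : 0 < n)
    {a C : ℝ} (ha : 0 < a) (hsub : tube a I ⊆ rho A)
    (hest : ∀ z ∈ tube a I, ‖res A z‖ ≤ C * |z.im| ^ (-(1 + n))) : ResolventEstimate A I n := by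
  refine ⟨hn, a, ha, |C| + 1, by positivity, hsub, fun z hz => (hest z hz).trans ?_⟩
  have hpos : 0 < |z.im| := hz.2.1
  have hb := bracket_pos z.re
  rw [Real.div_rpow hb.le hpos.le, neg_add, Real.rpow_add hpos, Real.rpow_neg_one,
    Real.rpow_neg hpos.le]
  have h1 := Real.one_le_rpow (one_le_bracket z.re) hn.le
  have h2 : C ≤ |C| + 1 := by linarith [le_abs_self C]
  calc C * (|z.im|⁻¹ * (|z.im| ^ n)⁻¹) ≤ (|C| + 1) * (|z.im|⁻¹ * (|z.im| ^ n)⁻¹) := by gcongr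
    _ = (|C| + 1) * |z.im|⁻¹ * (1 / |z.im| ^ n) := by ring
    _ ≤ (|C| + 1) * |z.im|⁻¹ * (bracket z.re ^ n / |z.im| ^ n) := by gcongr

/-- If the cut-off is narrow, the part of the support of `χ` over the bounded interval stays within
height `a / 2`, where the tube contains no eigenvalue. The extra bound `δ` lets the support be as
thin as later steps require. -/
theorem ResolventEstimate.exists_isAdmissible {A : E →ₗ.[ℂ] E} {s₀ s₁ n : ℝ}
    (h : ResolventEstimate A (Set.Ioo s₀ s₁) n) {δ : ℝ} (hδ : 0 < δ) :
    ∃ τ, IsAdmissible A (Set.Ioo s₀ s₁) τ ∧ ∀ s, τ s ≠ 0 → |s| ≤ δ := by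
  obtain ⟨hn, a, ha, C, hC, hsub, hest⟩ := h
  have hpos : 0 < 1 + (|s₀| + |s₁|) := by positivity
  obtain ⟨τ, hτ, hτs⟩ := exists_cutoff (δ := min δ (a / 2 / (1 + (|s₀| + |s₁|)))) (by positivity)
  refine ⟨τ, ⟨hτ, fun lam hlam him hre hmem => ?_⟩, fun s hs => (hτs s hs).trans (min_le_left _ _)⟩
  refine hlam.notMem_rho (hsub ⟨hre, abs_pos.2 him, ?_⟩)
  have h1 : |lam.im| ≤ _ := tsupport_chi_subset hτs hmem
  refine h1.trans_lt ?_
  calc min δ (a / 2 / (1 + (|s₀| + |s₁|))) * bracket lam.re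
      ≤ a / 2 / (1 + (|s₀| + |s₁|)) * (1 + (|s₀| + |s₁|)) :=
        mul_le_mul (min_le_right _ _) (bracket_le_of_mem hre) (bracket_pos _).le (by positivity)
    _ = a / 2 := by field_simp
    _ < a := by linarith

variable [CompleteSpace E]

/-- Inside the tube the estimate applies; the rest of `K` is compact in the resolvent set, where the
resolvent is continuous and hence bounded. -/
theorem ResolventEstimate.exists_bound_on_compact {A : E →ₗ.[ℂ] E} {s₀ s₁ n : ℝ}
    (h : ResolventEstimate A (Set.Ioo s₀ s₁) n) {K : Set ℂ} (hK : IsCompact K)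
    (hre : ∀ z ∈ K, z.re ∈ Set.Ioo s₀ s₁) (hrho : ∀ z ∈ K, z.im ≠ 0 → z ∈ rho A) :
    ∃ D, ∀ z ∈ K, z.im ≠ 0 → ‖res A z‖ ≤ D * |z.im| ^ (-(1 + n)) := by
  have hn := h.1
  obtain ⟨a, ha, C, hC, hsub, hest⟩ := h.exists_bound
  have hfar : IsCompact (K ∩ {z : ℂ | a ≤ |z.im|}) :=
    hK.inter_right (isClosed_le (f := fun _ : ℂ => a) (g := fun z : ℂ => |z.im|)
      (by fun_prop) (by fun_prop))
  have him : ∀ z : ℂ, a ≤ |z.im| → z.im ≠ 0 := fun z hz => abs_pos.1 (ha.trans_le hz)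
  obtain ⟨M, hM⟩ := hfar.exists_bound_of_continuousOn
    ((differentiableOn_res A).continuousOn.mono fun z hz => hrho z hz.1 (him z hz.2))
  obtain ⟨R, hR⟩ := hK.isBounded.exists_norm_le
  refine ⟨C + |M| * |R| ^ (1 + n), fun z hz hz0 => ?_⟩
  have hpos : 0 < |z.im| := abs_pos.2 hz0
  have hp := Real.rpow_pos_of_pos hpos (-(1 + n))
  rcases lt_or_ge |z.im| a with hlt | hge
  · refine (hest z ⟨hre z hz, hpos, hlt⟩).trans ?_
    gcongr
    have : 0 ≤ |M| * |R| ^ (1 + n) := by positivity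
    linarith
  · have h1 : |z.im| ≤ |R| := ((Complex.abs_im_le_norm z).trans (hR z hz)).trans (le_abs_self R)
    have h2 : 1 ≤ |R| ^ (1 + n) * |z.im| ^ (-(1 + n)) := by
      rw [Real.rpow_neg hpos.le, ← div_eq_mul_inv, one_le_div (Real.rpow_pos_of_pos hpos _)]
      exact Real.rpow_le_rpow hpos.le h1 (by linarith)
    calc ‖res A z‖ ≤ |M| * 1 := by rw [mul_one]; exact (hM z ⟨hz, hge⟩).trans (le_abs_self M)
      _ ≤ |M| * (|R| ^ (1 + n) * |z.im| ^ (-(1 + n))) := by gcongr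
      _ ≤ (C + |M| * |R| ^ (1 + n)) * |z.im| ^ (-(1 + n)) := by
          have := mul_nonneg hC hp.le
          linarith

/-- A compactly supported function of class `C¹` with `∂̄F = O(|Im z|^N)`, whose support lies over
`I` and meets the non-real spectrum of `A` nowhere. -/
structure IsAlmostAnalytic (A : E →ₗ.[ℂ] E) (I : Set ℝ) (N : ℕ) (F : ℂ → ℂ) : Prop where
  contDiff : ContDiff ℝ 1 F
  hasCompactSupport : HasCompactSupport F
  re_mem : ∀ z ∈ tsupport F, z.re ∈ I
  mem_rho : ∀ z ∈ tsupport F, z.im ≠ 0 → z ∈ rho A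
  exists_bound : ∃ C, 0 ≤ C ∧ ∀ z, ‖dbar F z‖ ≤ C * |z.im| ^ N

theorem IsAlmostAnalytic.integrable {A : E →ₗ.[ℂ] E} {s₀ s₁ n : ℝ}
    (h : ResolventEstimate A (Set.Ioo s₀ s₁) n) {N : ℕ} (hN : n < N) {F : ℂ → ℂ}
    (hF : IsAlmostAnalytic A (Set.Ioo s₀ s₁) N F) : Integrable fun z => dbar F z • res A z := by
  obtain ⟨C, -, hC⟩ := hF.exists_bound
  obtain ⟨D, hD⟩ := h.exists_bound_on_compact hF.hasCompactSupport hF.re_mem hF.mem_rho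
  exact integrable_smul_of_bounds hN (continuous_dbar hF.contDiff)
    (hasCompactSupport_dbar hF.hasCompactSupport) hC (isOpen_rho A)
    (fun z hz => hF.mem_rho z (tsupport_dbar_subset F hz)) (differentiableOn_res A).continuousOn
    (fun z hz => hD z (tsupport_dbar_subset F hz))

/-- The Helffer-Sjöstrand integral only depends on the almost analytic extension up to
`O(|Im z|^{N+1})`. -/
theorem IsAlmostAnalytic.integral_eq {A : E →ₗ.[ℂ] E} {s₀ s₁ n : ℝ}
    (h : ResolventEstimate A (Set.Ioo s₀ s₁) n) {N : ℕ} (hN : n < N) {F₁ F₂ : ℂ → ℂ}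
    (h₁ : IsAlmostAnalytic A (Set.Ioo s₀ s₁) N F₁) (h₂ : IsAlmostAnalytic A (Set.Ioo s₀ s₁) N F₂)
    {ε C : ℝ} (hε : 0 < ε) (hC : ∀ z, |z.im| < ε → ‖F₁ z - F₂ z‖ ≤ C * |z.im| ^ (N + 1)) :
    ∫ z, dbar F₁ z • res A z = ∫ z, dbar F₂ z • res A z := by
  obtain ⟨C₁, hC₁0, hC₁⟩ := h₁.exists_bound
  obtain ⟨C₂, hC₂0, hC₂⟩ := h₂.exists_bound
  have hΦ : ContDiff ℝ 1 fun z => F₁ z - F₂ z := h₁.contDiff.sub h₂.contDiff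
  have hc : HasCompactSupport fun z => F₁ z - F₂ z := h₁.hasCompactSupport.sub h₂.hasCompactSupport
  have hsupp : tsupport (fun z => F₁ z - F₂ z) ⊆ tsupport F₁ ∪ tsupport F₂ := tsupport_sub F₁ F₂
  obtain ⟨C', hC'0, hC'⟩ := exists_bound_of_near hΦ.continuous hc hε hC
  obtain ⟨D, hD⟩ := h.exists_bound_on_compact hc
    (fun z hz => (hsupp hz).elim (h₁.re_mem z) (h₂.re_mem z))
    (fun z hz => (hsupp hz).elim (h₁.mem_rho z) (h₂.mem_rho z))
  have hdb : ∀ z, dbar (fun z => F₁ z - F₂ z) z = dbar F₁ z - dbar F₂ z := fun z =>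
    dbar_sub (h₁.contDiff.differentiable (by simp) z) (h₂.contDiff.differentiable (by simp) z)
  have key := integral_dbar_smul_eq_zero_of_bounds (C := C' + C₁ + C₂) hN hΦ hc
    (fun z => (hC' z).trans (by gcongr; linarith))
    (fun z => by
      rw [hdb]
      refine (norm_sub_le _ _).trans ((add_le_add (hC₁ z) (hC₂ z)).trans ?_)
      rw [← add_mul]
      gcongr
      linarith)
    (isOpen_rho A) (fun z hz => (hsupp hz).elim (h₁.mem_rho z) (h₂.mem_rho z))
    (differentiableOn_res A) hD
  simp_rw [hdb, sub_smul] at key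
  rw [integral_sub (h₁.integrable h hN) (h₂.integrable h hN)] at key
  exact sub_eq_zero.1 key

-- Admissibility keeps the support away from non-real eigenvalues; `hev` upgrades this to the whole
-- non-real spectrum over `I`.
omit [CompleteSpace E] in
theorem isAlmostAnalytic_almostAnalytic {A : E →ₗ.[ℂ] E} {I : Set ℝ}
    (hev : ∀ z : ℂ, z.im ≠ 0 → z.re ∈ I → IsEigenvalue A z ∨ z ∈ rho A) {τ f : ℝ → ℂ}
    (hτ : IsAdmissible A I τ) (hf : IsTestFunction I f) (N : ℕ) :
    IsAlmostAnalytic A I N (almostAnalytic N τ f) where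
  contDiff := (contDiff_almostAnalytic hτ.1 hf.1 N).of_le (by simp)
  hasCompactSupport := hasCompactSupport_almostAnalytic hτ.1 hf.2.1 N
  re_mem z hz := hf.2.2 (tsupport_almostAnalytic_subset N τ f hz).1
  mem_rho z hz h0 := by
    obtain ⟨h1, h2⟩ := tsupport_almostAnalytic_subset N τ f hz
    exact (hev z h0 (hf.2.2 h1)).resolve_left fun he => hτ.2 z he h0 (hf.2.2 h1) h2
  exists_bound := exists_bound_dbar_almostAnalytic hτ.1 hf.1 hf.2.1 N

omit [CompleteSpace E] in
theorem IsAlmostAnalytic.mono {A : E →ₗ.[ℂ] E} {I : Set ℝ} {N M : ℕ} (hNM : N ≤ M) {F : ℂ → ℂ}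
    (hF : IsAlmostAnalytic A I M F) : IsAlmostAnalytic A I N F where
  contDiff := hF.contDiff
  hasCompactSupport := hF.hasCompactSupport
  re_mem := hF.re_mem
  mem_rho := hF.mem_rho
  exists_bound := by
    obtain ⟨C, hC0, hC⟩ := hF.exists_bound
    refine exists_bound_of_near (continuous_dbar hF.contDiff)
      (hasCompactSupport_dbar hF.hasCompactSupport) one_pos (C := C) fun z hz => (hC z).trans ?_
    gcongr ?_ * ?_
    exact pow_le_pow_of_le_one (abs_nonneg _) hz.le hNM

theorem exists_bound_taylorExt_sub {f : ℝ → ℂ} (hf : ContDiff ℝ ∞ f) (hc : HasCompactSupport f)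
    {N M : ℕ} (hNM : N ≤ M) :
    ∃ C, 0 ≤ C ∧ ∀ z : ℂ, |z.im| < 1 → ‖taylorExt M f z - taylorExt N f z‖ ≤ C * |z.im| ^ N := by
  induction M, hNM using Nat.le_induction with
  | base => exact ⟨0, le_rfl, fun z _ => by simp⟩
  | succ M hM ih =>
    obtain ⟨C, hC0, hC⟩ := ih
    obtain ⟨D, hD0, hD⟩ := exists_bound_taylor_term hf hc M
    refine ⟨C + D, by positivity, fun z hz => ?_⟩
    rw [taylorExt_succ, add_sub_right_comm, add_mul]
    refine (norm_add_le _ _).trans (add_le_add (hC z hz) ((hD z).trans ?_))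
    gcongr ?_ * ?_
    exact pow_le_pow_of_le_one (abs_nonneg _) hz.le hM

/-- Near the real axis both cut-offs equal `1`, and the extensions of orders `N ≤ M` differ only by
Taylor terms of degree at least `N + 1`. -/
theorem integral_hsIntegrand_eq {A : E →ₗ.[ℂ] E} {s₀ s₁ n : ℝ}
    (h : ResolventEstimate A (Set.Ioo s₀ s₁) n)
    (hev : ∀ z : ℂ, z.im ≠ 0 → z.re ∈ Set.Ioo s₀ s₁ → IsEigenvalue A z ∨ z ∈ rho A)
    {f : ℝ → ℂ} (hf : IsTestFunction (Set.Ioo s₀ s₁) f) {N M : ℕ} (hN : n < N) (hNM : N ≤ M)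
    {τ σ : ℝ → ℂ} (hτ : IsAdmissible A (Set.Ioo s₀ s₁) τ)
    (hσ : IsAdmissible A (Set.Ioo s₀ s₁) σ) :
    ∫ z, hsIntegrand A M σ f z = ∫ z, hsIntegrand A N τ f z := by
  obtain ⟨ε₁, hε₁, h₁⟩ := hτ.1.exists_almostAnalytic_eq
  obtain ⟨ε₂, hε₂, h₂⟩ := hσ.1.exists_almostAnalytic_eq
  obtain ⟨C, hC0, hC⟩ := exists_bound_taylorExt_sub hf.1 hf.2.1 (Nat.succ_le_succ hNM)
  refine IsAlmostAnalytic.integral_eq h hN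
    ((isAlmostAnalytic_almostAnalytic hev hσ hf M).mono hNM)
    (isAlmostAnalytic_almostAnalytic hev hτ hf N) (ε := min (min ε₁ ε₂) 1) (C := C)
    (by positivity) fun z hz => ?_
  rw [lt_min_iff, lt_min_iff] at hz
  rw [h₁ N f z hz.1.1, h₂ M f z hz.1.2]
  exact hC z hz.2

/-- The Helffer-Sjöstrand calculus is well defined. -/
theorem hasFunctionalCalculus_of_resolventEstimate {A : E →ₗ.[ℂ] E} {s₀ s₁ n : ℝ}
    (h : ResolventEstimate A (Set.Ioo s₀ s₁) n)
    (hev : ∀ z : ℂ, z.im ≠ 0 → z.re ∈ Set.Ioo s₀ s₁ → IsEigenvalue A z ∨ z ∈ rho A)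
    {f : ℝ → ℂ} (hf : IsTestFunction (Set.Ioo s₀ s₁) f) {N : ℕ} (hN : n < N) {τ : ℝ → ℂ}
    (hτ : IsAdmissible A (Set.Ioo s₀ s₁) τ) :
    HasFunctionalCalculus A (Set.Ioo s₀ s₁) n f
      (((Real.pi : ℂ)⁻¹) • ∫ z : ℂ, hsIntegrand A N τ f z) := by
  refine ⟨⟨τ, hτ⟩, fun M σ hM hσ =>
    ⟨(isAlmostAnalytic_almostAnalytic hev hσ hf M).integrable h hM, ?_⟩⟩
  congr 1
  rcases le_total N M with hNM | hNM
  · exact (integral_hsIntegrand_eq h hev hf hN hNM hτ hσ).symm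
  · exact integral_hsIntegrand_eq h hev hf hM hNM hσ hτ

end WellDefined

/-! ### Almost analytic extensions and composition with a holomorphic map -/

section Composition

/-- Almost analytic extensions of different types agree to high order: composing the extension of
`f` with a holomorphic map `φ` real on the reals is comparable to extending `f ∘ φ`. -/
theorem exists_bound_taylorExt_comp {W K : Set ℂ} (hW : IsOpen W) (hK : IsCompact K) (hKW : K ⊆ W)
    (hstar : ∀ z ∈ K, ∀ t ∈ Set.uIcc 0 z.im, (⟨z.re, t⟩ : ℂ) ∈ K) {φ : ℂ → ℂ}
    (hφ : DifferentiableOn ℂ φ W) (hreal : ∀ x : ℝ, (x : ℂ) ∈ W → (φ x).im = 0) {L : ℝ}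
    (hL : ∀ z ∈ K, |(φ z).im| ≤ L * |z.im|) (N : ℕ) :
    ∀ f : ℝ → ℂ, ContDiff ℝ ∞ f → HasCompactSupport f → ∀ a : ℂ → ℂ, DifferentiableOn ℂ a W →
      ∃ C, 0 ≤ C ∧ ∀ z ∈ K, ‖a z * taylorExt N f (φ z) -
        taylorExt N (fun x : ℝ => a x * f (φ x).re) z‖ ≤ C * |z.im| ^ N := by
  -- The holomorphic factor `a` is there to close the induction: differentiating `a * f ∘ φ` yields
  -- `a' * f ∘ φ` and `(a φ') * f' ∘ φ`, which are of the same form.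
  induction N with
  | zero =>
    intro f hf hc a ha
    exact ⟨0, le_rfl, fun z _ => by simp [taylorExt]⟩
  | succ N ih =>
    intro f hf hc a ha
    have hd : ContDiff ℝ ∞ (deriv f) := by simpa using hf.iterate_deriv 1
    have ha' : DifferentiableOn ℂ (deriv a) W := ha.deriv hW
    have hφ' : DifferentiableOn ℂ (deriv φ) W := hφ.deriv hW
    obtain ⟨C₁, hC₁0, hC₁⟩ := ih f hf hc (deriv a) ha'
    obtain ⟨C₂, hC₂0, hC₂⟩ := ih (deriv f) hd hc.deriv (fun z => a z * deriv φ z) (ha.mul hφ')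
    obtain ⟨M₁, hM₁0, hM₁⟩ := exists_bound_taylor_term hf hc N
    obtain ⟨M₂, hM₂0, hM₂⟩ := exists_bound_taylor_term hd hc.deriv N
    obtain ⟨A₁, hA₁⟩ := hK.exists_bound_of_continuousOn (ha'.continuousOn.mono hKW)
    obtain ⟨A₂, hA₂⟩ := hK.exists_bound_of_continuousOn ((ha.mul hφ').continuousOn.mono hKW)
    have hsm : ∀ (b : ℂ → ℂ) (g : ℝ → ℂ), DifferentiableOn ℂ b W → ContDiff ℝ ∞ g → ∀ x : ℝ,
        (x : ℂ) ∈ W → ContDiffAt ℝ ∞ (fun x : ℝ => b x * g (φ x).re) x := by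
      intro b g hb hg x hx
      have h1 : ∀ u : ℂ → ℂ, DifferentiableOn ℂ u W → ContDiffAt ℝ ∞ (fun x : ℝ => u x) x := by
        intro u hu
        have h2 : ContDiffAt ℂ ∞ u (x : ℂ) := (hu.analyticAt (hW.mem_nhds hx)).contDiffAt
        exact (h2.restrict_scalars ℝ).comp x Complex.ofRealCLM.contDiff.contDiffAt
      exact (h1 b hb).mul (hg.contDiffAt.comp x
        (Complex.reCLM.contDiff.contDiffAt.comp x (h1 φ hφ)))
    have hWr : IsOpen {x : ℝ | (x : ℂ) ∈ W} := hW.preimage Complex.continuous_ofReal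
    have hders : ∀ u : ℂ → ℂ, DifferentiableOn ℂ u W → ∀ x : ℝ, (x : ℂ) ∈ W →
        HasDerivAt (fun x : ℝ => u x) (deriv u x) x := fun u hu x hx =>
      (hu.differentiableAt (hW.mem_nhds hx)).hasDerivAt.comp_ofReal
    -- Needed so that the real chain rule for `f (φ x).re` produces the holomorphic factor `deriv φ`
    -- and not its real part.
    have hφreal : ∀ x : ℝ, (x : ℂ) ∈ W → (deriv φ x).im = 0 := by
      intro x hx
      have h1 : HasDerivAt (fun x : ℝ => (φ x).im) (deriv φ x).im x :=
        Complex.imCLM.hasFDerivAt.comp_hasDerivAt x (hders φ hφ x hx)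
      have h2 : (fun x : ℝ => (φ x).im) =ᶠ[𝓝 x] fun _ => 0 := by
        filter_upwards [hWr.mem_nhds hx] with y hy using hreal y hy
      rw [← h1.deriv, h2.deriv_eq, deriv_const]
    have hderiv : ∀ x : ℝ, (x : ℂ) ∈ W → deriv (fun x : ℝ => a x * f (φ x).re) =ᶠ[𝓝 x]
        fun x : ℝ => deriv a x * f (φ x).re + (a x * deriv φ x) * deriv f (φ x).re := by
      intro x hx
      filter_upwards [hWr.mem_nhds hx] with y hy
      have h1 : HasDerivAt (fun x : ℝ => (φ x).re) (deriv φ y).re y :=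
        Complex.reCLM.hasFDerivAt.comp_hasDerivAt y (hders φ hφ y hy)
      have h2 : HasDerivAt (fun x : ℝ => f (φ x).re) ((deriv φ y).re • deriv f (φ y).re) y :=
        ((hf.differentiable (by simp) (φ y).re).hasDerivAt).scomp y h1
      rw [((hders a ha y hy).fun_mul h2).deriv]
      have h3 : ((deriv φ y).re : ℂ) = deriv φ y := Complex.ext rfl (by simp [hφreal y hy])
      simp only [Complex.real_smul, h3]
      ring
    have hcoe : ∀ z ∈ K, (z.re : ℂ) ∈ W := by
      intro z hz
      have := hKW (hstar z hz 0 Set.left_mem_uIcc)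
      exact this
    have hLnn : ∀ z ∈ K, |(φ z).im| ^ N ≤ |L| ^ N * |z.im| ^ N := by
      intro z hz
      rw [← mul_pow]
      exact pow_le_pow_left₀ (abs_nonneg _)
        ((hL z hz).trans (mul_le_mul_of_nonneg_right (le_abs_self L) (abs_nonneg _))) N
    set C := C₁ + C₂ + |A₁| * (M₁ * |L| ^ N) + |A₂| * (M₂ * |L| ^ N) with hCdef
    have hC0 : 0 ≤ C := by positivity
    refine ⟨C, hC0, fun z hz => ?_⟩
    let h : ℝ → ℂ := fun x => a x * f (φ x).re
    let D : ℝ → ℂ := fun y => a ⟨z.re, y⟩ * taylorExt (N + 1) f (φ ⟨z.re, y⟩) -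
      taylorExt (N + 1) h ⟨z.re, y⟩
    -- The vertical derivative of `D`: the two errors of the inductive hypothesis, plus two
    -- top-degree Taylor terms left over because the horizontal derivative keeps one more term than
    -- the vertical one. These are `O(|Im φ| ^ N)`, hence `O(|y| ^ N)`.
    let D' : ℝ → ℂ := fun y => Complex.I *
      ((deriv a ⟨z.re, y⟩ * taylorExt N f (φ ⟨z.re, y⟩) -
          taylorExt N (fun x : ℝ => deriv a x * f (φ x).re) ⟨z.re, y⟩) +
        (a ⟨z.re, y⟩ * deriv φ ⟨z.re, y⟩ * taylorExt N (deriv f) (φ ⟨z.re, y⟩) -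
          taylorExt N (fun x : ℝ => a x * deriv φ x * deriv f (φ x).re) ⟨z.re, y⟩) +
        deriv a ⟨z.re, y⟩ * (iteratedDeriv N f (φ ⟨z.re, y⟩).re / (N.factorial : ℂ) *
          (Complex.I * ((φ ⟨z.re, y⟩).im : ℂ)) ^ N)) +
      a ⟨z.re, y⟩ * ((Complex.I * deriv φ ⟨z.re, y⟩).re *
        (iteratedDeriv N (deriv f) (φ ⟨z.re, y⟩).re / (N.factorial : ℂ) *
          (Complex.I * ((φ ⟨z.re, y⟩).im : ℂ)) ^ N))
    have hvert : ∀ y : ℝ, HasDerivAt (fun t : ℝ => (⟨z.re, t⟩ : ℂ)) Complex.I y := by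
      intro y
      have h1 := ((Complex.ofRealCLM.hasDerivAt (x := y)).mul_const Complex.I).const_add (z.re : ℂ)
      have h2 : (fun t : ℝ => (⟨z.re, t⟩ : ℂ)) = fun t : ℝ => (z.re : ℂ) + (t : ℂ) * Complex.I := by
        ext t; exact Complex.mk_eq_add_mul_I _ _
      rw [h2]
      simpa using h1
    have hD : ∀ y ∈ Set.uIcc 0 z.im, HasDerivAt D (D' y) y := by
      intro y hy
      have hyK := hstar z hz y hy
      have hyW := hKW hyK
      have h1 : HasDerivAt (fun t : ℝ => a ⟨z.re, t⟩) (deriv a ⟨z.re, y⟩ * Complex.I) y := by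
        have := (ha.differentiableAt (hW.mem_nhds hyW)).hasDerivAt.scomp y (hvert y)
        rw [mul_comm]; exact this
      have h2 : HasDerivAt (fun t : ℝ => φ ⟨z.re, t⟩) (Complex.I * deriv φ ⟨z.re, y⟩) y :=
        (hφ.differentiableAt (hW.mem_nhds hyW)).hasDerivAt.scomp y (hvert y)
      have h3 := (hasFDerivAt_taylorExt hf N (φ ⟨z.re, y⟩)).comp_hasDerivAt y h2
      have h4 := (h1.mul h3).sub (hasDerivAt_taylorExt_vertical h N z.re y)
      refine h4.congr_deriv ?_
      have h5 : taylorExt N (deriv h) ⟨z.re, y⟩ =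
          taylorExt N (fun x : ℝ => deriv a x * f (φ x).re) ⟨z.re, y⟩ +
            taylorExt N (fun x : ℝ => (a x * deriv φ x) * deriv f (φ x).re) ⟨z.re, y⟩ := by
        have h6 := taylorExt_add (w := ⟨z.re, y⟩) (hsm _ _ ha' hf _ (hcoe z hz))
          (hsm (fun z => a z * deriv φ z) _ (ha.mul hφ') hd _ (hcoe z hz)) N
        rw [← h6]
        exact taylorExt_congr (w := ⟨z.re, y⟩) (hderiv _ (hcoe z hz)) N
      have h6 : Complex.I * deriv φ ⟨z.re, y⟩ = ((Complex.I * deriv φ ⟨z.re, y⟩).re : ℂ) +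
          ((Complex.I * deriv φ ⟨z.re, y⟩).im : ℂ) * Complex.I := (Complex.re_add_im _).symm
      simp only [D', h5, _root_.add_apply, ContinuousLinearMap.smulRight_apply,
        Complex.reCLM_apply, Complex.imCLM_apply, Complex.real_smul, taylorExt_succ, Function.comp_apply]
      linear_combination (-(a ⟨z.re, y⟩ * taylorExt N (deriv f) (φ ⟨z.re, y⟩))) * h6
    have hD'b : ∀ y ∈ Set.uIcc 0 z.im, ‖D' y‖ ≤ C * |z.im| ^ N := by
      intro y hy
      have hyK := hstar z hz y hy
      have hyabs : |y| ≤ |z.im| := by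
        rcases Set.mem_uIcc.1 hy with h | h
        · rw [abs_of_nonneg h.1, abs_of_nonneg (h.1.trans h.2)]; exact h.2
        · rw [abs_of_nonpos h.2, abs_of_nonpos (h.1.trans h.2)]; linarith [h.1]
      have hypow : |y| ^ N ≤ |z.im| ^ N := pow_le_pow_left₀ (abs_nonneg _) hyabs N
      have b1 := hC₁ _ hyK
      have b2 := hC₂ _ hyK
      have b3 : ‖deriv a ⟨z.re, y⟩ * (iteratedDeriv N f (φ ⟨z.re, y⟩).re / (N.factorial : ℂ) *
          (Complex.I * ((φ ⟨z.re, y⟩).im : ℂ)) ^ N)‖ ≤ |A₁| * (M₁ * |L| ^ N) * |y| ^ N := by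
        rw [norm_mul]
        calc _ ≤ |A₁| * (M₁ * (|L| ^ N * |y| ^ N)) :=
              mul_le_mul ((hA₁ _ hyK).trans (le_abs_self _))
                ((hM₁ _).trans (mul_le_mul_of_nonneg_left (hLnn _ hyK) hM₁0)) (norm_nonneg _)
                (abs_nonneg _)
          _ = _ := by ring
      have b4 : ‖a ⟨z.re, y⟩ * ((Complex.I * deriv φ ⟨z.re, y⟩).re *
        (iteratedDeriv N (deriv f) (φ ⟨z.re, y⟩).re / (N.factorial : ℂ) *
          (Complex.I * ((φ ⟨z.re, y⟩).im : ℂ)) ^ N))‖ ≤ |A₂| * (M₂ * |L| ^ N) * |y| ^ N := by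
        rw [← mul_assoc, norm_mul]
        have h1 : ‖a ⟨z.re, y⟩ * ((Complex.I * deriv φ ⟨z.re, y⟩).re : ℂ)‖ ≤ |A₂| := by
          refine le_trans ?_ ((hA₂ _ hyK).trans (le_abs_self _))
          simp only [Pi.mul_apply]
          rw [norm_mul, norm_mul, Complex.norm_real]
          gcongr
          refine (Complex.abs_re_le_norm _).trans ?_
          rw [norm_mul, Complex.norm_I, one_mul]
        calc _ ≤ |A₂| * (M₂ * (|L| ^ N * |y| ^ N)) :=
              mul_le_mul h1
                ((hM₂ _).trans (mul_le_mul_of_nonneg_left (hLnn _ hyK) hM₂0)) (norm_nonneg _)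
                (abs_nonneg _)
          _ = _ := by ring
      calc ‖D' y‖ ≤ C₁ * |y| ^ N + C₂ * |y| ^ N + |A₁| * (M₁ * |L| ^ N) * |y| ^ N +
            |A₂| * (M₂ * |L| ^ N) * |y| ^ N := by
            refine (norm_add_le _ _).trans (add_le_add ?_ b4)
            rw [norm_mul, Complex.norm_I, one_mul]
            refine (norm_add_le _ _).trans (add_le_add ?_ b3)
            exact (norm_add_le _ _).trans (add_le_add b1 b2)
        _ = C * |y| ^ N := by rw [hCdef]; ring
        _ ≤ C * |z.im| ^ N := by gcongr
    have hD0 : D 0 = 0 := by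
      have h1 : (φ (z.re : ℂ)).im = 0 := hreal _ (hcoe z hz)
      have h2 : (⟨z.re, 0⟩ : ℂ) = (z.re : ℂ) := rfl
      simp only [D, h2]
      rw [taylorExt_of_im_eq_zero N f h1, taylorExt_of_im_eq_zero N h (by simp)]
      simp [h]
    -- Integrating from the real axis, where `D` vanishes, gains the missing power of `|Im z|`.
    have hfin := (convex_uIcc (0 : ℝ) z.im).norm_image_sub_le_of_norm_hasDerivWithin_le
      (fun y hy => (hD y hy).hasDerivWithinAt) hD'b Set.left_mem_uIcc Set.right_mem_uIcc
    rw [hD0, sub_zero, sub_zero, Real.norm_eq_abs] at hfin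
    rw [pow_succ, ← mul_assoc]
    exact hfin

end Composition

end SpecCalc

namespace SpecCalc

open Filter Topology
open scoped ComplexConjugate

/-! ### The map `(z + c)^{-m}`, its inverse, and the pullback of test functions -/

section PowMap

/-- The map `z ↦ (z + c)^{-m}`. -/
noncomputable def powMap (c : ℝ) (m : ℕ) (z : ℂ) : ℂ := ((z + c) ^ m)⁻¹

/-- The inverse `w ↦ w^{-1/m} - c` of `powMap`. -/
noncomputable def powInv (c : ℝ) (m : ℕ) (w : ℂ) : ℂ := Complex.exp (-(Complex.log w / m)) - c

variable {c : ℝ} {m : ℕ}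

theorem powMap_powInv (hm : 1 ≤ m) {w : ℂ} (hw : w ≠ 0) : powMap c m (powInv c m w) = w := by
  have hm' : (m : ℂ) ≠ 0 := by exact_mod_cast (by omega : m ≠ 0)
  rw [powMap, powInv, sub_add_cancel, ← Complex.exp_nat_mul, ← Complex.exp_neg]
  have : -(m * -(Complex.log w / m)) = Complex.log w := by field_simp
  rw [this, Complex.exp_log hw]

theorem powInv_powMap (hm : 1 ≤ m) {z : ℂ} (hz : z + c ∈ sector m) :
    powInv c m (powMap c m z) = z := by
  have hm' : (m : ℂ) ≠ 0 := by exact_mod_cast (by omega : m ≠ 0)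
  obtain ⟨h1, h2⟩ := log_pow_of_mem_sector hm hz
  have h3 : ((z + c) ^ m).arg ≠ Real.pi := fun h => by
    rw [h, abs_of_pos Real.pi_pos] at h2
    linarith [Real.pi_pos]
  rw [powInv, powMap, Complex.log_inv _ h3, h1]
  have : -(-(m * Complex.log (z + c)) / m) = Complex.log (z + c) := by field_simp
  rw [this, Complex.exp_log (sector_ne_zero hz), add_sub_cancel_right]

theorem continuousOn_powInv : ContinuousOn (powInv c m) {w | 0 < w.re} := by
  intro w hw
  have h1 : ContinuousAt Complex.log w := continuousAt_clog (Or.inl hw)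
  exact ((Complex.continuous_exp.continuousAt.comp (h1.div_const _).neg).sub
    continuousAt_const).continuousWithinAt

theorem powInv_ofReal (r : ℝ) (hr : 0 < r) :
    powInv c m (r : ℂ) = ((Real.exp (-(Real.log r / m)) - c : ℝ) : ℂ) := by
  rw [powInv, ← Complex.ofReal_log hr.le]
  push_cast
  rfl

theorem powInv_ofReal_mem (hm : 1 ≤ m) {s₀ s₁ r : ℝ} (h0 : 0 < s₀ + c) (hs : s₀ < s₁)
    (h1 : ((s₁ + c) ^ m)⁻¹ < r) (h2 : r < ((s₀ + c) ^ m)⁻¹) :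
    (powInv c m (r : ℂ)).re ∈ Set.Ioo s₀ s₁ ∧ (powInv c m (r : ℂ)).im = 0 := by
  have hm' : (m : ℝ) ≠ 0 := by exact_mod_cast (by omega : m ≠ 0)
  have hp1 : 0 < (s₁ + c) ^ m := pow_pos (by linarith) _
  have hp0 : 0 < (s₀ + c) ^ m := pow_pos h0 _
  have hr : 0 < r := (inv_pos.2 hp1).trans h1
  rw [powInv_ofReal r hr, Complex.ofReal_re, Complex.ofReal_im]
  refine ⟨?_, rfl⟩
  set u := Real.exp (-(Real.log r / m)) with hu
  have hum : u ^ m = r⁻¹ := by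
    rw [hu, ← Real.exp_nat_mul]
    have : (m : ℝ) * -(Real.log r / m) = -Real.log r := by field_simp
    rw [this, Real.exp_neg, Real.exp_log hr]
  have hu0 : 0 ≤ u := (Real.exp_pos _).le
  constructor
  · have h3 : (s₀ + c) ^ m < u ^ m := by
      rw [hum]
      exact (lt_inv_comm₀ hr hp0).1 h2
    have := lt_of_pow_lt_pow_left₀ m hu0 h3
    linarith
  · have h3 : u ^ m < (s₁ + c) ^ m := by
      rw [hum]
      exact (inv_lt_comm₀ hp1 hr).1 h1
    have := lt_of_pow_lt_pow_left₀ m (by linarith) h3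
    linarith

theorem hasDerivAt_powMap {z : ℂ} (hz : z + c ≠ 0) :
    HasDerivAt (powMap c m) (-(m : ℂ) * (z + c)⁻¹ ^ (m + 1)) z := by
  have h1 : HasDerivAt (fun z : ℂ => z + c) 1 z := (hasDerivAt_id z).add_const _
  have h2 := (h1.fun_pow m).fun_inv (pow_ne_zero m hz)
  refine h2.congr_deriv ?_
  rcases m with _ | k
  · simp
  · rw [Nat.add_sub_cancel, inv_pow]
    field_simp
    ring

theorem powMap_ofReal_im (x : ℝ) : (powMap c m x).im = 0 := by
  rw [powMap, ← Complex.ofReal_add, ← Complex.ofReal_pow, ← Complex.ofReal_inv, Complex.ofReal_im]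

theorem powMap_ofReal_re (x : ℝ) : (powMap c m x).re = ((x + c) ^ m)⁻¹ := by
  rw [powMap, ← Complex.ofReal_add, ← Complex.ofReal_pow, ← Complex.ofReal_inv, Complex.ofReal_re]

theorem add_ne_zero_of_le_re {s₀ : ℝ} (h0 : 0 < s₀ + c) {z : ℂ} (hz : s₀ ≤ z.re) :
    z + c ≠ 0 := by
  intro h
  have := congrArg Complex.re h
  simp only [Complex.add_re, Complex.ofReal_re, Complex.zero_re] at this
  linarith

theorem norm_deriv_powMap_le {s₀ : ℝ} (h0 : 0 < s₀ + c) {z : ℂ} (hz : s₀ ≤ z.re) :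
    ‖-(m : ℂ) * (z + c)⁻¹ ^ (m + 1)‖ ≤ m * (s₀ + c)⁻¹ ^ (m + 1) := by
  rw [norm_mul, norm_neg, Complex.norm_natCast, norm_pow, norm_inv]
  have h1 : s₀ + c ≤ ‖z + c‖ := by
    refine le_trans ?_ (Complex.re_le_norm _)
    simp only [Complex.add_re, Complex.ofReal_re]
    linarith
  gcongr

/-- The mean value inequality between `z` and its real part, where the map is real; the derivative
is bounded on the half-plane `Re z ≥ s₀`. -/
theorem abs_im_powMap_le {s₀ : ℝ} (h0 : 0 < s₀ + c) {z : ℂ} (hz : s₀ ≤ z.re) :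
    |(powMap c m z).im| ≤ m * (s₀ + c)⁻¹ ^ (m + 1) * |z.im| := by
  have hconv : Convex ℝ {z : ℂ | s₀ ≤ z.re} := convex_halfSpace_re_ge s₀
  have h1 := hconv.norm_image_sub_le_of_norm_hasDerivWithin_le (f := powMap c m)
    (x := (z.re : ℂ)) (y := z)
    (fun w hw => (hasDerivAt_powMap (add_ne_zero_of_le_re h0 hw)).hasDerivWithinAt)
    (fun w hw => norm_deriv_powMap_le h0 hw) (by change s₀ ≤ ((z.re : ℂ)).re; simpa using hz) hz
  have h2 : z - (z.re : ℂ) = z.im * Complex.I := by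
    rw [sub_eq_iff_eq_add, add_comm]; exact (Complex.re_add_im z).symm
  rw [h2, norm_mul, Complex.norm_I, mul_one, Complex.norm_real, Real.norm_eq_abs] at h1
  refine le_trans ?_ h1
  have h3 := Complex.abs_im_le_norm (powMap c m z - powMap c m z.re)
  rwa [Complex.sub_im, powMap_ofReal_im, sub_zero] at h3

theorem isOpen_strip (s₀ s₁ b : ℝ) : IsOpen {z : ℂ | z.re ∈ Set.Ioo s₀ s₁ ∧ |z.im| < b} :=
  (isOpen_Ioo.preimage Complex.continuous_re).inter
    (isOpen_lt (f := fun z : ℂ => |z.im|) (g := fun _ => b) (by fun_prop) (by fun_prop))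

/-- The inverse map sends the compact interval `[r₀, r₁]` into `I`, so by continuity it sends a
uniform complex neighbourhood of it into the open strip. -/
theorem exists_powInv_mem_strip (hm : 1 ≤ m) {s₀ s₁ r₀ r₁ b : ℝ} (h0 : 0 < s₀ + c) (hs : s₀ < s₁)
    (hr₀ : ((s₁ + c) ^ m)⁻¹ < r₀) (hr₁ : r₁ < ((s₀ + c) ^ m)⁻¹) (hb : 0 < b) :
    ∃ a > 0, ∀ w : ℂ, w.re ∈ Set.Icc r₀ r₁ → |w.im| < a → 0 < w.re ∧
      powInv c m w ∈ {z : ℂ | z.re ∈ Set.Ioo s₀ s₁ ∧ |z.im| < b} := by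
  have hp1 : 0 < (s₁ + c) ^ m := pow_pos (by linarith) _
  have hre : IsOpen {w : ℂ | 0 < w.re} := isOpen_lt continuous_const Complex.continuous_re
  have hopen : IsOpen ({w : ℂ | 0 < w.re} ∩
      powInv c m ⁻¹' {z : ℂ | z.re ∈ Set.Ioo s₀ s₁ ∧ |z.im| < b}) :=
    continuousOn_powInv.isOpen_inter_preimage hre (isOpen_strip s₀ s₁ b)
  have hcpt : IsCompact ((fun x : ℝ => (x : ℂ)) '' Set.Icc r₀ r₁) :=
    isCompact_Icc.image Complex.continuous_ofReal
  have hsub : (fun x : ℝ => (x : ℂ)) '' Set.Icc r₀ r₁ ⊆ {w : ℂ | 0 < w.re} ∩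
      powInv c m ⁻¹' {z : ℂ | z.re ∈ Set.Ioo s₀ s₁ ∧ |z.im| < b} := by
    rintro _ ⟨r, hr, rfl⟩
    have hr' : ((s₁ + c) ^ m)⁻¹ < r := hr₀.trans_le hr.1
    obtain ⟨h1, h2⟩ := powInv_ofReal_mem (c := c) hm h0 hs hr' (hr.2.trans_lt hr₁)
    refine ⟨(inv_pos.2 hp1).trans (by simpa using hr'), h1, ?_⟩
    rw [h2, abs_zero]
    exact hb
  obtain ⟨a, ha, hthick⟩ := hcpt.exists_thickening_subset_open hopen hsub
  refine ⟨a, ha, fun w hw1 hw2 => ?_⟩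
  refine hthick (Metric.mem_thickening_iff.2 ⟨(w.re : ℂ), ⟨w.re, hw1, rfl⟩, ?_⟩)
  rw [Complex.dist_of_re_eq (by simp), Complex.ofReal_im, Real.dist_eq, sub_zero]
  exact hw2

theorem isTestFunction_pullback {s₀ s₁ r₀ r₁ : ℝ} (h0 : 0 < s₀ + c)
    (hr₀ : ((s₁ + c) ^ m)⁻¹ < r₀) (hr₁ : r₁ < ((s₀ + c) ^ m)⁻¹) {f : ℝ → ℂ}
    (hf : IsTestFunction (Set.Ioo r₀ r₁) f) :
    IsTestFunction (Set.Ioo s₀ s₁) (pullback s₀ s₁ c m f) := by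
  let K : Set ℝ := Set.Icc s₀ s₁ ∩ (fun t : ℝ => ((t + c) ^ m)⁻¹) ⁻¹' tsupport f
  have hcont : ContinuousOn (fun t : ℝ => ((t + c) ^ m)⁻¹) (Set.Icc s₀ s₁) := by
    refine ContinuousOn.inv₀ (by fun_prop) fun t ht => ?_
    exact (pow_pos (by linarith [ht.1]) m).ne'
  have hKc : IsClosed K := hcont.preimage_isClosed_of_isClosed isClosed_Icc (isClosed_tsupport f)
  have hK : IsCompact K := isCompact_Icc.of_isClosed_subset hKc Set.inter_subset_left
  have hsupp : tsupport (pullback s₀ s₁ c m f) ⊆ K := by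
    refine closure_minimal (fun t ht => ?_) hKc
    have ht' := Set.mem_of_indicator_ne_zero ht
    refine ⟨Set.Ioo_subset_Icc_self ht', ?_⟩
    rw [Function.mem_support, pullback, Set.indicator_of_mem ht'] at ht
    exact subset_tsupport _ ht
  -- At the endpoints of `I` the map takes values outside `(r₀, r₁)`. Hence the support stays away
  -- from them and the extension by zero is smooth.
  have hKI : K ⊆ Set.Ioo s₀ s₁ := by
    rintro t ⟨ht, hft⟩
    have h1 := hf.2.2 hft
    refine ⟨lt_of_le_of_ne ht.1 ?_, lt_of_le_of_ne ht.2 ?_⟩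
    · rintro rfl
      exact absurd (h1.2.trans hr₁) (lt_irrefl _)
    · rintro rfl
      exact absurd (hr₀.trans h1.1) (lt_irrefl _)
  refine ⟨contDiff_iff_contDiffAt.2 fun t => ?_, hK.of_isClosed_subset (isClosed_tsupport _) hsupp,
    hsupp.trans hKI⟩
  by_cases ht : t ∈ Set.Ioo s₀ s₁
  · have h1 : pullback s₀ s₁ c m f =ᶠ[𝓝 t] fun t => f (((t + c) ^ m)⁻¹) := by
      filter_upwards [isOpen_Ioo.mem_nhds ht] with x hx
      rw [pullback, Set.indicator_of_mem hx]
    refine ContDiffAt.congr_of_eventuallyEq ?_ h1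
    have h2 : (t + c) ^ m ≠ 0 := (pow_pos (by linarith [ht.1]) m).ne'
    exact hf.1.contDiffAt.comp t (ContDiffAt.inv (by fun_prop) h2)
  · have h1 : t ∉ tsupport (pullback s₀ s₁ c m f) := fun h => ht (hKI (hsupp h))
    have h2 : pullback s₀ s₁ c m f =ᶠ[𝓝 t] fun _ => 0 := by
      filter_upwards [(isClosed_tsupport _).isOpen_compl.mem_nhds h1] with x hx
      exact image_eq_zero_of_notMem_tsupport hx
    exact contDiffAt_const.congr_of_eventuallyEq h2

end PowMap

/-! ### Chain rule for `∂̄` and the real Jacobian of a holomorphic map -/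

section ChangeOfVariables

theorem dbar_comp {F φ : ℂ → ℂ} {z d : ℂ} (hF : DifferentiableAt ℝ F (φ z))
    (hφ : HasDerivAt φ d z) : dbar (fun w => F (φ w)) z = conj d * dbar F (φ z) := by
  have h1 : HasFDerivAt (fun w => F (φ w)) _ z :=
    hF.hasFDerivAt.comp z (hφ.hasFDerivAt.restrictScalars ℝ)
  have h2 : ∀ u : ℂ, fderiv ℝ F (φ z) u =
      u.re * fderiv ℝ F (φ z) 1 + u.im * fderiv ℝ F (φ z) Complex.I := by
    intro u
    have : u = u.re • (1 : ℂ) + u.im • Complex.I := by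
      simp [Complex.re_add_im]
    conv_lhs => rw [this, map_add, map_smul, map_smul]
    simp
  rw [dbar, dbar, h1.fderiv]
  simp only [ContinuousLinearMap.comp_apply, ContinuousLinearMap.coe_restrictScalars',
    ContinuousLinearMap.toSpanSingleton_apply, smul_eq_mul, one_mul]
  rw [h2 d, h2 (Complex.I * d)]
  have h3 : conj d = d.re - d.im * Complex.I := by
    apply Complex.ext <;> simp
  simp only [Complex.mul_re, Complex.mul_im, Complex.I_re, Complex.I_im, h3]
  push_cast
  linear_combination (1 / 2 * d.im * fderiv ℝ F (φ z) Complex.I) * Complex.I_sq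

theorem det_restrictScalars_toSpanSingleton (d : ℂ) :
    (((ContinuousLinearMap.toSpanSingleton ℂ d : ℂ →L[ℂ] ℂ).restrictScalars ℝ : ℂ →L[ℝ] ℂ)).det =
      Complex.normSq d := by
  rw [← Algebra.norm_complex_apply, Algebra.norm_apply, ContinuousLinearMap.det]
  congr 1
  ext <;> simp [mul_comm]

end ChangeOfVariables

/-! ### Transfer of the resolvent estimate -/

section Main

variable {E : Type*} [NormedAddCommGroup E] [InnerProductSpace ℂ E] [CompleteSpace E]

theorem isCompact_rect (s₀ s₁ b : ℝ) :
    IsCompact {z : ℂ | z.re ∈ Set.Icc s₀ s₁ ∧ z.im ∈ Set.Icc (-b) b} :=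
  isCompact_Icc.reProdIm isCompact_Icc

/-- The resolvent estimate carries over from `A` to `(A + c)^{-m}`. -/
theorem resolventEstimate_invPow {A : E →ₗ.[ℂ] E} {c : ℝ} (hc : -(c : ℂ) ∈ rho A) {m : ℕ}
    (hm : 1 ≤ m) (hsec : ∀ z : ℂ, z ∉ rho A → z + c ∈ sector m) {s₀ s₁ : ℝ} (hs : s₀ < s₁)
    (h0 : 0 < s₀ + c) (hstrip : ∀ z : ℂ, s₀ ≤ z.re → |z.im| ≤ 1 → z + c ∈ sector m) {n : ℝ}
    (h : ResolventEstimate A (Set.Ioo s₀ s₁) n) {r₀ r₁ : ℝ}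
    (hr₀ : ((s₁ + c) ^ m)⁻¹ < r₀) (hr₁ : r₁ < ((s₀ + c) ^ m)⁻¹) :
    ResolventEstimate (ofBounded (invPow A c m)) (Set.Ioo r₀ r₁) n := by
  have hn := h.1
  obtain ⟨a, ha, C, hC, hsub, hest⟩ := h.exists_bound
  obtain ⟨G, Y, -, hY, hres⟩ := exists_res_invPow hc hm hsec
  -- Height at most `a` keeps `z` in the tube of the hypothesis. Height at most `1` keeps `z + c` in
  -- the sector and makes `|Im z|^{-(1+n)} ≥ 1`, which absorbs the non-singular term of the
  -- resolvent.
  obtain ⟨a', ha', hinv⟩ := exists_powInv_mem_strip (c := c) hm (b := min a 1) h0 hs hr₀ hr₁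
    (by positivity)
  set K : Set ℂ := {z : ℂ | z.re ∈ Set.Icc s₀ s₁ ∧ z.im ∈ Set.Icc (-1) 1}
  have hK : IsCompact K := isCompact_rect s₀ s₁ 1
  have hKs : ∀ z ∈ K, z + c ∈ sector m := fun z hz => hstrip z hz.1.1 (abs_le.2 hz.2)
  obtain ⟨My, hMy⟩ := hK.exists_bound_of_continuousOn (hY.continuousOn.mono hKs)
  obtain ⟨Z, hZ⟩ := hK.exists_bound_of_continuousOn
    (f := fun z : ℂ => z + (c : ℂ)) (by fun_prop)
  set L : ℝ := m * (s₀ + c)⁻¹ ^ (m + 1) with hLdef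
  have hL : 0 < L := by
    have : (0 : ℝ) < m := by exact_mod_cast hm
    positivity
  have key : ∀ w ∈ tube a' (Set.Ioo r₀ r₁), w ∈ rho (ofBounded (invPow A c m)) ∧
      ‖res (ofBounded (invPow A c m)) w‖ ≤
        |My| * (|Z| + |Z| ^ 2 * C) * (L ^ (-(1 + n)))⁻¹ * |w.im| ^ (-(1 + n)) := by
    intro w hw
    obtain ⟨hwre, hz⟩ := hinv w (Set.Ioo_subset_Icc_self hw.1) hw.2.2
    have hw0 : w ≠ 0 := by rintro rfl; simp at hwre
    have hφ : powMap c m (powInv c m w) = w := powMap_powInv hm hw0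
    set z := powInv c m w
    have hzre : s₀ ≤ z.re := hz.1.1.le
    have hz1 : |z.im| < 1 := hz.2.trans_le (min_le_right _ _)
    have hzim : |w.im| ≤ L * |z.im| := by
      have := abs_im_powMap_le (m := m) h0 hzre
      rwa [hφ] at this
    have hzpos : 0 < |z.im| := by
      by_contra hcon
      have : |z.im| = 0 := le_antisymm (not_lt.1 hcon) (abs_nonneg _)
      rw [this, mul_zero] at hzim
      exact absurd hw.2.1 (not_lt.2 hzim)
    have hztube : z ∈ tube a (Set.Ioo s₀ s₁) := ⟨hz.1, hzpos, hz.2.trans_le (min_le_left _ _)⟩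
    have hzK : z ∈ K := ⟨Set.Ioo_subset_Icc_self hz.1, abs_le.1 hz1.le⟩
    obtain ⟨hr1, hr2, -⟩ := hres z (hsub hztube) (hKs z hzK)
    change powMap c m z ∈ _ at hr1
    change res _ (powMap c m z) = _ at hr2
    rw [hφ] at hr1 hr2
    refine ⟨hr1, ?_⟩
    have hp : 1 ≤ |z.im| ^ (-(1 + n)) :=
      Real.one_le_rpow_of_pos_of_le_one_of_nonpos hzpos hz1.le (by linarith)
    -- The exponent is negative, so the upper bound `|Im w| ≤ L |Im z|` is the direction needed, and
    -- `n` is unchanged.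
    have hq : |z.im| ^ (-(1 + n)) ≤ (L ^ (-(1 + n)))⁻¹ * |w.im| ^ (-(1 + n)) := by
      have h1 : |w.im| / L ≤ |z.im| := by rwa [div_le_iff₀' hL]
      have h2 := Real.rpow_le_rpow_of_nonpos (div_pos hw.2.1 hL) h1
        (by linarith : -(1 + n) ≤ 0)
      rw [Real.div_rpow (abs_nonneg _) hL.le] at h2
      rwa [inv_mul_eq_div]
    have hZ1 : ‖z + (c : ℂ)‖ ≤ |Z| := (hZ z hzK).trans (le_abs_self Z)
    have h1E : ‖(1 : E →L[ℂ] E)‖ ≤ 1 := ContinuousLinearMap.norm_id_le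
    rw [hr2, norm_neg]
    calc ‖Y z * ((z + c) • 1 + (z + c) ^ 2 • res A z)‖
        ≤ ‖Y z‖ * (‖z + (c : ℂ)‖ * ‖(1 : E →L[ℂ] E)‖ + ‖z + (c : ℂ)‖ ^ 2 * ‖res A z‖) := by
          refine (norm_mul_le _ _).trans ?_
          gcongr
          refine (norm_add_le _ _).trans ?_
          rw [norm_smul, norm_smul, norm_pow]
      _ ≤ |My| * (|Z| * 1 + |Z| ^ 2 * (C * |z.im| ^ (-(1 + n)))) := by
          gcongr
          · exact (hMy z hzK).trans (le_abs_self _)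
          · exact hest z hztube
      _ ≤ |My| * (|Z| * |z.im| ^ (-(1 + n)) + |Z| ^ 2 * (C * |z.im| ^ (-(1 + n)))) := by
          gcongr
      _ = |My| * (|Z| + |Z| ^ 2 * C) * |z.im| ^ (-(1 + n)) := by ring
      _ ≤ |My| * (|Z| + |Z| ^ 2 * C) * ((L ^ (-(1 + n)))⁻¹ * |w.im| ^ (-(1 + n))) := by gcongr
      _ = _ := by ring
  exact ResolventEstimate.of_bound hn ha' (fun w hw => (key w hw).1) (fun w hw => (key w hw).2)

end Main

end SpecCalc

namespace SpecCalc

open Filter Topology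
open scoped ComplexConjugate

/-! ### Change of variables in the Helffer-Sjöstrand integral -/

section Transfer

/-- The strip `{Re z ∈ (s₀, s₁), |Im z| < b}`. -/
def strip (s₀ s₁ b : ℝ) : Set ℂ := {z : ℂ | z.re ∈ Set.Ioo s₀ s₁ ∧ |z.im| < b}

/-- The composition of `F` with `powMap`, on a strip. -/
noncomputable def stripComp (s₀ s₁ b c : ℝ) (m : ℕ) (F : ℂ → ℂ) : ℂ → ℂ :=
  (strip s₀ s₁ b).indicator fun z => F (powMap c m z)

variable {s₀ s₁ b c : ℝ} {m : ℕ} {F : ℂ → ℂ}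

theorem stripComp_eventuallyEq {z : ℂ} (hz : z ∈ strip s₀ s₁ b) :
    stripComp s₀ s₁ b c m F =ᶠ[𝓝 z] fun z => F (powMap c m z) := by
  filter_upwards [(isOpen_strip s₀ s₁ b).mem_nhds hz] with w hw
  exact Set.indicator_of_mem (s := strip s₀ s₁ b) hw _

/-- The image under the inverse map is compact, hence closed, and it contains every point where the
composition is non-zero. As it lies in the open strip, cutting off at the strip's boundary creates
no singularity. -/
theorem tsupport_stripComp_subset (hm : 1 ≤ m) (hstrip : ∀ z ∈ strip s₀ s₁ b, z + c ∈ sector m)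
    (hFc : HasCompactSupport F)
    (hF : ∀ w ∈ tsupport F, 0 < w.re ∧ powInv c m w ∈ strip s₀ s₁ b) :
    IsCompact (powInv c m '' tsupport F) ∧
      tsupport (stripComp s₀ s₁ b c m F) ⊆ powInv c m '' tsupport F := by
  have hK : IsCompact (powInv c m '' tsupport F) :=
    IsCompact.image_of_continuousOn hFc (continuousOn_powInv.mono fun w hw => (hF w hw).1)
  refine ⟨hK, closure_minimal (fun z hz => ?_) hK.isClosed⟩
  have hz' := Set.mem_of_indicator_ne_zero hz
  rw [Function.mem_support, stripComp, Set.indicator_of_mem hz'] at hz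
  exact ⟨_, subset_tsupport _ hz, powInv_powMap hm (hstrip z hz')⟩

theorem tsupport_stripComp_subset_strip (hm : 1 ≤ m)
    (hstrip : ∀ z ∈ strip s₀ s₁ b, z + c ∈ sector m) (hFc : HasCompactSupport F)
    (hF : ∀ w ∈ tsupport F, 0 < w.re ∧ powInv c m w ∈ strip s₀ s₁ b) :
    tsupport (stripComp s₀ s₁ b c m F) ⊆ strip s₀ s₁ b := by
  refine (tsupport_stripComp_subset hm hstrip hFc hF).2.trans ?_
  rintro _ ⟨w, hw, rfl⟩
  exact (hF w hw).2

theorem contDiff_stripComp (hm : 1 ≤ m) (hstrip : ∀ z ∈ strip s₀ s₁ b, z + c ∈ sector m)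
    (hFc : HasCompactSupport F) (hF1 : ContDiff ℝ 1 F)
    (hF : ∀ w ∈ tsupport F, 0 < w.re ∧ powInv c m w ∈ strip s₀ s₁ b) :
    ContDiff ℝ 1 (stripComp s₀ s₁ b c m F) := by
  refine contDiff_iff_contDiffAt.2 fun z => ?_
  by_cases hz : z ∈ strip s₀ s₁ b
  · refine ContDiffAt.congr_of_eventuallyEq ?_ (stripComp_eventuallyEq hz)
    have h0 : (z + c) ^ m ≠ 0 := pow_ne_zero m (sector_ne_zero (hstrip z hz))
    exact hF1.contDiffAt.comp z (ContDiffAt.inv (by fun_prop) h0)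
  · have h1 : z ∉ tsupport (stripComp s₀ s₁ b c m F) := fun h =>
      hz (tsupport_stripComp_subset_strip hm hstrip hFc hF h)
    have h2 : stripComp s₀ s₁ b c m F =ᶠ[𝓝 z] fun _ => 0 := by
      filter_upwards [(isClosed_tsupport _).isOpen_compl.mem_nhds h1] with x hx
      exact image_eq_zero_of_notMem_tsupport hx
    exact contDiffAt_const.congr_of_eventuallyEq h2

theorem dbar_stripComp (hstrip : ∀ z ∈ strip s₀ s₁ b, z + c ∈ sector m) (hF1 : ContDiff ℝ 1 F)
    {z : ℂ} (hz : z ∈ strip s₀ s₁ b) :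
    dbar (stripComp s₀ s₁ b c m F) z =
      conj (-(m : ℂ) * (z + c)⁻¹ ^ (m + 1)) * dbar F (powMap c m z) := by
  rw [dbar_congr (stripComp_eventuallyEq hz)]
  exact dbar_comp (hF1.differentiable (by simp) _)
    (hasDerivAt_powMap (sector_ne_zero (hstrip z hz)))

theorem exists_bound_dbar_stripComp (hm : 1 ≤ m) (h0 : 0 < s₀ + c)
    (hstrip : ∀ z ∈ strip s₀ s₁ b, z + c ∈ sector m)
    (hFc : HasCompactSupport F) (hF1 : ContDiff ℝ 1 F)
    (hF : ∀ w ∈ tsupport F, 0 < w.re ∧ powInv c m w ∈ strip s₀ s₁ b) {N : ℕ}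
    (hN : ∃ C, 0 ≤ C ∧ ∀ z, ‖dbar F z‖ ≤ C * |z.im| ^ N) :
    ∃ C, 0 ≤ C ∧ ∀ z, ‖dbar (stripComp s₀ s₁ b c m F) z‖ ≤ C * |z.im| ^ N := by
  obtain ⟨C, hC0, hC⟩ := hN
  set L : ℝ := m * (s₀ + c)⁻¹ ^ (m + 1) with hL
  have hL0 : 0 ≤ L := by positivity
  refine ⟨L * (C * L ^ N), by positivity, fun z => ?_⟩
  by_cases hz : z ∈ strip s₀ s₁ b
  · rw [dbar_stripComp hstrip hF1 hz, norm_mul, RCLike.norm_conj]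
    have h1 := norm_deriv_powMap_le (m := m) h0 hz.1.1.le
    have h2 := abs_im_powMap_le (m := m) h0 hz.1.1.le
    calc _ ≤ L * (C * (L * |z.im|) ^ N) := by
          refine mul_le_mul h1 ((hC _).trans ?_) (norm_nonneg _) hL0
          gcongr
      _ = _ := by ring
  · rw [dbar_eq_zero_of_notMem fun h =>
      hz (tsupport_stripComp_subset_strip hm hstrip hFc hF h), norm_zero]
    positivity

variable {E : Type*} [NormedAddCommGroup E] [InnerProductSpace ℂ E] [CompleteSpace E]

/-- The change of variables `w = (z + c)^{-m}` in the Helffer-Sjöstrand integral. -/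
theorem integral_dbar_smul_res_invPow {A : E →ₗ.[ℂ] E} (hc : -(c : ℂ) ∈ rho A) (hm : 1 ≤ m)
    (hsec : ∀ z : ℂ, z ∉ rho A → z + c ∈ sector m)
    (hstrip : ∀ z ∈ strip s₀ s₁ b, z + c ∈ sector m)
    (hrho : ∀ z ∈ strip s₀ s₁ b, z.im ≠ 0 → z ∈ rho A)
    (hFc : HasCompactSupport F) (hF1 : ContDiff ℝ 1 F)
    (hF : ∀ w ∈ tsupport F, 0 < w.re ∧ powInv c m w ∈ strip s₀ s₁ b)
    (hint : Integrable fun z => dbar (stripComp s₀ s₁ b c m F) z • res A z) :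
    ∫ w, dbar F w • res (ofBounded (invPow A c m)) w =
      ∫ z, dbar (stripComp s₀ s₁ b c m F) z • res A z := by
  obtain ⟨G, Y, hG, -, hres⟩ := exists_res_invPow hc hm hsec
  have hW : IsOpen (strip s₀ s₁ b) := isOpen_strip s₀ s₁ b
  have hGW : DifferentiableOn ℂ G (strip s₀ s₁ b) := hG.mono hstrip
  have hsub := tsupport_stripComp_subset_strip hm hstrip hFc hF
  have hcs : HasCompactSupport (stripComp s₀ s₁ b c m F) := by
    obtain ⟨h1, h2⟩ := tsupport_stripComp_subset hm hstrip hFc hF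
    exact h1.of_isClosed_subset (isClosed_tsupport _) h2
  have hF1' := contDiff_stripComp hm hstrip hFc hF1 hF
  have hzero := integral_dbar_smul_eq_zero hW hF1' hcs hsub hGW
  have hintG : Integrable fun z => dbar (stripComp s₀ s₁ b c m F) z • G z :=
    integrable_smul_of_tsupport_subset hW (continuous_dbar hF1') (hasCompactSupport_dbar hcs)
      ((tsupport_dbar_subset _).trans hsub) hGW.continuousOn
  have hinj : Set.InjOn (powMap c m) (strip s₀ s₁ b) := fun z hz w hw h => by
    rw [← powInv_powMap hm (hstrip z hz), h, powInv_powMap hm (hstrip w hw)]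
  have h1 : ∫ w, dbar F w • res (ofBounded (invPow A c m)) w =
      ∫ w in powMap c m '' strip s₀ s₁ b, dbar F w • res (ofBounded (invPow A c m)) w := by
    symm
    apply setIntegral_eq_integral_of_forall_compl_eq_zero
    intro w hw
    rw [dbar_eq_zero_of_notMem, zero_smul]
    intro hw'
    obtain ⟨h2, h3⟩ := hF w hw'
    have h4 : w ≠ 0 := by rintro rfl; simp at h2
    exact hw ⟨_, h3, powMap_powInv hm h4⟩
  rw [h1, integral_image_eq_integral_abs_det_fderiv_smul volume hW.measurableSet
    (fun z hz => ((hasDerivAt_powMap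
      (sector_ne_zero (hstrip z hz))).hasFDerivAt.restrictScalars ℝ).hasFDerivWithinAt) hinj]
  have h5 : ∫ z in strip s₀ s₁ b, (dbar (stripComp s₀ s₁ b c m F) z • res A z +
      dbar (stripComp s₀ s₁ b c m F) z • G z) = ∫ z, dbar (stripComp s₀ s₁ b c m F) z • res A z := by
    rw [setIntegral_eq_integral_of_forall_compl_eq_zero, integral_add hint hintG, hzero, add_zero]
    intro z hz
    rw [dbar_eq_zero_of_notMem fun h => hz (hsub h), zero_smul, zero_smul, add_zero]
  rw [← h5]
  refine setIntegral_congr_ae hW.measurableSet ?_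
  filter_upwards [ae_im_ne_zero] with z hz0 hz
  obtain ⟨-, -, h6⟩ := hres z (hrho z hz hz0) (hstrip z hz)
  -- The Jacobian is `conj φ' * φ'`: one factor belongs to `∂̄(F ∘ φ)`, the other to the resolvent
  -- formula `h6`.
  rw [det_restrictScalars_toSpanSingleton, abs_of_nonneg (Complex.normSq_nonneg _), ← smul_add, ← h6,
    dbar_stripComp hstrip hF1 hz, smul_smul, ← Complex.coe_smul, smul_smul, Complex.normSq_eq_conj_mul_self]
  congr 1
  ring

/-- The composition of the almost analytic extension of `f` with `powMap` is an almost analytic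
extension of the pullback of `f`. -/
theorem exists_bound_stripComp_sub (hb : 0 < b) (h0 : 0 < s₀ + c) {f : ℝ → ℂ}
    (hf : ContDiff ℝ ∞ f) (hfc : HasCompactSupport f)
    (hg : tsupport (pullback s₀ s₁ c m f) ⊆ Set.Ioo s₀ s₁) {τ σ : ℝ → ℂ} (hτ : IsCutoff τ)
    (hσ : IsCutoff σ) (N : ℕ) :
    ∃ ε > 0, ∃ C, ∀ z : ℂ, |z.im| < ε →
      ‖stripComp s₀ s₁ b c m (almostAnalytic N τ f) z -
        almostAnalytic N σ (pullback s₀ s₁ c m f) z‖ ≤ C * |z.im| ^ (N + 1) := by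
  obtain ⟨ε₁, hε₁, h₁⟩ := hτ.exists_almostAnalytic_eq
  obtain ⟨ε₂, hε₂, h₂⟩ := hσ.exists_almostAnalytic_eq
  set L : ℝ := m * (s₀ + c)⁻¹ ^ (m + 1) with hL
  have hL0 : 0 ≤ L := by positivity
  have hhalf : IsOpen {z : ℂ | -c < z.re} := isOpen_lt continuous_const Complex.continuous_re
  have hne : ∀ z ∈ {z : ℂ | -c < z.re}, z + (c : ℂ) ≠ 0 := fun z hz h => by
    have := congrArg Complex.re h
    simp only [Complex.add_re, Complex.ofReal_re, Complex.zero_re] at this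
    have hz' : -c < z.re := hz
    linarith
  obtain ⟨C, hC0, hC⟩ := exists_bound_taylorExt_comp (φ := powMap c m) (L := L) hhalf
    (isCompact_rect s₀ s₁ b)
    (fun z hz => by
      have h1 : s₀ ≤ z.re := hz.1.1
      change -c < z.re
      linarith)
    (fun z hz t ht => by
      refine ⟨hz.1, ?_⟩
      have h1 : (0 : ℝ) ∈ Set.Icc (-b) b := ⟨by linarith, hb.le⟩
      exact Set.uIcc_subset_Icc h1 hz.2 ht)
    (fun z hz => (hasDerivAt_powMap (hne z hz)).differentiableAt.differentiableWithinAt)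
    (fun x _ => powMap_ofReal_im x)
    (fun z hz => abs_im_powMap_le h0 hz.1.1) (N + 1) f hf hfc (fun _ => 1)
    (differentiableOn_const _)
  -- The third bound makes `|Im φ z| < ε₁`, so that the cut-off `τ` is `1` at the image point; `L +
  -- 1` avoids dividing by `L = 0`.
  refine ⟨min (min b ε₂) (ε₁ / (L + 1)), by positivity, C, fun z hz => ?_⟩
  rw [lt_min_iff, lt_min_iff] at hz
  obtain ⟨⟨hzb, hz2⟩, hz1⟩ := hz
  rw [h₂ _ _ _ hz2]
  by_cases hzI : z.re ∈ Set.Ioo s₀ s₁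
  · have hzs : z ∈ strip s₀ s₁ b := ⟨hzI, hzb⟩
    have h3 : |(powMap c m z).im| < ε₁ := by
      refine (abs_im_powMap_le h0 hzI.1.le).trans_lt ?_
      rw [lt_div_iff₀ (by positivity)] at hz1
      nlinarith [abs_nonneg z.im]
    rw [stripComp, Set.indicator_of_mem hzs, h₁ _ _ _ h3]
    have h4 : pullback s₀ s₁ c m f =ᶠ[𝓝 z.re] fun x : ℝ => 1 * f (powMap c m x).re := by
      filter_upwards [isOpen_Ioo.mem_nhds hzI] with x hx
      rw [pullback, Set.indicator_of_mem hx, powMap_ofReal_re, one_mul]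
    rw [taylorExt_congr h4]
    have h5 := hC z ⟨Set.Ioo_subset_Icc_self hzI, abs_le.1 hzb.le⟩
    rwa [one_mul] at h5
  · have hzs : z ∉ strip s₀ s₁ b := fun h => hzI h.1
    rw [stripComp, Set.indicator_of_notMem hzs, taylorExt_eq_zero (fun h => hzI (hg h)), sub_zero,
      norm_zero]
    positivity

/-- The functional calculi of `(A + c)^{-m}` and `A` are compatible. -/
theorem exists_hasFunctionalCalculus_invPow {A : E →ₗ.[ℂ] E} (hc : -(c : ℂ) ∈ rho A) (hm : 1 ≤ m)
    (hsec : ∀ z : ℂ, z ∉ rho A → z + c ∈ sector m) (hs : s₀ < s₁) (h0 : 0 < s₀ + c)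
    (hstrip : ∀ z : ℂ, s₀ ≤ z.re → |z.im| ≤ 1 → z + c ∈ sector m) {n : ℝ}
    (hev : ∀ z : ℂ, z.im ≠ 0 → IsEigenvalue A z ∨ z ∈ rho A)
    (h : ResolventEstimate A (Set.Ioo s₀ s₁) n) {r₀ r₁ : ℝ}
    (hr₀ : ((s₁ + c) ^ m)⁻¹ < r₀) (hr₁ : r₁ < ((s₀ + c) ^ m)⁻¹) {f : ℝ → ℂ}
    (hf : IsTestFunction (Set.Ioo r₀ r₁) f) :
    ∃ B : E →L[ℂ] E,
      HasFunctionalCalculus (ofBounded (invPow A c m)) (Set.Ioo r₀ r₁) n f B ∧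
        HasFunctionalCalculus A (Set.Ioo s₀ s₁) n (pullback s₀ s₁ c m f) B := by
  have hR := resolventEstimate_invPow hc hm hsec hs h0 hstrip h hr₀ hr₁
  have hevR : ∀ w : ℂ, w.im ≠ 0 → w.re ∈ Set.Ioo r₀ r₁ →
      IsEigenvalue (ofBounded (invPow A c m)) w ∨ w ∈ rho (ofBounded (invPow A c m)) :=
    fun w hw _ => isEigenvalue_or_mem_rho_invPow hc hm hev hw
  have hg := isTestFunction_pullback (s₀ := s₀) h0 hr₀ hr₁ hf
  obtain ⟨a, ha, -, -, hsub, -⟩ := h.exists_bound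
  have hb : 0 < min a 1 := by positivity
  obtain ⟨a', ha', hinv⟩ := exists_powInv_mem_strip (c := c) hm h0 hs hr₀ hr₁ hb
  have hBpos : 0 < 1 + (|r₀| + |r₁|) := by positivity
  -- One convenient `τ` suffices, since the calculus does not depend on it. This one is so narrow
  -- that the support of the extension stays below height `a'`, inside the domain of the change of
  -- variables.
  obtain ⟨τ, hτ, hτs⟩ := hR.exists_isAdmissible (δ := a' / 2 / (1 + (|r₀| + |r₁|))) (by positivity)
  obtain ⟨σ, hσ, -⟩ := h.exists_isAdmissible one_pos
  obtain ⟨N, hN⟩ := exists_nat_gt n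
  have hstrip' : ∀ z ∈ strip s₀ s₁ (min a 1), z + c ∈ sector m := fun z hz =>
    hstrip z hz.1.1.le (hz.2.le.trans (min_le_right _ _))
  have hrho : ∀ z ∈ strip s₀ s₁ (min a 1), z.im ≠ 0 → z ∈ rho A := fun z hz hz0 =>
    hsub ⟨hz.1, abs_pos.2 hz0, hz.2.trans_le (min_le_left _ _)⟩
  have hF1 : ContDiff ℝ 1 (almostAnalytic N τ f) :=
    (contDiff_almostAnalytic hτ.1 hf.1 N).of_le (by simp)
  have hFc : HasCompactSupport (almostAnalytic N τ f) :=
    hasCompactSupport_almostAnalytic hτ.1 hf.2.1 N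
  have hF : ∀ w ∈ tsupport (almostAnalytic N τ f),
      0 < w.re ∧ powInv c m w ∈ strip s₀ s₁ (min a 1) := by
    intro w hw
    obtain ⟨h1, h2⟩ := tsupport_almostAnalytic_subset N τ f hw
    have h3 := hf.2.2 h1
    refine hinv w (Set.Ioo_subset_Icc_self h3) ?_
    have h4 : |w.im| ≤ _ := tsupport_chi_subset hτs h2
    refine h4.trans_lt ?_
    calc a' / 2 / (1 + (|r₀| + |r₁|)) * bracket w.re
        ≤ a' / 2 / (1 + (|r₀| + |r₁|)) * (1 + (|r₀| + |r₁|)) := by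
          gcongr
          exact bracket_le_of_mem h3
      _ = a' / 2 := by field_simp
      _ < a' := by linarith
  have hsub' := tsupport_stripComp_subset_strip hm hstrip' hFc hF
  have hAA : IsAlmostAnalytic A (Set.Ioo s₀ s₁) N
      (stripComp s₀ s₁ (min a 1) c m (almostAnalytic N τ f)) :=
    { contDiff := contDiff_stripComp hm hstrip' hFc hF1 hF
      hasCompactSupport := by
        obtain ⟨h1, h2⟩ := tsupport_stripComp_subset hm hstrip' hFc hF
        exact h1.of_isClosed_subset (isClosed_tsupport _) h2
      re_mem := fun z hz => (hsub' hz).1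
      mem_rho := fun z hz hz0 => hrho z (hsub' hz) hz0
      exists_bound := exists_bound_dbar_stripComp hm h0 hstrip' hFc hF1 hF
        (exists_bound_dbar_almostAnalytic hτ.1 hf.1 hf.2.1 N) }
  obtain ⟨ε, hε, C, hC⟩ := exists_bound_stripComp_sub (b := min a 1) hb h0 hf.1 hf.2.1 hg.2.2
    hτ.1 hσ.1 N
  have key : ∫ w, hsIntegrand (ofBounded (invPow A c m)) N τ f w =
      ∫ z, hsIntegrand A N σ (pullback s₀ s₁ c m f) z := by
    refine (integral_dbar_smul_res_invPow hc hm hsec hstrip' hrho hFc hF1 hF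
      (hAA.integrable h hN)).trans ?_
    exact hAA.integral_eq h hN
      (isAlmostAnalytic_almostAnalytic (fun z hz _ => hev z hz) hσ hg N) hε hC
  refine ⟨_, hasFunctionalCalculus_of_resolventEstimate hR hevR hf hN hτ, ?_⟩
  rw [key]
  exact hasFunctionalCalculus_of_resolventEstimate h (fun z hz _ => hev z hz) hg hN hσ

end Transfer

end SpecCalc

/-! ### Choice of the shift and conclusion -/

theorem mainTheorem8 {E : Type*} [NormedAddCommGroup E] [InnerProductSpace ℂ E]
    [CompleteSpace E] [TopologicalSpace.SeparableSpace E]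
    (H₀ : E →ₗ.[ℂ] E) (hH₀ : IsSelfAdjoint H₀) (hbelow : SpecCalc.BoundedFromBelow H₀)
    (V : E →L[ℂ] E) (hV : SpecCalc.RelativelyCompact V H₀)
    (H : E →ₗ.[ℂ] E) (hH : H = SpecCalc.perturb H₀ V)
    (s₀ s₁ : ℝ) (hs : s₀ < s₁) (n : ℝ)
    (h1 : SpecCalc.FiniteNonrealEigenvalues H (Set.Ioo s₀ s₁))
    (h2 : SpecCalc.ResolventEstimate H (Set.Ioo s₀ s₁) n)
    (m : ℕ) (hm : 1 ≤ m) :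
    ∃ c : ℝ, 0 < c ∧ 0 < s₀ + c ∧ -(c : ℂ) ∈ SpecCalc.rho H ∧
      ∀ r₀ r₁ : ℝ, ((s₁ + c) ^ m)⁻¹ < r₀ → r₀ < r₁ → r₁ < ((s₀ + c) ^ m)⁻¹ →
        SpecCalc.FiniteNonrealEigenvalues
            (SpecCalc.ofBounded (SpecCalc.invPow H c m)) (Set.Ioo r₀ r₁) ∧
          SpecCalc.ResolventEstimate
            (SpecCalc.ofBounded (SpecCalc.invPow H c m)) (Set.Ioo r₀ r₁) n ∧
          ∀ f : ℝ → ℂ, SpecCalc.IsTestFunction (Set.Ioo r₀ r₁) f →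
            SpecCalc.IsTestFunction (Set.Ioo s₀ s₁) (SpecCalc.pullback s₀ s₁ c m f) ∧
              ∃ B : E →L[ℂ] E,
                SpecCalc.HasFunctionalCalculus
                    (SpecCalc.ofBounded (SpecCalc.invPow H c m)) (Set.Ioo r₀ r₁) n f B ∧
                  SpecCalc.HasFunctionalCalculus H (Set.Ioo s₀ s₁) n
                    (SpecCalc.pullback s₀ s₁ c m f) B := by
  subst hH
  obtain ⟨γ, hγ⟩ := hbelow
  -- One half-strip that contains both the spectrum of `H` (real part at least `γ - ‖V‖`, height at
  -- most `‖V‖`) and the strip of height `1` over `I`.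
  obtain ⟨c₀, hc₀⟩ := SpecCalc.exists_forall_mem_sector m hm (min s₀ (γ - ‖V‖)) (‖V‖ + 1)
  -- The four bounds give, in order: the sector condition, `c > 0`, `s₀ + c > 0`, and `-c` to the
  -- left of the half-strip that contains the spectrum.
  obtain ⟨c, hcc₀, hc1, hcs, hcγ⟩ : ∃ c : ℝ, c₀ ≤ c ∧ 1 ≤ c ∧ 1 - s₀ ≤ c ∧ ‖V‖ - γ + 1 ≤ c :=
    ⟨max (max c₀ 1) (max (1 - s₀) (‖V‖ - γ + 1)), by simp, by simp, by simp, by simp⟩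
  have h0 : 0 < s₀ + c := by linarith
  obtain ⟨hcρ₀, hcρ⟩ := SpecCalc.mem_rho_perturb_of_norm_lt hH₀ hγ V (z := -(c : ℂ)) (Or.inl (by
    rw [Complex.neg_re, Complex.ofReal_re]
    linarith))
  have hVn := norm_nonneg V
  have hsec : ∀ z : ℂ, z ∉ SpecCalc.rho (SpecCalc.perturb H₀ V) → z + c ∈ SpecCalc.sector m := by
    intro z hz
    have h3 : ¬(‖V‖ < γ - z.re ∨ ‖V‖ < |z.im|) := fun h =>
      hz (SpecCalc.mem_rho_perturb_of_norm_lt hH₀ hγ V h).2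
    push Not at h3
    exact hc₀ c hcc₀ z ((min_le_right _ _).trans (by linarith [h3.1])) (by linarith [h3.2])
  have hstrip : ∀ z : ℂ, s₀ ≤ z.re → |z.im| ≤ 1 → z + c ∈ SpecCalc.sector m := fun z hz1 hz2 =>
    hc₀ c hcc₀ z ((min_le_left _ _).trans hz1) (by linarith)
  have hev : ∀ z : ℂ, z.im ≠ 0 → SpecCalc.IsEigenvalue (SpecCalc.perturb H₀ V) z ∨
      z ∈ SpecCalc.rho (SpecCalc.perturb H₀ V) := fun z hz =>
    or_iff_not_imp_left.2 fun he => SpecCalc.mem_rho_perturb_of_not_isEigenvalue hV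
      (SpecCalc.mem_rho_of_im_ne_zero hH₀ hz) he
  refine ⟨c, by linarith, h0, hcρ, fun r₀ r₁ hr₀ _ hr₁ => ?_⟩
  have hR := SpecCalc.resolventEstimate_invPow hcρ hm hsec hs h0 hstrip h2 hr₀ hr₁
  refine ⟨?_, hR, fun f hf => ⟨SpecCalc.isTestFunction_pullback h0 hr₀ hr₁ hf,
    SpecCalc.exists_hasFunctionalCalculus_invPow hcρ hm hsec hs h0 hstrip hev h2 hr₀ hr₁ hf⟩⟩
  -- The tube over `J` lies in the resolvent set, so non-real eigenvalues over `J` have `|Im| ≥ a`,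
  -- and only finitely many such exist.
  obtain ⟨-, a, ha, -, -, hsub, -⟩ := hR
  refine (SpecCalc.finite_eigenvalues_invPow hH₀ hV hcρ₀ hcρ m ha).subset ?_
  rintro lam ⟨hlam, him, hre⟩
  refine ⟨hlam, ?_⟩
  by_contra hlt
  exact hlam.notMem_rho (hsub ⟨hre, abs_pos.2 him, not_le.1 hlt⟩)
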